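/- Let $X$ be a paracompact Hausdorff space with a continuous involution $x\mapsto\bar x$, and let $G=\{1,\tau\}$ act on $X$ by it. Let $A$ be a unital $C^*$-algebra over $\mathbb{R}$ (a Banach $*$-algebra over $\mathbb{R}$ that is $*$-isometrically isomorphic to a norm-closed subalgebra of the bounded operators on a real Hilbert space). Let $\mathcal{A}$ be a Real bundle of $*$-algebras on $X$ with fibre $A$: a locally trivial bundle of $*$-algebras with fibre $A$, with an involution of its total space that restricts to $*$-algebra homomorphisms $\mathcal{A}_x\to\mathcal{A}_{\bar x}$, $a\mapsto\bar a$ (for example $X\times A$ with $\overline{(x,a)}=(\bar x,\bar a)$, if $\tau$ is an involution $a\mapsto\bar a$ of the $*$-algebra $A$). For a Real algebra bundle $\mathcal{B}$ (the same notion without $*$), a Real $\mathcal{B}$-bundle is a locally trivial bundle $E$ of finitely generated projective left $\mathcal{B}$-modules on $X$, with $\mathcal B\times_XE\to E$ continuous, together with an involution of $E$ that maps $E_x$ additively to $E_{\bar x}$ and satisfies $\overline{be}=\bar b\,\bar e$. Let $KR^{\mathcal{B}}(X)$ be the Grothendieck group of the monoid of isomorphism classes of Real $\mathcal{B}$-bundles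 under direct sum. For $\varepsilon=\pm1$, an $\varepsilon$-symmetric form on a Real $\mathcal{A}$-bundle $E$ is an isomorphism $\varphi:E\to E^*=\operatorname{Hom}_{\mathcal A}(E,\mathcal A)$ of Real $\mathcal{A}$-bundles with $\varphi(y)(x)=\varepsilon\,\varphi(x)(y)^*$, where $E^*$ has the module structure $(af)(e)=f(e)a^*$ and the involution $\bar f(\bar e)=\overline{f(e)}$. Let ${}_{\varepsilon}GR^{\mathcal{A}}(X)$ be the Grothendieck group of the monoid of isometry classes of pairs $(E,\varphi)$ under orthogonal sum. A metric on $E$ is a symmetric ($\varepsilon=+1$) form $\psi$ such that every $\psi(e)(e)$ has the form $b^*b$. Let $\mathcal{A}'=\mathcal{A}\otimes_{\mathbb{R}}\mathbb{R}[t]/(t^2=\varepsilon)$, with the involution fixing $t$. Then there is a canonical isomorphism $${}_{\varepsilon}GR^{\mathcal{A}}(X)\;\cong\;KR^{\mathcal{A}'}(X).$$ More precisely, there is exactly one isomorphism $\Phi$ between these groups such that $\Phi[E,\varphi]=[F]$ whenever $F$ is a Real $\mathcal{A}'$-bundle, $E$ is (isomorphic to) its underlying Real $\mathcal{A}$-bundle,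 and there is a metric $\psi$ on $E$ with $\varphi(e)=\psi(te)$ for all $e\in E$. Moreover, as Real algebra bundles, $\mathcal{A}'\cong\mathcal{A}\times\mathcal{A}$ if $\varepsilon=+1$, and $\mathcal{A}'\cong\mathcal{A}\otimes_{\mathbb{R}}\mathbb{C}$ if $\varepsilon=-1$, where the involution is trivial on $\mathbb{C}$. -/

import Mathlib

open scoped TensorProduct Polynomial Topology

namespace TwistedK

universe u v

variable {X : Type v}

/-! ### Total spaces of families and fibrewise trivializations -/

/-- The total space of a family `E` of types over `X`. -/
abbrev Tot (E : X → Type u) : Type (max u v) := Bundle.TotalSpace Unit E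

/-- The total space of the fibre product `E ×_X F`, mapped to the product of total spaces. -/
def Tot.pair {E F : X → Type u} (p : Tot fun x => E x × F x) : Tot E × Tot F :=
  (⟨p.proj, p.snd.1⟩, ⟨p.proj, p.snd.2⟩)

/-- The topology on `E ×_X F` as a subspace of the product of the total spaces. -/
abbrev fibProdTop {E F : X → Type u} (tE : TopologicalSpace (Tot E))
    (tF : TopologicalSpace (Tot F)) : TopologicalSpace (Tot fun x => E x × F x) :=
  TopologicalSpace.induced Tot.pair inferInstance

/-- A family of bijections `g y : E y ≃ F`, for `y ∈ U`, that is a trivialization of `E` over `U`: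
the induced bijection of the part of the total space over `U` with `U × F` is continuous in both
directions (the component in `U` is the projection, whose continuity is required
separately). -/
def IsTrivialization [TopologicalSpace X] {E : X → Type u} (tE : TopologicalSpace (Tot E))
    {F : Type u} [TopologicalSpace F] (U : Set X) (g : ∀ y : U, E y ≃ F) : Prop :=
  Continuous (fun p : {p : Tot E // p.proj ∈ U} => g ⟨p.1.proj, p.2⟩ p.1.snd) ∧
  Continuous (fun q : U × F => (⟨q.1.1, (g q.1).symm q.2⟩ : Tot E))

theorem mk_prod_eq {E F : X → Type u} {x y : X} {e : E x} {e' : E y} {f : F x} {f' : F y}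
    (h : (⟨x, e⟩ : Tot E) = ⟨y, e'⟩) (h' : (⟨x, f⟩ : Tot F) = ⟨y, f'⟩) :
    (⟨x, (e, f)⟩ : Tot fun x => E x × F x) = ⟨y, (e', f')⟩ := by
  cases h
  cases h'
  rfl

theorem tensor_map_eq {E : X → Type u} [∀ x, Ring (E x)] [∀ x, Algebra ℝ (E x)] {B : Type}
    [Ring B] [Algebra ℝ B] {x y : X} (hxy : y = x) (φ : E x →ₐ[ℝ] E y)
    (h : ∀ a, (⟨y, φ a⟩ : Tot E) = ⟨x, a⟩) (z : E x ⊗[ℝ] B) :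
    (⟨y, Algebra.TensorProduct.map φ (AlgHom.id ℝ B) z⟩ : Tot fun x => E x ⊗[ℝ] B) = ⟨x, z⟩ := by
  subst hxy
  have : φ = AlgHom.id ℝ _ := by
    ext a
    exact Bundle.TotalSpace.mk_injective _ (h a)
  simp [this]

section lemmas

theorem continuous_toProd {E F : X → Type u} {tE : TopologicalSpace (Tot E)}
    {tF : TopologicalSpace (Tot F)} {Z : Type*} [TopologicalSpace Z]
    {f : Z → Tot fun x => E x × F x}
    (h1 : Continuous[_, tE] fun z => (⟨(f z).proj, (f z).snd.1⟩ : Tot E))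
    (h2 : Continuous[_, tF] fun z => (⟨(f z).proj, (f z).snd.2⟩ : Tot F)) :
    Continuous[_, fibProdTop tE tF] f :=
  continuous_induced_rng.2 (h1.prodMk h2)

theorem continuous_left {E F : X → Type u} (tE : TopologicalSpace (Tot E))
    (tF : TopologicalSpace (Tot F)) :
    Continuous[fibProdTop tE tF, tE] fun p => (⟨p.proj, p.snd.1⟩ : Tot E) := by
  let _ := fibProdTop tE tF
  exact continuous_fst.comp (continuous_induced_dom (f := Tot.pair (E := E) (F := F)))

theorem continuous_right {E F : X → Type u} (tE : TopologicalSpace (Tot E))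
    (tF : TopologicalSpace (Tot F)) :
    Continuous[fibProdTop tE tF, tF] fun p => (⟨p.proj, p.snd.2⟩ : Tot F) := by
  let _ := fibProdTop tE tF
  exact continuous_snd.comp (continuous_induced_dom (f := Tot.pair (E := E) (F := F)))

theorem IsTrivialization.mono [TopologicalSpace X] {E : X → Type u} {tE : TopologicalSpace (Tot E)}
    {F : Type u} [TopologicalSpace F] {U V : Set X} {g : ∀ y : U, E y ≃ F}
    (h : IsTrivialization tE U g) (hV : V ⊆ U) :
    IsTrivialization tE V (fun y => g ⟨y, hV y.2⟩) := by
  constructor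
  · exact h.1.comp (f := fun p : {p : Tot E // p.proj ∈ V} =>
      (⟨p.1, hV p.2⟩ : {p : Tot E // p.proj ∈ U})) (by fun_prop)
  · exact h.2.comp (f := fun q : V × F => ((⟨q.1, hV q.1.2⟩, q.2) : U × F)) (by fun_prop)

theorem IsTrivialization.prod [TopologicalSpace X] {E E' : X → Type u} {tE : TopologicalSpace (Tot E)}
    {tE' : TopologicalSpace (Tot E')}
    {F F' : Type u} [TopologicalSpace F] [TopologicalSpace F'] {U : Set X}
    {g : ∀ y : U, E y ≃ F} {g' : ∀ y : U, E' y ≃ F'}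
    (h : IsTrivialization tE U g) (h' : IsTrivialization tE' U g') :
    IsTrivialization (E := fun x => E x × E' x) (fibProdTop tE tE') U
      (fun y => (g y).prodCongr (g' y)) := by
  let _ := fibProdTop tE tE'
  constructor
  · refine Continuous.prodMk ?_ ?_
    · exact h.1.comp (f := fun p : {p : Tot (fun x => E x × E' x) // p.proj ∈ U} =>
        (⟨⟨p.1.proj, p.1.snd.1⟩, p.2⟩ : {p : Tot E // p.proj ∈ U}))
        (((continuous_left tE tE').comp continuous_subtype_val).subtype_mk _)
    · exact h'.1.comp (f := fun p : {p : Tot (fun x => E x × E' x) // p.proj ∈ U} =>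
        (⟨⟨p.1.proj, p.1.snd.2⟩, p.2⟩ : {p : Tot E' // p.proj ∈ U}))
        (((continuous_right tE tE').comp continuous_subtype_val).subtype_mk _)
  · apply continuous_toProd
    · exact h.2.comp (f := fun q : U × (F × F') => (q.1, q.2.1)) (by fun_prop)
    · exact h'.2.comp (f := fun q : U × (F × F') => (q.1, q.2.2)) (by fun_prop)

end lemmas

/-! ### Real algebra bundles -/

variable [TopologicalSpace X]

/-- A continuous involution of the space `X`. -/
structure Involution (X : Type v) [TopologicalSpace X] where
  toFun : X → X
  continuous : Continuous toFun
  involutive : Function.Involutive toFun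

instance : CoeFun (Involution X) fun _ => X → X := ⟨Involution.toFun⟩

variable {σ : Involution X}

/-- A Real algebra bundle with fibre the topological `ℝ`-algebra `A` on the space `X` with
involution `σ`: a locally trivial bundle of algebras isomorphic to `A`, given with a local
trivialization `triv x` around each point `x`, and an involution `bar` of the total space which
covers `σ` and is an algebra homomorphism on each fibre. -/
structure RealAlgBundle (σ : Involution X) (A : Type u) [Ring A] [Algebra ℝ A] [TopologicalSpace A] where
  fib : X → Type u
  [ring : ∀ x, Ring (fib x)]
  [algebra : ∀ x, Algebra ℝ (fib x)]
  top : TopologicalSpace (Tot fib)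
  continuous_proj : Continuous fun p : Tot fib => p.proj
  base : X → Set X
  isOpen_base : ∀ x, IsOpen (base x)
  mem_base : ∀ x, x ∈ base x
  triv : ∀ (x : X) (y : base x), fib y ≃ₐ[ℝ] A
  isTrivialization : ∀ x, IsTrivialization top (base x) fun y => (triv x y).toEquiv
  bar : ∀ x, fib x →ₐ[ℝ] fib (σ x)
  bar_bar : ∀ x (a : fib x), (⟨σ (σ x), bar (σ x) (bar x a)⟩ : Tot fib) = ⟨x, a⟩
  continuous_bar : Continuous fun p : Tot fib => (⟨σ p.proj, bar p.proj p.snd⟩ : Tot fib)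

attribute [instance] RealAlgBundle.ring RealAlgBundle.algebra

/-- A Real bundle of `*`-algebras with fibre the `*`-algebra `A`: the trivializations and the
involution are compatible with `*`. -/
structure RealStarAlgBundle (σ : Involution X) (A : Type u) [Ring A] [Algebra ℝ A] [TopologicalSpace A]
    [StarRing A] extends RealAlgBundle σ A where
  [starRing : ∀ x, StarRing (fib x)]
  [starModule : ∀ x, StarModule ℝ (fib x)]
  triv_star : ∀ (x : X) (y : base x) (a : fib y), triv x y (star a) = star (triv x y a)
  bar_star : ∀ x (a : fib x), bar x (star a) = star (bar x a)

attribute [instance] RealStarAlgBundle.starRing RealStarAlgBundle.starModule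

section algebraBundles

variable {A A' : Type u} [Ring A] [Algebra ℝ A] [TopologicalSpace A]
  [Ring A'] [Algebra ℝ A'] [TopologicalSpace A']

/-- Isomorphisms of Real algebra bundles. -/
structure RealAlgBundle.Iso (𝒜 : RealAlgBundle σ A) (ℬ : RealAlgBundle σ A') where
  toEquiv : ∀ x, 𝒜.fib x ≃ₐ[ℝ] ℬ.fib x
  continuous_toFun : Continuous[𝒜.top, ℬ.top]
    fun p => (⟨p.proj, toEquiv p.proj p.snd⟩ : Tot ℬ.fib)
  continuous_invFun : Continuous[ℬ.top, 𝒜.top]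
    fun p => (⟨p.proj, (toEquiv p.proj).symm p.snd⟩ : Tot 𝒜.fib)
  map_bar : ∀ x (a : 𝒜.fib x), toEquiv (σ x) (𝒜.bar x a) = ℬ.bar x (toEquiv x a)

/-- The fibrewise product of two Real algebra bundles. -/
def RealAlgBundle.prod (𝒜 : RealAlgBundle σ A) (ℬ : RealAlgBundle σ A') :
    RealAlgBundle σ (A × A') where
  fib x := 𝒜.fib x × ℬ.fib x
  top := fibProdTop 𝒜.top ℬ.top
  continuous_proj := by
    let _ := 𝒜.top
    let _ := fibProdTop 𝒜.top ℬ.top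
    exact 𝒜.continuous_proj.comp (continuous_left 𝒜.top ℬ.top)
  base x := 𝒜.base x ∩ ℬ.base x
  isOpen_base x := (𝒜.isOpen_base x).inter (ℬ.isOpen_base x)
  mem_base x := ⟨𝒜.mem_base x, ℬ.mem_base x⟩
  triv x y := AlgEquiv.prodCongr (𝒜.triv x ⟨y, y.2.1⟩) (ℬ.triv x ⟨y, y.2.2⟩)
  isTrivialization x :=
    ((𝒜.isTrivialization x).mono Set.inter_subset_left).prod
      ((ℬ.isTrivialization x).mono Set.inter_subset_right)
  bar x := AlgHom.prodMap (𝒜.bar x) (ℬ.bar x)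
  bar_bar x a := mk_prod_eq (𝒜.bar_bar x a.1) (ℬ.bar_bar x a.2)
  continuous_bar := by
    let _ := 𝒜.top
    let _ := ℬ.top
    let _ := fibProdTop 𝒜.top ℬ.top
    exact continuous_toProd (𝒜.continuous_bar.comp (continuous_left 𝒜.top ℬ.top))
      (ℬ.continuous_bar.comp (continuous_right 𝒜.top ℬ.top))

/-! ### Tensor product with a finite-dimensional algebra -/

/-- For a linear functional `f` on `B`, the map `id ⊗ f : R ⊗ B → R`. -/
noncomputable def contract (R : Type u) [Ring R] [Algebra ℝ R] {B : Type} [Ring B] [Algebra ℝ B]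
    (f : B →ₗ[ℝ] ℝ) : R ⊗[ℝ] B →ₗ[ℝ] R :=
  (TensorProduct.rid ℝ R).toLinearMap ∘ₗ TensorProduct.map LinearMap.id f

theorem contract_map {R S : Type u} [Ring R] [Algebra ℝ R] [Ring S] [Algebra ℝ S] {B : Type}
    [Ring B] [Algebra ℝ B] (f : B →ₗ[ℝ] ℝ) (φ : R →ₐ[ℝ] S) (z : R ⊗[ℝ] B) :
    contract S f (Algebra.TensorProduct.map φ (AlgHom.id ℝ B) z) = φ (contract R f z) := by
  induction z using TensorProduct.induction_on with
  | zero => simp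
  | tmul a b => simp [contract]
  | add z w hz hw => simp only [map_add, hz, hw]

/-- The topology on `A ⊗ B` for finite-dimensional `B`: the coarsest one making all the maps
`id ⊗ f` continuous. In terms of a basis of `B` it is the product topology on `A ^ dim B`. -/
noncomputable instance tensorTopology (B : Type) [Ring B] [Algebra ℝ B] : TopologicalSpace (A ⊗[ℝ] B) :=
  ⨅ f : B →ₗ[ℝ] ℝ, TopologicalSpace.induced (contract A f) inferInstance

/-- The topology on the total space of `𝒜 ⊗ B` for finite-dimensional `B`: the coarsest one
making all the maps `id ⊗ f` to the total space of `𝒜` continuous. -/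
noncomputable abbrev RealAlgBundle.tensorTop (𝒜 : RealAlgBundle σ A) (B : Type) [Ring B] [Algebra ℝ B] :
    TopologicalSpace (Tot fun x => 𝒜.fib x ⊗[ℝ] B) :=
  ⨅ f : B →ₗ[ℝ] ℝ, TopologicalSpace.induced
    (fun p => (⟨p.proj, contract (𝒜.fib p.proj) f p.snd⟩ : Tot 𝒜.fib)) 𝒜.top

theorem RealAlgBundle.continuous_contract (𝒜 : RealAlgBundle σ A) (B : Type) [Ring B]
    [Algebra ℝ B] (f : B →ₗ[ℝ] ℝ) : Continuous[𝒜.tensorTop B, 𝒜.top]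
      fun p => (⟨p.proj, contract (𝒜.fib p.proj) f p.snd⟩ : Tot 𝒜.fib) :=
  continuous_iInf_dom (i := f) continuous_induced_dom

theorem continuous_contract_model (B : Type) [Ring B] [Algebra ℝ B] (f : B →ₗ[ℝ] ℝ) :
    Continuous (contract A f) :=
  continuous_iInf_dom (i := f) continuous_induced_dom

/-- The Real algebra bundle `𝒜 ⊗ B`, for a finite-dimensional algebra `B` on which the involution
is trivial. -/
noncomputable def RealAlgBundle.tensor (𝒜 : RealAlgBundle σ A) (B : Type) [Ring B] [Algebra ℝ B] :
    RealAlgBundle σ (A ⊗[ℝ] B) where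
  fib x := 𝒜.fib x ⊗[ℝ] B
  top := 𝒜.tensorTop B
  continuous_proj := by
    let _ := 𝒜.top
    let _ := 𝒜.tensorTop B
    exact 𝒜.continuous_proj.comp (𝒜.continuous_contract B 0)
  base := 𝒜.base
  isOpen_base := 𝒜.isOpen_base
  mem_base := 𝒜.mem_base
  triv x y := Algebra.TensorProduct.congr (𝒜.triv x y) AlgEquiv.refl
  isTrivialization x := by
    let _ := 𝒜.top
    let _ := 𝒜.tensorTop B
    constructor
    · refine continuous_iInf_rng.2 fun f => continuous_induced_rng.2 ?_
      have h := (𝒜.isTrivialization x).1.comp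
        (f := fun p : {p : Tot (fun x => 𝒜.fib x ⊗[ℝ] B) // p.proj ∈ 𝒜.base x} =>
          (⟨⟨p.1.proj, contract _ f p.1.snd⟩, p.2⟩ : {p : Tot 𝒜.fib // p.proj ∈ 𝒜.base x}))
        (((𝒜.continuous_contract B f).comp continuous_subtype_val).subtype_mk _)
      refine h.congr fun p => ?_
      exact (contract_map f (𝒜.triv x ⟨p.1.proj, p.2⟩).toAlgHom p.1.snd).symm
    · refine continuous_iInf_rng.2 fun f => continuous_induced_rng.2 ?_
      have h := (𝒜.isTrivialization x).2.comp
        (f := fun q : 𝒜.base x × (A ⊗[ℝ] B) => (q.1, contract A f q.2))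
        (continuous_fst.prodMk ((continuous_contract_model B f).comp continuous_snd))
      refine h.congr fun q => ?_
      exact congrArg (Bundle.TotalSpace.mk _)
        (contract_map f (𝒜.triv x q.1).symm.toAlgHom q.2).symm
  bar x := Algebra.TensorProduct.map (𝒜.bar x) (AlgHom.id ℝ B)
  bar_bar x z := by
    have hx : σ (σ x) = x := congrArg Bundle.TotalSpace.proj (𝒜.bar_bar x 0)
    have h := tensor_map_eq (E := 𝒜.fib) hx ((𝒜.bar (σ x)).comp (𝒜.bar x)) (𝒜.bar_bar x) z
    rw [← h]
    congr 1
    rw [← AlgHom.comp_apply, ← Algebra.TensorProduct.map_comp, AlgHom.id_comp]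
  continuous_bar := by
    let _ := 𝒜.top
    let _ := 𝒜.tensorTop B
    refine continuous_iInf_rng.2 fun f => continuous_induced_rng.2 ?_
    refine (𝒜.continuous_bar.comp (𝒜.continuous_contract B f)).congr fun p => ?_
    exact congrArg (Bundle.TotalSpace.mk _) (contract_map f (𝒜.bar p.proj) p.snd).symm

/-- The algebra `ℝ[t]/(t² = ε)`. -/
abbrev RootAlg (ε : ℝ) : Type := AdjoinRoot (Polynomial.X ^ 2 - Polynomial.C ε : ℝ[X])

/-- The Real algebra bundle `𝒜 ⊗ ℝ[t]/(t² = ε)`. -/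
noncomputable abbrev RealAlgBundle.adjoinRoot (𝒜 : RealAlgBundle σ A) (ε : ℝ) :
    RealAlgBundle σ (A ⊗[ℝ] RootAlg ε) :=
  𝒜.tensor (RootAlg ε)

/-- The inclusion of the fibre of `𝒜` in that of `𝒜 ⊗ ℝ[t]/(t² = ε)`. -/
noncomputable def RealAlgBundle.inclRoot (𝒜 : RealAlgBundle σ A) (ε : ℝ) (x : X) (a : 𝒜.fib x) :
    (𝒜.adjoinRoot ε).fib x :=
  a ⊗ₜ[ℝ] (1 : RootAlg ε)

/-- The element `t` of the fibre of `𝒜 ⊗ ℝ[t]/(t² = ε)`. -/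
noncomputable def RealAlgBundle.root (𝒜 : RealAlgBundle σ A) (ε : ℝ) (x : X) :
    (𝒜.adjoinRoot ε).fib x :=
  (1 : 𝒜.fib x) ⊗ₜ[ℝ] (AdjoinRoot.root _ : RootAlg ε)

end algebraBundles

/-! ### Real `𝒜`-bundles and the group `KR` -/

section RealBundles

variable {A : Type u} [Ring A] [Algebra ℝ A] [TopologicalSpace A]

/-- A Real `𝒜`-bundle: a bundle of finitely generated projective left `𝒜`-modules, which is
around each point `x` isomorphic, over the trivialization of `𝒜` around `x`, to the product with
an `A`-module `P` (with its canonical topology), together with a twisted `𝒜`-linear involution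
`bar` of the total space covering `σ`. -/
structure RealBundle (𝒜 : RealAlgBundle σ A) where
  fib : X → Type u
  [addCommGroup : ∀ x, AddCommGroup (fib x)]
  [module : ∀ x, Module (𝒜.fib x) (fib x)]
  [finite : ∀ x, Module.Finite (𝒜.fib x) (fib x)]
  [projective : ∀ x, Module.Projective (𝒜.fib x) (fib x)]
  top : TopologicalSpace (Tot fib)
  continuous_proj : Continuous fun p : Tot fib => p.proj
  locally_trivial : ∀ x, ∃ (P : Type u) (_ : AddCommGroup P) (_ : Module A P)
    (_ : TopologicalSpace P) (_ : IsModuleTopology A P)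
    (U : Set X) (hU : U ⊆ 𝒜.base x) (g : ∀ y : U, fib y ≃+ P),
    IsOpen U ∧ x ∈ U ∧
    (∀ (y : U) (a : 𝒜.fib y) (e : fib y), g y (a • e) = 𝒜.triv x ⟨y, hU y.2⟩ a • g y e) ∧
    IsTrivialization top U fun y => (g y).toEquiv
  continuous_smul : Continuous[fibProdTop 𝒜.top top, top]
    fun p => (⟨p.proj, p.snd.1 • p.snd.2⟩ : Tot fib)
  bar : ∀ x, fib x →+ fib (σ x)
  bar_smul : ∀ x (a : 𝒜.fib x) (e : fib x), bar x (a • e) = 𝒜.bar x a • bar x e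
  bar_bar : ∀ x (e : fib x), (⟨σ (σ x), bar (σ x) (bar x e)⟩ : Tot fib) = ⟨x, e⟩
  continuous_bar : Continuous fun p : Tot fib => (⟨σ p.proj, bar p.proj p.snd⟩ : Tot fib)

attribute [instance] RealBundle.addCommGroup RealBundle.module RealBundle.finite
  RealBundle.projective

variable {𝒜 : RealAlgBundle σ A}

/-- Isomorphisms of Real `𝒜`-bundles. -/
structure RealBundle.Iso (E F : RealBundle 𝒜) where
  toEquiv : ∀ x, E.fib x ≃ₗ[𝒜.fib x] F.fib x
  continuous_toFun : Continuous[E.top, F.top]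
    fun p => (⟨p.proj, toEquiv p.proj p.snd⟩ : Tot F.fib)
  continuous_invFun : Continuous[F.top, E.top]
    fun p => (⟨p.proj, (toEquiv p.proj).symm p.snd⟩ : Tot E.fib)
  map_bar : ∀ x (e : E.fib x), toEquiv (σ x) (E.bar x e) = F.bar x (toEquiv x e)

namespace RealBundle

def Iso.refl (E : RealBundle 𝒜) : Iso E E where
  toEquiv _ := LinearEquiv.refl _ _
  continuous_toFun := @continuous_id _ E.top
  continuous_invFun := @continuous_id _ E.top
  map_bar _ _ := rfl

def Iso.symm {E F : RealBundle 𝒜} (i : Iso E F) : Iso F E where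
  toEquiv x := (i.toEquiv x).symm
  continuous_toFun := i.continuous_invFun
  continuous_invFun := i.continuous_toFun
  map_bar x e := by
    rw [LinearEquiv.symm_apply_eq, i.map_bar, LinearEquiv.apply_symm_apply]

def Iso.trans {E F G : RealBundle 𝒜} (i : Iso E F) (j : Iso F G) : Iso E G where
  toEquiv x := (i.toEquiv x).trans (j.toEquiv x)
  continuous_toFun := by
    let _ := E.top
    let _ := F.top
    let _ := G.top
    exact j.continuous_toFun.comp i.continuous_toFun
  continuous_invFun := by
    let _ := E.top
    let _ := F.top
    let _ := G.top
    exact i.continuous_invFun.comp j.continuous_invFun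
  map_bar x e := by simp [i.map_bar, j.map_bar]

/-- The Whitney sum of Real `𝒜`-bundles. -/
def sum (E F : RealBundle 𝒜) : RealBundle 𝒜 where
  fib x := E.fib x × F.fib x
  top := fibProdTop E.top F.top
  continuous_proj := by
    let _ := E.top
    let _ := fibProdTop E.top F.top
    exact E.continuous_proj.comp (continuous_left E.top F.top)
  locally_trivial x := by
    obtain ⟨P, _, _, _, _, U, hU, g, oU, xU, hg, tg⟩ := E.locally_trivial x
    obtain ⟨Q, _, _, _, _, V, hV, h, oV, xV, hh, th⟩ := F.locally_trivial x
    refine ⟨P × Q, inferInstance, inferInstance, inferInstance, inferInstance, U ∩ V,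
      fun y hy => hU hy.1, fun y => (g ⟨y, y.2.1⟩).prodCongr (h ⟨y, y.2.2⟩),
      oU.inter oV, ⟨xU, xV⟩, ?_, ?_⟩
    · intro y a e
      exact Prod.ext (hg ⟨y, y.2.1⟩ a e.1) (hh ⟨y, y.2.2⟩ a e.2)
    · exact (tg.mono Set.inter_subset_left).prod (th.mono Set.inter_subset_right)
  continuous_smul := by
    let _ := 𝒜.top
    let _ := E.top
    let _ := F.top
    let _ := fibProdTop E.top F.top
    let _ := fibProdTop 𝒜.top E.top
    let _ := fibProdTop 𝒜.top F.top
    let _ := fibProdTop (E := 𝒜.fib) (F := fun x => E.fib x × F.fib x) 𝒜.top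
      (fibProdTop E.top F.top)
    have h1 := continuous_left (E := 𝒜.fib) (F := fun x => E.fib x × F.fib x) 𝒜.top
      (fibProdTop E.top F.top)
    have h2 := continuous_right (E := 𝒜.fib) (F := fun x => E.fib x × F.fib x) 𝒜.top
      (fibProdTop E.top F.top)
    refine continuous_toProd ?_ ?_
    · exact E.continuous_smul.comp
        (f := fun p : Tot (fun x => 𝒜.fib x × (E.fib x × F.fib x)) =>
          (⟨p.proj, (p.snd.1, p.snd.2.1)⟩ : Tot fun x => 𝒜.fib x × E.fib x))
        (continuous_toProd h1 ((continuous_left E.top F.top).comp h2))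
    · exact F.continuous_smul.comp
        (f := fun p : Tot (fun x => 𝒜.fib x × (E.fib x × F.fib x)) =>
          (⟨p.proj, (p.snd.1, p.snd.2.2)⟩ : Tot fun x => 𝒜.fib x × F.fib x))
        (continuous_toProd h1 ((continuous_right E.top F.top).comp h2))
  bar x := AddMonoidHom.prodMap (E.bar x) (F.bar x)
  bar_smul x a e := Prod.ext (E.bar_smul x a e.1) (F.bar_smul x a e.2)
  bar_bar x e := mk_prod_eq (E.bar_bar x e.1) (F.bar_bar x e.2)
  continuous_bar := by
    let _ := E.top
    let _ := F.top
    let _ := fibProdTop E.top F.top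
    exact continuous_toProd (E.continuous_bar.comp (continuous_left E.top F.top))
      (F.continuous_bar.comp (continuous_right E.top F.top))

/-- The topology on the total space of the zero bundle. -/
abbrev zeroTop : TopologicalSpace (Tot fun _ : X => PUnit.{u + 1}) :=
  TopologicalSpace.induced Bundle.TotalSpace.proj inferInstance

end RealBundle

/-- The zero bundle. -/
def RealBundle.zero (𝒜 : RealAlgBundle σ A) : RealBundle 𝒜 where
  fib _ := PUnit.{u + 1}
  top := RealBundle.zeroTop
  continuous_proj := continuous_induced_dom
  locally_trivial x := by
    let _ : TopologicalSpace (Tot fun _ : X => PUnit.{u + 1}) := RealBundle.zeroTop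
    refine ⟨PUnit.{u + 1}, inferInstance, inferInstance, inferInstance, inferInstance, 𝒜.base x,
      subset_rfl, fun _ => AddEquiv.refl _, 𝒜.isOpen_base x, 𝒜.mem_base x, fun _ _ _ => rfl,
      @continuous_const _ _ _ _ PUnit.unit, ?_⟩
    exact continuous_induced_rng.2 (continuous_subtype_val.comp continuous_fst)
  continuous_smul := by
    let _ := 𝒜.top
    let _ : TopologicalSpace (Tot fun _ : X => PUnit.{u + 1}) := RealBundle.zeroTop
    exact continuous_right 𝒜.top RealBundle.zeroTop
  bar x := 0
  bar_smul _ _ _ := rfl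
  bar_bar x e := by
    have h := σ.involutive x
    revert e
    rw [h]
    intro e
    rfl
  continuous_bar := by
    let _ : TopologicalSpace (Tot fun _ : X => PUnit.{u + 1}) := RealBundle.zeroTop
    exact continuous_induced_rng.2 (σ.continuous.comp continuous_induced_dom)

namespace RealBundle

def Iso.sumCongr {E E' F F' : RealBundle 𝒜} (i : Iso E E') (j : Iso F F') :
    Iso (E.sum F) (E'.sum F') where
  toEquiv x := (i.toEquiv x).prodCongr (j.toEquiv x)
  continuous_toFun := by
    let _ := E.top
    let _ := F.top
    let _ := E'.top
    let _ := F'.top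
    let _ := (E.sum F).top
    let _ := fibProdTop E.top F.top
    exact continuous_toProd (i.continuous_toFun.comp (continuous_left E.top F.top))
      (j.continuous_toFun.comp (continuous_right E.top F.top))
  continuous_invFun := by
    let _ := E.top
    let _ := F.top
    let _ := E'.top
    let _ := F'.top
    let _ := (E'.sum F').top
    let _ := fibProdTop E'.top F'.top
    exact continuous_toProd (i.continuous_invFun.comp (continuous_left E'.top F'.top))
      (j.continuous_invFun.comp (continuous_right E'.top F'.top))
  map_bar x e := Prod.ext (i.map_bar x e.1) (j.map_bar x e.2)

def sumComm (E F : RealBundle 𝒜) : Iso (E.sum F) (F.sum E) where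
  toEquiv x := LinearEquiv.prodComm _ _ _
  continuous_toFun := by
    let _ := E.top
    let _ := F.top
    let _ := (E.sum F).top
    let _ := fibProdTop E.top F.top
    exact continuous_toProd (continuous_right E.top F.top) (continuous_left E.top F.top)
  continuous_invFun := by
    let _ := E.top
    let _ := F.top
    let _ := (F.sum E).top
    let _ := fibProdTop F.top E.top
    exact continuous_toProd (continuous_right F.top E.top) (continuous_left F.top E.top)
  map_bar _ _ := rfl

def sumAssoc (E F G : RealBundle 𝒜) : Iso ((E.sum F).sum G) (E.sum (F.sum G)) where
  toEquiv x := LinearEquiv.prodAssoc _ _ _ _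
  continuous_toFun := by
    let _ := E.top
    let _ := F.top
    let _ := G.top
    let _ := (E.sum F).top
    let _ := (F.sum G).top
    let _ := ((E.sum F).sum G).top
    let _ := fibProdTop E.top F.top
    let _ := fibProdTop (E.sum F).top G.top
    have h1 := continuous_left (E.sum F).top G.top
    have h2 := continuous_right (E.sum F).top G.top
    exact continuous_toProd ((continuous_left E.top F.top).comp h1)
      (continuous_toProd ((continuous_right E.top F.top).comp h1) h2)
  continuous_invFun := by
    let _ := E.top
    let _ := F.top
    let _ := G.top
    let _ := (E.sum F).top
    let _ := (F.sum G).top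
    let _ := (E.sum (F.sum G)).top
    let _ := fibProdTop F.top G.top
    let _ := fibProdTop E.top (F.sum G).top
    have h1 := continuous_left E.top (F.sum G).top
    have h2 := continuous_right E.top (F.sum G).top
    exact continuous_toProd (continuous_toProd h1 ((continuous_left F.top G.top).comp h2))
      ((continuous_right F.top G.top).comp h2)
  map_bar _ _ := rfl

instance (x : X) : Unique ((zero 𝒜).fib x) := inferInstanceAs (Unique PUnit)

def zeroSum (E : RealBundle 𝒜) : Iso ((zero 𝒜).sum E) E where
  toEquiv x := LinearEquiv.uniqueProd
  continuous_toFun := by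
    let _ := E.top
    let _ := fibProdTop (zero 𝒜).top E.top
    exact continuous_right (zero 𝒜).top E.top
  continuous_invFun := by
    let _ := E.top
    let _ := (zero 𝒜).top
    exact continuous_toProd (continuous_induced_rng.2 E.continuous_proj) continuous_id
  map_bar _ _ := rfl

instance setoid (𝒜 : RealAlgBundle σ A) : Setoid (RealBundle 𝒜) where
  r E F := Nonempty (Iso E F)
  iseqv := ⟨fun E => ⟨Iso.refl E⟩, fun ⟨i⟩ => ⟨i.symm⟩, fun ⟨i⟩ ⟨j⟩ => ⟨i.trans j⟩⟩

end RealBundle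

/-- Isomorphism classes of Real `𝒜`-bundles. -/
abbrev RealBundleClass (𝒜 : RealAlgBundle σ A) := Quotient (RealBundle.setoid 𝒜)

instance (𝒜 : RealAlgBundle σ A) : Add (RealBundleClass 𝒜) :=
  ⟨Quotient.map₂ RealBundle.sum fun _ _ ⟨i⟩ _ _ ⟨j⟩ => ⟨i.sumCongr j⟩⟩

instance (𝒜 : RealAlgBundle σ A) : Zero (RealBundleClass 𝒜) := ⟨⟦RealBundle.zero 𝒜⟧⟩

instance (𝒜 : RealAlgBundle σ A) : AddCommMonoid (RealBundleClass 𝒜) where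
  add_assoc := by
    rintro ⟨E⟩ ⟨F⟩ ⟨G⟩
    exact Quotient.sound ⟨RealBundle.sumAssoc E F G⟩
  add_comm := by
    rintro ⟨E⟩ ⟨F⟩
    exact Quotient.sound ⟨RealBundle.sumComm E F⟩
  zero_add := by
    rintro ⟨E⟩
    exact Quotient.sound ⟨RealBundle.zeroSum E⟩
  add_zero := by
    rintro ⟨E⟩
    exact Quotient.sound ⟨(RealBundle.sumComm _ _).trans (RealBundle.zeroSum E)⟩
  nsmul := nsmulRec

/-- The group `KR^𝒜(X)`: the Grothendieck group of Real `𝒜`-bundles under Whitney sum. -/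
abbrev KR (𝒜 : RealAlgBundle σ A) := Algebra.GrothendieckAddGroup (RealBundleClass 𝒜)

/-- The class in `KR^𝒜(X)` of a Real `𝒜`-bundle. -/
def RealBundle.toKR (E : RealBundle 𝒜) : KR 𝒜 :=
  Algebra.GrothendieckAddGroup.of (⟦E⟧ : RealBundleClass 𝒜)

end RealBundles

/-! ### `ε`-symmetric forms and the group `GR` -/

section Forms

/-- The dual `Hom_R(M, R)` of a left module over a `*`-ring `R`. It is the left `R`-module with
`(a • f) m = f m * a^*`. -/
def StarDual (R M : Type u) [Ring R] [AddCommGroup M] [Module R M] : Type u := M →ₗ[R] R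

namespace StarDual

variable {R M : Type u} [Ring R] [AddCommGroup M] [Module R M]

instance : AddCommGroup (StarDual R M) := inferInstanceAs (AddCommGroup (M →ₗ[R] R))

instance : FunLike (StarDual R M) M R := inferInstanceAs (FunLike (M →ₗ[R] R) M R)

instance : LinearMapClass (StarDual R M) R M R :=
  inferInstanceAs (LinearMapClass (M →ₗ[R] R) R M R)

theorem ext {f g : StarDual R M} (h : ∀ m, f m = g m) : f = g := DFunLike.ext f g h

theorem add_apply (f g : StarDual R M) (m : M) : (f + g) m = f m + g m := rfl

variable [StarRing R]

instance : SMul R (StarDual R M) where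
  smul a f :=
    { toFun m := f m * star a
      map_add' m m' := by rw [map_add, add_mul]
      map_smul' r m := by simp [mul_assoc] }

theorem smul_apply (a : R) (f : StarDual R M) (m : M) : (a • f) m = f m * star a := rfl

instance : Module R (StarDual R M) where
  one_smul f := ext fun m => by simp [smul_apply]
  mul_smul a b f := ext fun m => by simp [smul_apply, mul_assoc]
  smul_zero a := ext fun m => by
    rw [smul_apply]
    exact zero_mul _
  smul_add a f g := ext fun m => by simp [smul_apply, add_apply, add_mul]
  add_smul a b f := ext fun m => by simp [smul_apply, add_apply, mul_add]
  zero_smul f := ext fun m => by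
    rw [smul_apply, star_zero, mul_zero]
    rfl

/-- The dual of a direct sum. -/
def prodEquiv {N : Type u} [AddCommGroup N] [Module R N] :
    (StarDual R M × StarDual R N) ≃ₗ[R] StarDual R (M × N) where
  toFun f := LinearMap.coprod (M₃ := R) f.1 f.2
  invFun f := (LinearMap.comp (M₂ := M × N) (M₃ := R) f (LinearMap.inl R M N),
    LinearMap.comp (M₂ := M × N) (M₃ := R) f (LinearMap.inr R M N))
  map_add' f g := ext fun m => by
    change (f.1 m.1 + g.1 m.1) + (f.2 m.2 + g.2 m.2) = (f.1 m.1 + f.2 m.2) + (g.1 m.1 + g.2 m.2)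
    abel
  map_smul' a f := ext fun m => by
    change f.1 m.1 * star a + f.2 m.2 * star a = (f.1 m.1 + f.2 m.2) * star a
    rw [add_mul]
  left_inv f := by
    refine Prod.ext (ext fun m => ?_) (ext fun m => ?_)
    · change f.1 m + f.2 0 = f.1 m
      rw [map_zero, add_zero]
    · change f.1 0 + f.2 m = f.2 m
      rw [map_zero, zero_add]
  right_inv f := ext fun m => by
    change f (m.1, 0) + f (0, m.2) = f m
    rw [← map_add, Prod.mk_add_mk, add_zero, zero_add]

theorem prodEquiv_apply {N : Type u} [AddCommGroup N] [Module R N]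
    (f : StarDual R M × StarDual R N) (m : M × N) : prodEquiv f m = f.1 m.1 + f.2 m.2 := rfl

end StarDual

variable {A : Type u} [Ring A] [Algebra ℝ A] [TopologicalSpace A] [StarRing A]

/-- An `ε`-symmetric form on a Real `𝒜`-bundle `E`: an isomorphism of `E` with its dual (linear
on the fibres, compatible with the involutions and continuous), such that the form
`B(e, e') = toDual e e'` satisfies `B(e', e) = ε B(e, e')^*`. The continuity is expressed as that
of `B : E ×_X E → 𝒜`. -/
structure Form (𝒜 : RealStarAlgBundle σ A) (ε : ℝ) (E : RealBundle 𝒜.toRealAlgBundle) where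
  toDual : ∀ x, E.fib x ≃ₗ[𝒜.fib x] StarDual (𝒜.fib x) (E.fib x)
  symm : ∀ x (e e' : E.fib x), toDual x e' e = ε • star (toDual x e e')
  map_bar : ∀ x (e e' : E.fib x),
    toDual (σ x) (E.bar x e) (E.bar x e') = 𝒜.bar x (toDual x e e')
  continuous : Continuous[fibProdTop E.top E.top, 𝒜.top]
    fun p => (⟨p.proj, toDual p.proj p.snd.1 p.snd.2⟩ : Tot 𝒜.fib)

variable {𝒜 : RealStarAlgBundle σ A} {ε : ℝ}

/-- A (Riemannian) metric is a symmetric form such that all `B(e, e)` are positive elements of the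
`*`-algebra, that is, of the form `b^* b`. -/
def Form.IsMetric {E : RealBundle 𝒜.toRealAlgBundle} (ψ : Form 𝒜 1 E) : Prop :=
  ∀ x (e : E.fib x), ∃ b : 𝒜.fib x, ψ.toDual x e e = star b * b

theorem RealAlgBundle.continuous_add {A : Type u} [Ring A] [Algebra ℝ A] [TopologicalSpace A]
    [ContinuousAdd A] (𝒜 : RealAlgBundle σ A) : Continuous[fibProdTop 𝒜.top 𝒜.top, 𝒜.top]
      fun p => (⟨p.proj, p.snd.1 + p.snd.2⟩ : Tot 𝒜.fib) := by
  let _ := 𝒜.top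
  let _ := fibProdTop 𝒜.top 𝒜.top
  have hl := continuous_left 𝒜.top 𝒜.top
  have hr := continuous_right 𝒜.top 𝒜.top
  have hp : Continuous fun p : Tot (fun x => 𝒜.fib x × 𝒜.fib x) => p.proj :=
    𝒜.continuous_proj.comp hl
  refine continuous_iff_continuousAt.2 fun p => ?_
  have hS : IsOpen {q : Tot (fun x => 𝒜.fib x × 𝒜.fib x) | q.proj ∈ 𝒜.base p.proj} :=
    (𝒜.isOpen_base p.proj).preimage hp
  refine ContinuousOn.continuousAt (s := {q | q.proj ∈ 𝒜.base p.proj}) ?_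
    (hS.mem_nhds (𝒜.mem_base p.proj))
  rw [continuousOn_iff_continuous_domRestrict]
  obtain ⟨h1, h2⟩ := 𝒜.isTrivialization p.proj
  let S := {q : Tot (fun x => 𝒜.fib x × 𝒜.fib x) // q.proj ∈ 𝒜.base p.proj}
  have ha := h1.comp (f := fun q : S => ⟨⟨q.1.proj, q.1.snd.1⟩, q.2⟩)
    ((hl.comp continuous_subtype_val).subtype_mk _)
  have hb := h1.comp (f := fun q : S => ⟨⟨q.1.proj, q.1.snd.2⟩, q.2⟩)
    ((hr.comp continuous_subtype_val).subtype_mk _)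
  have hc : Continuous fun q : S => (⟨q.1.proj, q.2⟩ : 𝒜.base p.proj) :=
    (hp.comp continuous_subtype_val).subtype_mk _
  refine (h2.comp (hc.prodMk (ha.add hb))).congr fun q => ?_
  refine congrArg (Bundle.TotalSpace.mk _) ?_
  change (𝒜.triv p.proj _).symm (𝒜.triv p.proj _ _ + 𝒜.triv p.proj _ _) = _
  rw [map_add, AlgEquiv.symm_apply_apply, AlgEquiv.symm_apply_apply]

/-- The orthogonal sum of two forms. -/
def Form.sum [ContinuousAdd A] {E F : RealBundle 𝒜.toRealAlgBundle} (φ : Form 𝒜 ε E)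
    (ψ : Form 𝒜 ε F) : Form 𝒜 ε (E.sum F) where
  toDual x := ((φ.toDual x).prodCongr (ψ.toDual x)).trans StarDual.prodEquiv
  symm x e e' := by
    change φ.toDual x e'.1 e.1 + ψ.toDual x e'.2 e.2 =
      ε • star (φ.toDual x e.1 e'.1 + ψ.toDual x e.2 e'.2)
    rw [star_add, smul_add, ← φ.symm, ← ψ.symm]
  map_bar x e e' := by
    change φ.toDual _ (E.bar x e.1) (E.bar x e'.1) + ψ.toDual _ (F.bar x e.2) (F.bar x e'.2) =
      𝒜.bar x (φ.toDual x e.1 e'.1 + ψ.toDual x e.2 e'.2)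
    rw [map_add, φ.map_bar, ψ.map_bar]
  continuous := by
    let _ := 𝒜.top
    let _ := E.top
    let _ := F.top
    let _ := (E.sum F).top
    let _ := fibProdTop E.top F.top
    let _ := fibProdTop E.top E.top
    let _ := fibProdTop F.top F.top
    let _ := fibProdTop 𝒜.top 𝒜.top
    let _ := fibProdTop (E.sum F).top (E.sum F).top
    have h1 := continuous_left (E.sum F).top (E.sum F).top
    have h2 := continuous_right (E.sum F).top (E.sum F).top
    have hl := continuous_left E.top F.top
    have hr := continuous_right E.top F.top
    have hφ := φ.continuous.comp (f := fun p : Tot (fun x => (E.sum F).fib x × (E.sum F).fib x) =>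
      (⟨p.proj, (p.snd.1.1, p.snd.2.1)⟩ : Tot fun x => E.fib x × E.fib x))
      (continuous_toProd (hl.comp h1) (hl.comp h2))
    have hψ := ψ.continuous.comp (f := fun p : Tot (fun x => (E.sum F).fib x × (E.sum F).fib x) =>
      (⟨p.proj, (p.snd.1.2, p.snd.2.2)⟩ : Tot fun x => F.fib x × F.fib x))
      (continuous_toProd (hr.comp h1) (hr.comp h2))
    exact 𝒜.continuous_add.comp
      (f := fun p : Tot (fun x => (E.sum F).fib x × (E.sum F).fib x) =>
        (⟨p.proj, (φ.toDual p.proj p.snd.1.1 p.snd.2.1, ψ.toDual p.proj p.snd.1.2 p.snd.2.2)⟩ :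
          Tot fun x => 𝒜.fib x × 𝒜.fib x))
      (continuous_toProd hφ hψ)

/-- The form on the zero bundle. -/
def Form.zero (𝒜 : RealStarAlgBundle σ A) (ε : ℝ) :
    Form 𝒜 ε (RealBundle.zero 𝒜.toRealAlgBundle) where
  toDual x :=
    { toFun := 0
      invFun := 0
      map_add' _ _ := (add_zero _).symm
      map_smul' _ _ := (smul_zero _).symm
      left_inv _ := rfl
      right_inv f := StarDual.ext fun m => (map_zero f).symm }
  symm x e e' := by
    change (0 : 𝒜.fib x) = ε • star 0
    rw [star_zero, smul_zero]
  map_bar x e e' := (map_zero (𝒜.bar x)).symm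
  continuous := by
    let _ := 𝒜.top
    let _ := (RealBundle.zero 𝒜.toRealAlgBundle).top
    let _ := fibProdTop (RealBundle.zero 𝒜.toRealAlgBundle).top
      (RealBundle.zero 𝒜.toRealAlgBundle).top
    have hp : Continuous fun p : Tot (fun x => (RealBundle.zero 𝒜.toRealAlgBundle).fib x ×
        (RealBundle.zero 𝒜.toRealAlgBundle).fib x) => p.proj :=
      (RealBundle.zero 𝒜.toRealAlgBundle).continuous_proj.comp (continuous_left _ _)
    refine continuous_iff_continuousAt.2 fun p => ?_
    refine ContinuousOn.continuousAt (s := Bundle.TotalSpace.proj ⁻¹' 𝒜.base p.proj) ?_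
      (((𝒜.isOpen_base p.proj).preimage hp).mem_nhds (𝒜.mem_base p.proj))
    rw [continuousOn_iff_continuous_domRestrict]
    have h2 := (𝒜.isTrivialization p.proj).2
    refine (h2.comp (f := fun q : {q : Tot (fun x => (RealBundle.zero 𝒜.toRealAlgBundle).fib x ×
      (RealBundle.zero 𝒜.toRealAlgBundle).fib x) // q.proj ∈ 𝒜.base p.proj} =>
      ((⟨q.1.proj, q.2⟩ : 𝒜.base p.proj), (0 : A)))
      (((hp.comp continuous_subtype_val).subtype_mk _).prodMk continuous_const)).congr fun q => ?_
    exact congrArg (Bundle.TotalSpace.mk _) (map_zero (𝒜.triv p.proj _).symm)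

/-- A Real `𝒜`-bundle with an `ε`-symmetric form. -/
structure FormBundle (𝒜 : RealStarAlgBundle σ A) (ε : ℝ) where
  bundle : RealBundle 𝒜.toRealAlgBundle
  form : Form 𝒜 ε bundle

namespace FormBundle

/-- An isomorphism of Real `𝒜`-bundles with forms: an isomorphism of Real `𝒜`-bundles which
preserves the forms. -/
structure Iso (E F : FormBundle 𝒜 ε) where
  iso : RealBundle.Iso E.bundle F.bundle
  isometry : ∀ x (e e' : E.bundle.fib x),
    F.form.toDual x (iso.toEquiv x e) (iso.toEquiv x e') = E.form.toDual x e e'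

instance setoid (𝒜 : RealStarAlgBundle σ A) (ε : ℝ) : Setoid (FormBundle 𝒜 ε) where
  r E F := Nonempty (Iso E F)
  iseqv :=
    { refl E := ⟨⟨RealBundle.Iso.refl _, fun _ _ _ => rfl⟩⟩
      symm := by
        rintro E F ⟨i⟩
        refine ⟨⟨i.iso.symm, fun x e e' => ?_⟩⟩
        have h := i.isometry x ((i.iso.toEquiv x).symm e) ((i.iso.toEquiv x).symm e')
        rw [LinearEquiv.apply_symm_apply, LinearEquiv.apply_symm_apply] at h
        exact h.symm
      trans := by
        rintro E F G ⟨i⟩ ⟨j⟩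
        exact ⟨⟨i.iso.trans j.iso, fun x e e' =>
          (j.isometry x _ _).trans (i.isometry x e e')⟩⟩ }

/-- The orthogonal sum. -/
def sum [ContinuousAdd A] (E F : FormBundle 𝒜 ε) : FormBundle 𝒜 ε :=
  ⟨E.bundle.sum F.bundle, E.form.sum F.form⟩

end FormBundle

/-- Isomorphism classes of Real `𝒜`-bundles with an `ε`-symmetric form. -/
abbrev FormBundleClass (𝒜 : RealStarAlgBundle σ A) (ε : ℝ) := Quotient (FormBundle.setoid 𝒜 ε)

instance [ContinuousAdd A] (𝒜 : RealStarAlgBundle σ A) (ε : ℝ) : Add (FormBundleClass 𝒜 ε) :=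
  ⟨Quotient.map₂ FormBundle.sum fun _ _ ⟨i⟩ _ _ ⟨j⟩ => ⟨⟨i.iso.sumCongr j.iso,
    fun x e e' => congrArg₂ (· + ·) (i.isometry x e.1 e'.1) (j.isometry x e.2 e'.2)⟩⟩⟩

instance (𝒜 : RealStarAlgBundle σ A) (ε : ℝ) : Zero (FormBundleClass 𝒜 ε) :=
  ⟨⟦⟨RealBundle.zero 𝒜.toRealAlgBundle, Form.zero 𝒜 ε⟩⟧⟩

instance [ContinuousAdd A] (𝒜 : RealStarAlgBundle σ A) (ε : ℝ) :
    AddCommMonoid (FormBundleClass 𝒜 ε) where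
  add_assoc := by
    rintro ⟨E⟩ ⟨F⟩ ⟨G⟩
    exact Quotient.sound ⟨⟨RealBundle.sumAssoc _ _ _, fun x e e' => (add_assoc _ _ _).symm⟩⟩
  add_comm := by
    rintro ⟨E⟩ ⟨F⟩
    exact Quotient.sound ⟨⟨RealBundle.sumComm _ _, fun x e e' => add_comm _ _⟩⟩
  zero_add := by
    rintro ⟨E⟩
    exact Quotient.sound ⟨⟨RealBundle.zeroSum _, fun x e e' =>
      (zero_add (E.form.toDual x e.2 e'.2)).symm⟩⟩
  add_zero := by
    rintro ⟨E⟩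
    exact Quotient.sound ⟨⟨(RealBundle.sumComm _ _).trans (RealBundle.zeroSum _),
      fun x e e' => (add_zero (E.form.toDual x e.1 e'.1)).symm⟩⟩
  nsmul := nsmulRec

/-- The group `εGR^𝒜(X)`: the Grothendieck group of the Real `𝒜`-bundles with an `ε`-symmetric
form, under orthogonal sum. -/
abbrev GR [ContinuousAdd A] (𝒜 : RealStarAlgBundle σ A) (ε : ℝ) :=
  Algebra.GrothendieckAddGroup (FormBundleClass 𝒜 ε)

/-- The class in `εGR^𝒜(X)` of a Real `𝒜`-bundle with an `ε`-symmetric form. -/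
def FormBundle.toGR [ContinuousAdd A] (E : FormBundle 𝒜 ε) : GR 𝒜 ε :=
  Algebra.GrothendieckAddGroup.of (⟦E⟧ : FormBundleClass 𝒜 ε)

/-- `Represents E F`, for a Real `𝒜`-bundle `E` with an `ε`-symmetric form `φ` and a Real bundle
`F` over `𝒜' = 𝒜 ⊗ ℝ[t]/(t² = ε)`: the underlying Real `𝒜`-bundle of `F` is isomorphic to
that of `E`, by an isomorphism `u` under which `φ(e)e' = ψ(θ e)e'` for some metric `ψ` on `E`,
where `θ` is the operator on `E` that corresponds to the action of `t` on `F`. -/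
def Represents (E : FormBundle 𝒜 ε) (F : RealBundle (𝒜.adjoinRoot ε)) : Prop :=
  ∃ u : ∀ x, E.bundle.fib x ≃+ F.fib x,
    (∀ x (a : 𝒜.fib x) (e : E.bundle.fib x),
      u x (a • e) = 𝒜.inclRoot ε x a • u x e) ∧
    (∀ x (e : E.bundle.fib x), u (σ x) (E.bundle.bar x e) = F.bar x (u x e)) ∧
    (Continuous[E.bundle.top, F.top] fun p => (⟨p.proj, u p.proj p.snd⟩ : Tot F.fib)) ∧
    (Continuous[F.top, E.bundle.top]
      fun p => (⟨p.proj, (u p.proj).symm p.snd⟩ : Tot E.bundle.fib)) ∧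
    ∃ ψ : Form 𝒜 1 E.bundle, ψ.IsMetric ∧ ∀ x (e e' : E.bundle.fib x),
      E.form.toDual x e e' = ψ.toDual x ((u x).symm (𝒜.root ε x • u x e)) e'

end Forms

/-- `A` (a unital Banach `*`-algebra over `ℝ`) is a `C^*`-algebra over `ℝ`: it is
`*`-isometrically isomorphic to a norm-closed algebra of operators on a real Hilbert space.
(For complete `A` the image is norm-closed.) -/
def IsRealCStarAlgebra (A : Type u) [NormedRing A] [NormedAlgebra ℝ A] [CompleteSpace A]
    [StarRing A] : Prop :=
  ∃ (H : Type u) (_ : NormedAddCommGroup H) (_ : InnerProductSpace ℝ H) (_ : CompleteSpace H)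
    (π : A →⋆ₐ[ℝ] (H →L[ℝ] H)), Isometry π

end TwistedK

/-!
# Hermitian K-theory of Real bundles over real `C^*`-algebras

An `ε`-symmetric form on a Real `𝒜`-bundle and a Real bundle over `𝒜' = 𝒜 ⊗ ℝ[t]/(t² = ε)` are two
halves of the same object: a Real `𝒜`-bundle `E` with a metric `ψ` and an operator `J` (the action
of `t`) such that `J² = ε` and `J` preserves `ψ`. The form is `φ(e, e') = ψ(J e, e')`; that `φ` is
`ε`-symmetric is equivalent to the invariance of `ψ` (`isometry_of_symm`, `symm_of_isometry`). The
point is that each half determines the other one up to isomorphism.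

*Existence.* A form `φ` is `B(T e, e')` for some metric `B`. If `S` is the positive square root of
`T*T = ε T²`, then `J = T S⁻¹` and `ψ(e, e') = B(S e, e')` are as required; this is the polar
decomposition `Form.exists_polar`. An operator `J` with `J² = ε` makes `E` a Real `𝒜'`-bundle
(`RealBundle.ofRoot`). Local triviality holds because operators `J`, `J'` of square `ε` that are
close to each other are conjugate by `(1 + ε J J') / 2` (`exists_rootChart`). Conversely, on a
Real `𝒜'`-bundle a metric is made invariant under `t` by adding its transform by `t`
(`exists_represents_right`).

*Uniqueness.* Two metrics `ψ`, `ψ'` on `E` differ by the positive square root `S` of the operator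
that represents `ψ'` with respect to `ψ`. If both are invariant under `J`, then `S` commutes with
`J`, and is an isometry of the two forms (`IsSqrt.comm_of_isometry`, `Represents.unique_left`). If
`ψ(J e, e') = ψ'(J' e, e')`, then `S` conjugates `J'` into `J`, and is an isomorphism of the two
Real `𝒜'`-bundles (`IsSqrt.intertwines`, `Represents.unique_right`). Both rest on the uniqueness
of positive square roots, `IsSqrt.unique`. As orthogonal sums correspond to direct sums, the
monoids of isomorphism classes are isomorphic (`exists_classEquiv`), and so are their Grothendieck
groups. These are generated by classes of bundles, which gives the uniqueness of the isomorphism.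

*Metrics and square roots.* The analytic input is elementary. The algebra `A` enters through a few
properties of its elements `b^* b`, read off from a faithful representation
(`IsRealCStarAlgebra.realCStar`): they form a closed convex cone, `-b^* b` is in it only if `b =
0`, and inequalities between positive elements bound their norms. For a metric `B` this yields the
Cauchy–Schwarz inequality, hence a lower bound `‖e‖² ≤ K ‖B(e, e)‖` on a projective module
(`Frame.exists_norm_sq_le`), and a bound for the powers of an operator `0 ≤ x ≤ 1`
(`Frame.norm_pow_sq_le`). So the series `1 - √(1 - x) = ∑ cₙ xⁿ⁺¹`, whose coefficients `cₙ =
catalan n / (2 · 4ⁿ)` have a finite sum, converges in operator norm and gives square roots,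
locally uniformly in a parameter (`Frame.exists_sqrt_family`). By their uniqueness these are
continuous on bundles and commute with the involutions (`exists_isSqrt_bundle`, `isSqrt_bar`).
Metrics on a bundle are obtained by restriction from free modules, a partition of unity, and
averaging over the involution (`exists_isMetric_invariant`); here one needs that the sum of a
metric and a positive form is a metric (`Frame.isMetric_add`).

The last part is algebra: `t ↦ (1, -1)` identifies `𝒜'` with `𝒜 × 𝒜` for `ε = 1`
(`RealStarAlgBundle.splitIso`), and `t ↦ i` identifies `ℝ[t]/(t² = -1)` with `ℂ`.
-/

set_option linter.unusedSectionVars false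

namespace TwistedK

open Finset Filter Topology

universe u v

/-! ### The square root series -/

/-- The coefficients of the power series `1 - √(1 - t) = ∑ sqrtCoeff n * t ^ (n + 1)`. -/
noncomputable def sqrtCoeff (n : ℕ) : ℝ := catalan n / (2 * 4 ^ n)

theorem sqrtCoeff_nonneg (n : ℕ) : 0 ≤ sqrtCoeff n := by unfold sqrtCoeff; positivity

/-- The partial sums of the coefficients telescope. -/
theorem sum_sqrtCoeff (N : ℕ) :
    ∑ n ∈ range N, sqrtCoeff n = 1 - (Nat.centralBinom N : ℝ) / 4 ^ N := by
  induction N with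
  | zero => simp
  | succ N ih =>
    rw [sum_range_succ, ih, sqrtCoeff]
    have h1 : ((N : ℝ) + 1) * catalan N = Nat.centralBinom N := by
      exact_mod_cast succ_mul_catalan_eq_centralBinom N
    have h2 : ((N : ℝ) + 1) * Nat.centralBinom (N + 1) =
        2 * (2 * N + 1) * Nat.centralBinom N := by
      exact_mod_cast Nat.succ_mul_centralBinom_succ N
    have h3 : (Nat.centralBinom (N + 1) : ℝ) = 2 * (2 * N + 1) * catalan N := by
      have : (N : ℝ) + 1 ≠ 0 := by positivity
      apply mul_left_cancel₀ this
      rw [h2, ← h1]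
      ring
    rw [h3, ← h1, pow_succ]
    field_simp
    ring

theorem sum_sqrtCoeff_le_one (N : ℕ) : ∑ n ∈ range N, sqrtCoeff n ≤ 1 := by
  rw [sum_sqrtCoeff]
  have : (0 : ℝ) ≤ (Nat.centralBinom N : ℝ) / 4 ^ N := by positivity
  linarith

theorem summable_sqrtCoeff : Summable sqrtCoeff :=
  summable_of_sum_range_le sqrtCoeff_nonneg sum_sqrtCoeff_le_one

/-- The recursion of the coefficients, from the recursion of the Catalan numbers. -/
theorem sum_antidiagonal_sqrtCoeff (n : ℕ) :
    ∑ ij ∈ antidiagonal n, sqrtCoeff ij.1 * sqrtCoeff ij.2 = 2 * sqrtCoeff (n + 1) := by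
  have h : ∀ ij ∈ antidiagonal n, sqrtCoeff ij.1 * sqrtCoeff ij.2 =
      ((catalan ij.1 * catalan ij.2 : ℕ) : ℝ) / (4 * 4 ^ n) := by
    intro ij hij
    rw [← mem_antidiagonal.1 hij, sqrtCoeff, sqrtCoeff, pow_add]
    push_cast
    field_simp
    ring
  rw [sum_congr rfl h, ← sum_div, ← Nat.cast_sum, ← catalan_succ', sqrtCoeff, pow_succ]
  field_simp

section Banach

variable {R : Type*} [NormedRing R] [NormedAlgebra ℝ R]

/-- The series `1 - √(1 - x)`. -/
noncomputable def sqrtSeries (x : R) : R := ∑' n, sqrtCoeff n • x ^ (n + 1)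

theorem norm_sqrtCoeff_smul_le {x : R} {K : ℝ} (hK : ∀ n, ‖x ^ (n + 1)‖ ≤ K) (n : ℕ) :
    ‖sqrtCoeff n • x ^ (n + 1)‖ ≤ sqrtCoeff n * K := by
  rw [norm_smul, Real.norm_of_nonneg (sqrtCoeff_nonneg n)]
  exact mul_le_mul_of_nonneg_left (hK n) (sqrtCoeff_nonneg n)

theorem summable_norm_sqrtSeries {x : R} {K : ℝ} (hK : ∀ n, ‖x ^ (n + 1)‖ ≤ K) :
    Summable fun n => ‖sqrtCoeff n • x ^ (n + 1)‖ :=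
  Summable.of_nonneg_of_le (fun _ => norm_nonneg _) (norm_sqrtCoeff_smul_le hK)
    (summable_sqrtCoeff.mul_right K)

variable [CompleteSpace R]

theorem hasSum_sqrtSeries {x : R} {K : ℝ} (hK : ∀ n, ‖x ^ (n + 1)‖ ≤ K) :
    HasSum (fun n => sqrtCoeff n • x ^ (n + 1)) (sqrtSeries x) :=
  (summable_norm_sqrtSeries hK).of_norm.hasSum

theorem one_sub_sqrtSeries_mul_self {x : R} {K : ℝ} (hK : ∀ n, ‖x ^ (n + 1)‖ ≤ K) :
    (1 - sqrtSeries x) * (1 - sqrtSeries x) = 1 - x := by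
  have hs := hasSum_sqrtSeries hK
  have h1 : sqrtSeries x * sqrtSeries x = ∑' n, (2 * sqrtCoeff (n + 1)) • x ^ (n + 2) := by
    rw [sqrtSeries, tsum_mul_tsum_eq_tsum_sum_antidiagonal_of_summable_norm
      (summable_norm_sqrtSeries hK) (summable_norm_sqrtSeries hK)]
    refine tsum_congr fun n => ?_
    rw [← sum_antidiagonal_sqrtCoeff, sum_smul]
    refine sum_congr rfl fun ij hij => ?_
    rw [smul_mul_smul_comm, ← pow_add, ← mem_antidiagonal.1 hij]
    congr 2
    ring
  have h2 : sqrtSeries x = (1 / 2 : ℝ) • x + ∑' n, sqrtCoeff (n + 1) • x ^ (n + 2) := by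
    rw [sqrtSeries, hs.summable.tsum_eq_zero_add]
    simp [sqrtCoeff]
  have h3 : ∑' n, (2 * sqrtCoeff (n + 1)) • x ^ (n + 2) =
      (2 : ℝ) • ∑' n, sqrtCoeff (n + 1) • x ^ (n + 2) := by
    rw [← tsum_const_smul'']
    simp only [mul_smul]
  have h4 : sqrtSeries x * sqrtSeries x = (2 : ℝ) • sqrtSeries x - x := by
    rw [h1, h3]
    conv_rhs => rw [h2]
    rw [smul_add, smul_smul]
    norm_num
  rw [mul_sub, sub_mul, sub_mul, h4, two_smul]
  simp only [one_mul, mul_one]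
  abel

theorem Commute.sqrtSeries_right {x y : R} {K : ℝ} (hK : ∀ n, ‖x ^ (n + 1)‖ ≤ K)
    (h : Commute y x) : Commute y (sqrtSeries x) := by
  have hs := hasSum_sqrtSeries hK
  refine (hs.mul_left y).unique ((hs.mul_right y).congr_fun ?_)
  intro n
  exact ((h.pow_right (n + 1)).smul_right _).eq

end Banach

/-! ### Positive elements -/

section IsPos

variable {R : Type*} [Ring R] [StarRing R]

/-- Positive elements of a `*`-ring: those of the form `b^* b`. -/
def IsPos (a : R) : Prop := ∃ b : R, a = star b * b

theorem IsPos.isSelfAdjoint {a : R} (h : IsPos a) : star a = a := by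
  obtain ⟨b, rfl⟩ := h
  simp

theorem isPos_mul_star_self (b : R) : IsPos (b * star b) := ⟨star b, by simp⟩

theorem isPos_zero : IsPos (0 : R) := ⟨0, by simp⟩

theorem IsPos.conj {a : R} (h : IsPos a) (c : R) : IsPos (c * a * star c) := by
  obtain ⟨b, rfl⟩ := h
  exact ⟨b * star c, by simp [mul_assoc]⟩

theorem IsPos.map [Algebra ℝ R] {S : Type*} [Ring S] [Algebra ℝ S] [StarRing S] {τ : R →ₐ[ℝ] S}
    (hτ : ∀ a, τ (star a) = star (τ a)) {a : R} (h : IsPos a) : IsPos (τ a) := by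
  obtain ⟨b, rfl⟩ := h
  exact ⟨τ b, by rw [map_mul, hτ]⟩

variable [Algebra ℝ R] [StarModule ℝ R]

theorem IsPos.smul {a : R} (h : IsPos a) {r : ℝ} (hr : 0 ≤ r) : IsPos (r • a) := by
  obtain ⟨b, rfl⟩ := h
  refine ⟨Real.sqrt r • b, ?_⟩
  rw [star_smul, star_trivial (√r), smul_mul_smul_comm, Real.mul_self_sqrt hr]

theorem isPos_smul_one {r : ℝ} (hr : 0 ≤ r) : IsPos (r • (1 : R)) := by
  have h : IsPos (1 : R) := ⟨1, by simp⟩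
  exact h.smul hr

variable (R) in
/-- The order-theoretic properties of a `C^*`-algebra: the positive elements form a salient convex
cone, of which `1` is an order unit. -/
class PositiveCone : Prop where
  add : ∀ {a b : R}, IsPos a → IsPos b → IsPos (a + b)
  eq_zero : ∀ {b : R}, IsPos (-(star b * b)) → b = 0
  bounded : ∀ {a : R}, star a = a → ∃ c : ℝ, 0 < c ∧ IsPos (c • (1 : R) - a)

theorem IsPos.add [PositiveCone R] {a b : R} (ha : IsPos a) (hb : IsPos b) : IsPos (a + b) :=
  PositiveCone.add ha hb

theorem isPos_sum [PositiveCone R] {ι : Type*} (s : Finset ι) (f : ι → R)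
    (h : ∀ i ∈ s, IsPos (f i)) : IsPos (∑ i ∈ s, f i) :=
  Finset.sum_induction f IsPos (fun _ _ => IsPos.add) isPos_zero h

theorem IsPos.of_add_eq_zero [PositiveCone R] {a b : R} (ha : IsPos a) (hb : IsPos b)
    (h : a + b = 0) : a = 0 := by
  obtain ⟨c, rfl⟩ := ha
  rw [← neg_eq_of_add_eq_zero_right h] at hb
  rw [PositiveCone.eq_zero hb, mul_zero]

theorem IsPos.trans [PositiveCone R] {a b c : R} (h : IsPos (b - a)) (h' : IsPos (c - b)) :
    IsPos (c - a) := by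
  have := h.add h'
  rwa [sub_add_sub_comm, add_comm b c, add_sub_add_right_eq_sub] at this

/-- The properties of positive elements can be transported along `*`-isomorphisms. -/
theorem PositiveCone.of_equiv {S : Type*} [Ring S] [Algebra ℝ S] [StarRing S] [StarModule ℝ S]
    [PositiveCone R] (τ : S ≃ₐ[ℝ] R) (hτ : ∀ a, τ (star a) = star (τ a)) : PositiveCone S := by
  have hs : ∀ a, τ.symm (star a) = star (τ.symm a) := fun a => by
    rw [AlgEquiv.symm_apply_eq, hτ, AlgEquiv.apply_symm_apply]
  have key : ∀ a, IsPos (τ a) ↔ IsPos a := fun a =>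
    ⟨fun h => by simpa using h.map (τ := τ.symm.toAlgHom) hs, fun h => h.map (τ := τ.toAlgHom) hτ⟩
  refine ⟨fun {a b} ha hb => ?_, fun {b} hb => ?_, fun {a} ha => ?_⟩
  · rw [← key, map_add]
    exact ((key a).2 ha).add ((key b).2 hb)
  · have := PositiveCone.eq_zero (b := τ b) (by
      rw [← hτ, ← map_mul, ← map_neg]
      exact (key _).2 hb)
    simpa using this
  · obtain ⟨c, hc, h⟩ := PositiveCone.bounded (a := τ a) (by rw [← hτ, ha])
    refine ⟨c, hc, (key _).1 ?_⟩
    simpa using h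

end IsPos

/-- The properties of the norm and of the positive elements of a real `C^*`-algebra that are used
for Hilbert modules over it. -/
class RealCStar (A : Type*) [NormedRing A] [NormedAlgebra ℝ A] [StarRing A] [StarModule ℝ A] : Prop
    extends PositiveCone A, NormedStarGroup A where
  isClosed_isPos : IsClosed {a : A | IsPos a}
  norm_sq_le : ∀ {b c : A}, IsPos (b - c * star c) → ‖c‖ ^ 2 ≤ ‖b‖
  isPos_norm_sub : ∀ {a : A}, star a = a → IsPos (‖a‖ • (1 : A) - a)

section Concrete

variable {A : Type*} [NormedRing A] [NormedAlgebra ℝ A] [CompleteSpace A] [StarRing A]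
  {H : Type*} [NormedAddCommGroup H] [InnerProductSpace ℝ H] [CompleteSpace H]
  {π : A →⋆ₐ[ℝ] (H →L[ℝ] H)}

open scoped RealInnerProductSpace

theorem inner_map_star (a : A) (h k : H) : ⟪π (star a) h, k⟫ = ⟪h, π a k⟫ := by
  rw [map_star, ContinuousLinearMap.star_eq_adjoint, ContinuousLinearMap.adjoint_inner_left]

theorem norm_map_of_isometry (hπ : Isometry π) (a : A) : ‖π a‖ = ‖a‖ :=
  hπ.norm_map_of_map_zero (map_zero π) a

theorem norm_star_of_isometry (hπ : Isometry π) (a : A) : ‖star a‖ = ‖a‖ := by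
  rw [← norm_map_of_isometry hπ, map_star, ContinuousLinearMap.star_eq_adjoint,
    LinearIsometryEquiv.norm_map, norm_map_of_isometry hπ]

/-- A self-adjoint operator `T` with `0 ≤ T ≤ 1` is a contraction: `T - T²` is positive, being
`T (1 - T) T + (1 - T) T (1 - T)`. -/
theorem norm_apply_le_of_le_one {T : H → H} (hsub : ∀ h k, T (h - k) = T h - T k)
    (hT : ∀ h k, ⟪T h, k⟫ = ⟪h, T k⟫) (h0 : ∀ h, 0 ≤ ⟪T h, h⟫) (h1 : ∀ h, ⟪T h, h⟫ ≤ ⟪h, h⟫)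
    (h : H) : ‖T h‖ ≤ ‖h‖ := by
  have e1 := h0 (h - T h)
  have e2 := h1 (T h)
  have e3 : ⟪T (T h), h⟫ = ⟪T h, T h⟫ := hT _ _
  rw [hsub, inner_sub_left, inner_sub_right, inner_sub_right, e3] at e1
  have e4 : ⟪T h, T h⟫ ≤ ⟪h, h⟫ := by linarith [h1 h]
  rw [real_inner_self_eq_norm_sq, real_inner_self_eq_norm_sq] at e4
  exact le_of_sq_le_sq e4 (norm_nonneg _)

variable [StarModule ℝ A]

/-- Positivity in a concrete real `C^*`-algebra. The square root of a positive element `a ≤ c` is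
`√c (1 - z)`, where `1 - z` is the square root of `1 - x` for `x = 1 - a / c`, a contraction. -/
theorem isPos_iff_of_isometry (hπ : Isometry π) {a : A} :
    IsPos a ↔ star a = a ∧ ∀ h, 0 ≤ ⟪π a h, h⟫ := by
  constructor
  · intro h
    refine ⟨h.isSelfAdjoint, fun k => ?_⟩
    obtain ⟨b, rfl⟩ := h
    rw [map_mul, mul_apply_eq_comp, inner_map_star]
    exact real_inner_self_nonneg
  rintro ⟨ha, hpos⟩
  set c : ℝ := ‖a‖ + 1
  have hc : 0 < c := by positivity
  set x : A := 1 - c⁻¹ • a with hx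
  have hxs : star x = x := by simp [hx, ha]
  have hπx : ∀ h, π x h = h - c⁻¹ • π a h := fun h => by simp [hx]
  have h0 : ∀ h, 0 ≤ ⟪π x h, h⟫ := fun h => by
    rw [hπx, inner_sub_left, real_inner_smul_left]
    have h2 : ⟪π a h, h⟫ ≤ c * ⟪h, h⟫ := by
      calc ⟪π a h, h⟫ ≤ ‖π a h‖ * ‖h‖ := real_inner_le_norm _ _
        _ ≤ (‖π a‖ * ‖h‖) * ‖h‖ := by gcongr; exact (π a).le_opNorm h
        _ ≤ c * ⟪h, h⟫ := by
          rw [norm_map_of_isometry hπ, real_inner_self_eq_norm_sq]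
          nlinarith [sq_nonneg ‖h‖]
    have h3 : c⁻¹ * ⟪π a h, h⟫ ≤ c⁻¹ * (c * ⟪h, h⟫) := by gcongr
    rw [inv_mul_cancel_left₀ hc.ne'] at h3
    linarith
  have h1 : ∀ h, ⟪π x h, h⟫ ≤ ⟪h, h⟫ := fun h => by
    rw [hπx, inner_sub_left, real_inner_smul_left]
    have := mul_nonneg (inv_nonneg.2 hc.le) (hpos h)
    linarith
  have hsym : ∀ h k, ⟪π x h, k⟫ = ⟪h, π x k⟫ := fun h k => by
    rw [← inner_map_star, hxs]
  have hxn : ‖x‖ ≤ 1 := by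
    rw [← norm_map_of_isometry hπ]
    refine (π x).opNorm_le_bound zero_le_one fun h => ?_
    rw [one_mul]
    exact norm_apply_le_of_le_one (fun h k => map_sub (π x) h k) hsym h0 h1 h
  have hK : ∀ n, ‖x ^ (n + 1)‖ ≤ 1 := fun n =>
    (norm_pow_le' x n.succ_pos).trans (pow_le_one₀ (norm_nonneg _) hxn)
  have : NormedStarGroup A := ⟨fun a => (norm_star_of_isometry hπ a).le⟩
  have hz : star (sqrtSeries x) = sqrtSeries x := by
    have hs := hasSum_sqrtSeries hK
    refine hs.star.unique (hs.congr_fun fun n => ?_)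
    simp [hxs]
  refine ⟨Real.sqrt c • (1 - sqrtSeries x), ?_⟩
  rw [star_smul, star_trivial, star_sub, star_one, hz, smul_mul_smul_comm,
    Real.mul_self_sqrt hc.le, one_sub_sqrtSeries_mul_self hK, hx, sub_sub_cancel, smul_smul,
    mul_inv_cancel₀ hc.ne', one_smul]

theorem realCStar_of_isometry (hπ : Isometry π) : RealCStar A := by
  have key := fun {a : A} => isPos_iff_of_isometry hπ (a := a)
  have hb : ∀ {a : A}, star a = a → IsPos (‖a‖ • (1 : A) - a) := fun {a} ha => by
    refine key.2 ⟨by simp [ha], fun h => ?_⟩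
    have h2 : ⟪π a h, h⟫ ≤ ‖a‖ * ⟪h, h⟫ := by
      calc ⟪π a h, h⟫ ≤ ‖π a h‖ * ‖h‖ := real_inner_le_norm _ _
        _ ≤ (‖π a‖ * ‖h‖) * ‖h‖ := by gcongr; exact (π a).le_opNorm h
        _ = ‖a‖ * ⟪h, h⟫ := by
          rw [norm_map_of_isometry hπ, real_inner_self_eq_norm_sq]
          ring
    simp only [map_sub, map_smul, map_one, sub_apply,
      smul_apply, one_apply_eq_self, inner_sub_left,
      real_inner_smul_left]
    linarith
  have hstar : NormedStarGroup A := ⟨fun a => (norm_star_of_isometry hπ a).le⟩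
  exact
  { add := fun {a b} ha hb => by
      rw [key] at ha hb ⊢
      refine ⟨by rw [star_add, ha.1, hb.1], fun h => ?_⟩
      rw [map_add, add_apply, inner_add_left]
      exact add_nonneg (ha.2 h) (hb.2 h)
    eq_zero := fun {b} hb => by
      have h0 : ∀ h, π b h = 0 := fun h => by
        have := (key.1 hb).2 h
        rw [map_neg, map_mul, neg_apply, mul_apply_eq_comp,
          inner_neg_left, inner_map_star, real_inner_self_eq_norm_sq] at this
        have h2 : ‖π b h‖ ^ 2 = 0 := le_antisymm (by linarith) (sq_nonneg _)
        simpa using h2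
      rw [← norm_eq_zero, ← norm_map_of_isometry hπ, norm_eq_zero]
      exact ContinuousLinearMap.ext h0
    bounded := fun {a} ha => ⟨‖a‖ + 1, by positivity, by
      have h1 := key.1 (hb ha)
      refine key.2 ⟨by simp [ha], fun h => ?_⟩
      have h2 := h1.2 h
      have h3 : 0 ≤ ⟪h, h⟫ := real_inner_self_nonneg
      simp only [map_sub, map_smul, map_one, sub_apply,
        smul_apply, one_apply_eq_self, inner_sub_left,
        real_inner_smul_left] at h2 ⊢
      linarith⟩
    norm_star_le := hstar.norm_star_le
    isClosed_isPos := by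
      have : {a : A | IsPos a} = {a | star a = a} ∩ ⋂ h, {a | 0 ≤ ⟪π a h, h⟫} := by
        ext a
        simp [key]
      rw [this]
      have hcont : Continuous π := hπ.continuous
      refine (isClosed_eq continuous_star continuous_id).inter (isClosed_iInter fun h => ?_)
      exact isClosed_le continuous_const (by fun_prop)
    norm_sq_le := fun {b c} h => by
      have h1 : ‖c‖ ≤ Real.sqrt ‖b‖ := by
        rw [← norm_star_of_isometry hπ, ← norm_map_of_isometry hπ]
        refine ContinuousLinearMap.opNorm_le_bound _ (Real.sqrt_nonneg _) fun k => ?_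
        have h2 := (key.1 h).2 k
        have h3 : ⟪π (c * star c) k, k⟫ = ‖π (star c) k‖ ^ 2 := by
          rw [map_mul, mul_apply_eq_comp, ← real_inner_self_eq_norm_sq,
            inner_map_star, real_inner_comm]
        rw [map_sub, sub_apply, inner_sub_left, h3] at h2
        have h4 : ⟪π b k, k⟫ ≤ ‖b‖ * ‖k‖ ^ 2 := by
          calc ⟪π b k, k⟫ ≤ ‖π b k‖ * ‖k‖ := real_inner_le_norm _ _
            _ ≤ (‖π b‖ * ‖k‖) * ‖k‖ := by gcongr; exact (π b).le_opNorm k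
            _ = ‖b‖ * ‖k‖ ^ 2 := by rw [norm_map_of_isometry hπ]; ring
        refine le_of_sq_le_sq ?_ (by positivity)
        rw [mul_pow, Real.sq_sqrt (norm_nonneg _)]
        linarith
      calc ‖c‖ ^ 2 ≤ Real.sqrt ‖b‖ ^ 2 := by gcongr
        _ = ‖b‖ := Real.sq_sqrt (norm_nonneg _)
    isPos_norm_sub := hb }

theorem IsRealCStarAlgebra.realCStar {A : Type u} [NormedRing A] [NormedAlgebra ℝ A]
    [CompleteSpace A] [StarRing A] [StarModule ℝ A] (hA : IsRealCStarAlgebra A) : RealCStar A := by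
  obtain ⟨H, _, _, _, π, hπ⟩ := hA
  exact realCStar_of_isometry hπ

end Concrete

/-! ### Hermitian forms and metrics on modules -/

section Forms

variable {R M : Type*} [Ring R] [StarRing R] [AddCommGroup M] [Module R M]

/-- Sesquilinear forms with values in a `*`-ring, linear in the second variable. -/
structure IsSesq (B : M → M → R) : Prop where
  add_left : ∀ e₁ e₂ e', B (e₁ + e₂) e' = B e₁ e' + B e₂ e'
  add_right : ∀ e e₁ e₂, B e (e₁ + e₂) = B e e₁ + B e e₂
  smul_left : ∀ a e e', B (a • e) e' = B e e' * star a
  smul_right : ∀ a e e', B e (a • e') = a * B e e'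

namespace IsSesq

variable {B : M → M → R}

/-- The linear functional `B e`. -/
def toLinearMap (h : IsSesq B) (e : M) : M →ₗ[R] R where
  toFun := B e
  map_add' := h.add_right e
  map_smul' a e' := h.smul_right a e e'

/-- The additive map `B · e'`. -/
def leftHom (h : IsSesq B) (e' : M) : M →+ R :=
  AddMonoidHom.mk' (fun e => B e e') fun e₁ e₂ => h.add_left e₁ e₂ e'

theorem sub_left (h : IsSesq B) (e₁ e₂ e' : M) : B (e₁ - e₂) e' = B e₁ e' - B e₂ e' :=
  map_sub (h.leftHom e') e₁ e₂

theorem sub_right (h : IsSesq B) (e e₁ e₂ : M) : B e (e₁ - e₂) = B e e₁ - B e e₂ :=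
  map_sub (h.toLinearMap e) e₁ e₂

theorem zero_left (h : IsSesq B) (e' : M) : B 0 e' = 0 := map_zero (h.leftHom e')

theorem zero_right (h : IsSesq B) (e : M) : B e 0 = 0 := map_zero (h.toLinearMap e)

theorem sum_left (h : IsSesq B) {ι : Type*} (s : Finset ι) (f : ι → M) (e' : M) :
    B (∑ i ∈ s, f i) e' = ∑ i ∈ s, B (f i) e' := map_sum (h.leftHom e') f s

theorem sum_right (h : IsSesq B) {ι : Type*} (s : Finset ι) (f : ι → M) (e : M) :
    B e (∑ i ∈ s, f i) = ∑ i ∈ s, B e (f i) := map_sum (h.toLinearMap e) f s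

theorem comp {N : Type*} [AddCommGroup N] [Module R N] (h : IsSesq B) (T T' : N →ₗ[R] M) :
    IsSesq fun e e' => B (T e) (T' e') where
  add_left e₁ e₂ e' := by rw [map_add, h.add_left]
  add_right e e₁ e₂ := by rw [map_add, h.add_right]
  smul_left a e e' := by rw [map_smul, h.smul_left]
  smul_right a e e' := by rw [map_smul, h.smul_right]

theorem add {B' : M → M → R} (h : IsSesq B) (h' : IsSesq B') :
    IsSesq fun e e' => B e e' + B' e e' where
  add_left e₁ e₂ e' := by rw [h.add_left, h'.add_left]; abel
  add_right e e₁ e₂ := by rw [h.add_right, h'.add_right]; abel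
  smul_left a e e' := by rw [h.smul_left, h'.smul_left, add_mul]
  smul_right a e e' := by rw [h.smul_right, h'.smul_right, mul_add]

theorem sub {B' : M → M → R} (h : IsSesq B) (h' : IsSesq B') :
    IsSesq fun e e' => B e e' - B' e e' where
  add_left e₁ e₂ e' := by rw [h.add_left, h'.add_left]; abel
  add_right e e₁ e₂ := by rw [h.add_right, h'.add_right]; abel
  smul_left a e e' := by rw [h.smul_left, h'.smul_left, sub_mul]
  smul_right a e e' := by rw [h.smul_right, h'.smul_right, mul_sub]

theorem smul [Algebra ℝ R] (h : IsSesq B) (r : ℝ) : IsSesq fun e e' => r • B e e' where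
  add_left e₁ e₂ e' := by rw [h.add_left, smul_add]
  add_right e e₁ e₂ := by rw [h.add_right, smul_add]
  smul_left a e e' := by rw [h.smul_left, smul_mul_assoc]
  smul_right a e e' := by rw [h.smul_right, mul_smul_comm]

end IsSesq

/-- Positive semidefinite hermitian forms. -/
structure IsPosForm (B : M → M → R) : Prop extends IsSesq B where
  symm : ∀ e e', B e' e = star (B e e')
  pos : ∀ e, IsPos (B e e)

/-- Metrics: positive forms for which the map `e ↦ B e` from `M` to its dual is bijective. -/
structure IsMetric (B : M → M → R) : Prop extends IsPosForm B where
  inj : ∀ e, (∀ e', B e e' = 0) → e = 0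
  surj : ∀ l : M →ₗ[R] R, ∃ f, ∀ e, B f e = l e

theorem IsMetric.ext {B : M → M → R} (h : IsMetric B) {e₁ e₂ : M} (he : ∀ e', B e₁ e' = B e₂ e') :
    e₁ = e₂ :=
  sub_eq_zero.1 (h.inj _ fun e' => by rw [h.sub_left, he, sub_self])

variable {B B' : M → M → R}

theorem IsPosForm.comp {N : Type*} [AddCommGroup N] [Module R N] (h : IsPosForm B)
    (T : N →ₗ[R] M) : IsPosForm fun e e' => B (T e) (T e') where
  toIsSesq := h.toIsSesq.comp T T
  symm _ _ := h.symm _ _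
  pos _ := h.pos _

theorem IsMetric.comp {N : Type*} [AddCommGroup N] [Module R N] (h : IsMetric B)
    (T : N ≃ₗ[R] M) : IsMetric fun e e' => B (T e) (T e') where
  toIsPosForm := h.toIsPosForm.comp T.toLinearMap
  inj e he := T.map_eq_zero_iff.1 (h.inj _ fun e' => by simpa using he (T.symm e'))
  surj l := by
    obtain ⟨f, hf⟩ := h.surj (l ∘ₗ T.symm.toLinearMap)
    exact ⟨T.symm f, fun e => by simp [hf]⟩

variable [Algebra ℝ R] [StarModule ℝ R]

theorem IsPosForm.smul (h : IsPosForm B) {r : ℝ} (hr : 0 ≤ r) :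
    IsPosForm fun e e' => r • B e e' where
  toIsSesq := h.toIsSesq.smul r
  symm e e' := by rw [h.symm e e', star_smul, star_trivial r]
  pos e := (h.pos e).smul hr

theorem IsMetric.smul (h : IsMetric B) {r : ℝ} (hr : 0 < r) :
    IsMetric fun e e' => r • B e e' where
  toIsPosForm := h.toIsPosForm.smul hr.le
  inj e he := h.inj e fun e' => (smul_eq_zero_iff_right hr.ne').1 (he e')
  surj l := by
    obtain ⟨f, hf⟩ := h.surj l
    refine ⟨(r⁻¹ • (1 : R)) • f, fun e => ?_⟩
    rw [h.smul_left, hf, star_smul, star_one, star_trivial r⁻¹, mul_smul_comm, mul_one, smul_smul,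
      mul_inv_cancel₀ hr.ne', one_smul]

variable [PositiveCone R]

theorem IsPosForm.add (h : IsPosForm B) (h' : IsPosForm B') :
    IsPosForm fun e e' => B e e' + B' e e' where
  toIsSesq := h.toIsSesq.add h'.toIsSesq
  symm e e' := by rw [h.symm e e', h'.symm e e', star_add]
  pos e := (h.pos e).add (h'.pos e)

theorem IsPosForm.zero : IsPosForm fun _ _ : M => (0 : R) where
  add_left := by simp
  add_right := by simp
  smul_left := by simp
  smul_right := by simp
  symm := by simp
  pos _ := isPos_zero

theorem IsPosForm.sum {ι : Type*} (s : Finset ι) {C : ι → M → M → R}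
    (h : ∀ i ∈ s, IsPosForm (C i)) : IsPosForm fun e e' => ∑ i ∈ s, C i e e' := by
  classical
  induction s using Finset.induction_on with
  | empty => simpa using IsPosForm.zero
  | insert i s hi ih =>
    simp only [sum_insert hi]
    exact (h i (mem_insert_self _ _)).add (ih fun j hj => h j (mem_insert_of_mem hj))

/-- The Cauchy–Schwarz inequality. -/
theorem IsPosForm.cauchy_schwarz (h : IsPosForm B) {f : M} {c : ℝ} (hc : 0 < c)
    (hf : IsPos (c • (1 : R) - B f f)) (e : M) :
    IsPos (c • B e e - B f e * star (B f e)) := by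
  set a := B f e with ha
  have hs : ∀ (r : ℝ) (b : R), star (r • b) = r • star b := fun r b => by
    rw [star_smul, star_trivial r]
  have h1 := (h.pos (e - (c⁻¹ • a) • f)).smul hc.le
  have h2 := (hf.conj a).smul (inv_nonneg.2 hc.le)
  have h3 := h1.add h2
  have h4 : B e f = star a := h.symm f e
  have hc2 : c * (c⁻¹ * c⁻¹) = c⁻¹ := mul_inv_cancel_left₀ hc.ne' _
  have key : c • B (e - (c⁻¹ • a) • f) (e - (c⁻¹ • a) • f) +
      c⁻¹ • (a * (c • (1 : R) - B f f) * star a) = c • B e e - a * star a := by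
    simp only [h.sub_left, h.sub_right, h.smul_left, h.smul_right, h4, ← ha, hs, mul_sub, sub_mul,
      smul_sub, smul_mul_assoc, mul_smul_comm, smul_smul, mul_one, mul_inv_cancel₀ hc.ne',
      inv_mul_cancel₀ hc.ne', one_smul, mul_assoc, hc2]
    abel
  rwa [key] at h3

theorem IsPosForm.eq_zero_of_self (h : IsPosForm B) {e : M} (he : B e e = 0) (f : M) :
    B f e = 0 := by
  obtain ⟨c, hc, hf⟩ := PositiveCone.bounded (h.symm f f).symm
  have h1 := h.cauchy_schwarz hc hf e
  rw [he, smul_zero, zero_sub] at h1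
  have := PositiveCone.eq_zero (b := star (B f e)) (by rwa [star_star])
  simpa using this

theorem IsMetric.eq_zero_of_self (h : IsMetric B) {e : M} (he : B e e = 0) : e = 0 :=
  h.inj e fun e' => by rw [h.symm e' e, h.toIsPosForm.eq_zero_of_self he, star_zero]

/-! ### Positive square roots -/

/-- `S` is a positive self-adjoint operator for the form `B`, whose square is the operator that
represents the form `B'`. -/
structure IsPosSqrt (B B' : M → M → R) (S : M →ₗ[R] M) : Prop where
  selfAdj : ∀ e e', B (S e) e' = B e (S e')
  pos : ∀ e, IsPos (B (S e) e)
  sq : ∀ e e', B (S e) (S e') = B' e e'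

/-- A positive square root which commutes with everything that commutes with its square. -/
structure IsSqrt (B B' : M → M → R) (S : M →ₗ[R] M) : Prop extends IsPosSqrt B B' S where
  comm : ∀ T : M →ₗ[R] M, (∀ e, T (S (S e)) = S (S (T e))) → ∀ e, T (S e) = S (T e)

namespace IsPosSqrt

variable {S T : M →ₗ[R] M}

theorem injective (hB' : IsMetric B') (h : IsPosSqrt B B' S) (hB : IsPosForm B) {e : M}
    (he : S e = 0) : e = 0 :=
  hB'.inj e fun e' => by rw [← h.sq, he, hB.zero_left]

theorem bijective (hB : IsMetric B) (hB' : IsMetric B') (h : IsPosSqrt B B' S) :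
    Function.Bijective S := by
  have h0 := fun e => h.injective hB' hB.toIsPosForm (e := e)
  refine ⟨(injective_iff_map_eq_zero S).2 h0, fun v => ?_⟩
  obtain ⟨e, he⟩ := hB'.surj (hB.toLinearMap v ∘ₗ S)
  refine ⟨e, sub_eq_zero.1 (h0 _ (hB.ext fun e' => ?_))⟩
  have h1 : B' e e' = B v (S e') := he e'
  rw [h.selfAdj, hB.sub_left, h.sq, h1, sub_self, hB.zero_left]

/-- The form `B (S ·) ·`. -/
theorem isPosForm (hB : IsPosForm B) (h : IsPosSqrt B B' S) : IsPosForm fun e e' => B (S e) e' where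
  toIsSesq := hB.toIsSesq.comp S LinearMap.id
  symm e e' := by rw [h.selfAdj, hB.symm]
  pos := h.pos

theorem isMetric (hB : IsMetric B) (hB' : IsMetric B') (h : IsPosSqrt B B' S) :
    IsMetric fun e e' => B (S e) e' where
  toIsPosForm := h.isPosForm hB.toIsPosForm
  inj e he := h.injective hB' hB.toIsPosForm (hB.inj _ he)
  surj l := by
    obtain ⟨f, hf⟩ := hB.surj l
    obtain ⟨e, rfl⟩ := (h.bijective hB hB').2 f
    exact ⟨e, hf⟩

theorem sq_eq (hB : IsMetric B) (h : IsPosSqrt B B' S) (hT : IsPosSqrt B B' T) (e : M) :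
    S (S e) = T (T e) :=
  hB.ext fun e' => by rw [h.selfAdj, h.sq, hT.selfAdj, hT.sq]

end IsPosSqrt

/-- Uniqueness of the positive square root. If `S` and `T` are both square roots, they commute, so
`(S + T) (S - T) = 0`, and `S + T` is positive definite. -/
theorem IsSqrt.unique (hB : IsMetric B) (hB' : IsMetric B') {S T : M →ₗ[R] M} (h : IsSqrt B B' S)
    (hT : IsPosSqrt B B' T) : S = T := by
  have hsq := h.toIsPosSqrt.sq_eq hB hT
  have hST : ∀ e, T (S e) = S (T e) := h.comm T fun e => by rw [hsq, hsq]
  ext e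
  rw [← sub_eq_zero]
  set d := S e - T e with hd
  have h1 : S d + T d = 0 := by
    rw [hd, map_sub, map_sub, hsq, hST]
    abel
  have h2 : B (S d) d + B (T d) d = 0 := by rw [← hB.add_left, h1, hB.zero_left]
  have h3 := (h.pos d).of_add_eq_zero (hT.pos d) h2
  have h4 := (h.toIsPosSqrt.isPosForm hB.toIsPosForm).eq_zero_of_self h3
  refine h.toIsPosSqrt.injective hB' hB.toIsPosForm (hB.inj _ fun f => ?_)
  rw [hB.symm f, ← h.selfAdj, h4, star_zero]

end Forms

/-! ### Transport along semilinear isomorphisms -/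

section Transport

variable {R S M N : Type*} [Ring R] [StarRing R] [Algebra ℝ R] [Ring S] [StarRing S] [Algebra ℝ S]
  [AddCommGroup M] [Module R M] [AddCommGroup N] [Module S N]

/-- An isomorphism of modules over an isomorphism of `*`-algebras. -/
structure IsSemiIso (τ : R ≃ₐ[ℝ] S) (g : M ≃+ N) : Prop where
  star : ∀ a, τ (star a) = star (τ a)
  smul : ∀ a e, g (a • e) = τ a • g e

variable {τ : R ≃ₐ[ℝ] S} {g : M ≃+ N}

theorem IsSemiIso.symm (h : IsSemiIso τ g) : IsSemiIso τ.symm g.symm where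
  star a := by rw [AlgEquiv.symm_apply_eq, h.star, AlgEquiv.apply_symm_apply]
  smul a e := by
    rw [AddEquiv.symm_apply_eq, h.smul, AlgEquiv.apply_symm_apply, AddEquiv.apply_symm_apply]

/-- The form on `N` that corresponds to the form `B` on `M`. -/
def transportForm (τ : R ≃ₐ[ℝ] S) (g : M ≃+ N) (B : M → M → R) (p p' : N) : S :=
  τ (B (g.symm p) (g.symm p'))

/-- The linear functional on `M` that corresponds to one on `N`. -/
def IsSemiIso.pullDual (h : IsSemiIso τ g) (l : N →ₗ[S] S) : M →ₗ[R] R where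
  toFun e := τ.symm (l (g e))
  map_add' e e' := by simp
  map_smul' a e := by rw [h.smul, map_smul, smul_eq_mul, map_mul]; simp

/-- The endomorphism of `M` that corresponds to one of `N`. -/
def IsSemiIso.pullEnd (h : IsSemiIso τ g) (T : N →ₗ[S] N) : M →ₗ[R] M where
  toFun e := g.symm (T (g e))
  map_add' e e' := by simp
  map_smul' a e := by rw [h.smul, map_smul, h.symm.smul]; simp

theorem IsSemiIso.pullEnd_apply (h : IsSemiIso τ g) (T : N →ₗ[S] N) (e : M) :
    h.pullEnd T e = g.symm (T (g e)) := rfl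

variable {B B' : M → M → R}

theorem IsSemiIso.isSesq (h : IsSemiIso τ g) (hB : IsSesq B) : IsSesq (transportForm τ g B) where
  add_left e₁ e₂ e' := by simp [transportForm, hB.add_left]
  add_right e e₁ e₂ := by simp [transportForm, hB.add_right]
  smul_left a e e' := by
    rw [transportForm, h.symm.smul, hB.smul_left, map_mul, h.star, AlgEquiv.apply_symm_apply]
    rfl
  smul_right a e e' := by
    rw [transportForm, h.symm.smul, hB.smul_right, map_mul, AlgEquiv.apply_symm_apply]
    rfl

theorem IsSemiIso.isPosForm (h : IsSemiIso τ g) (hB : IsPosForm B) :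
    IsPosForm (transportForm τ g B) where
  toIsSesq := h.isSesq hB.toIsSesq
  symm e e' := by rw [transportForm, hB.symm, h.star]; rfl
  pos e := (hB.pos _).map (τ := τ.toAlgHom) h.star

theorem IsSemiIso.isMetric (h : IsSemiIso τ g) (hB : IsMetric B) :
    IsMetric (transportForm τ g B) where
  toIsPosForm := h.isPosForm hB.toIsPosForm
  inj e he := by
    rw [← g.symm.map_eq_zero_iff]
    refine hB.inj _ fun e' => ?_
    have := he (g e')
    rwa [transportForm, AddEquiv.symm_apply_apply, EmbeddingLike.map_eq_zero_iff] at this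
  surj l := by
    obtain ⟨f, hf⟩ := hB.surj (h.pullDual l)
    refine ⟨g f, fun e => ?_⟩
    rw [transportForm, AddEquiv.symm_apply_apply, hf]
    simp [IsSemiIso.pullDual]

theorem IsSemiIso.isSqrt (h : IsSemiIso τ g) {T : N →ₗ[S] N}
    (hT : IsSqrt (transportForm τ g B) (transportForm τ g B') T) : IsSqrt B B' (h.pullEnd T) where
  selfAdj e e' := by
    have := hT.selfAdj (g e) (g e')
    simpa [transportForm, h.pullEnd_apply] using this
  pos e := by
    have := (hT.pos (g e)).map (τ := τ.symm.toAlgHom) h.symm.star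
    simpa [transportForm, h.pullEnd_apply] using this
  sq e e' := by
    have := hT.sq (g e) (g e')
    simpa [transportForm, h.pullEnd_apply] using this
  comm U hU e := by
    have := hT.comm (h.symm.pullEnd U) (fun p => by
      have := hU (g.symm p)
      simp only [IsSemiIso.pullEnd_apply] at this ⊢
      simp at this ⊢
      rw [this]
      simp) (g e)
    simp only [IsSemiIso.pullEnd_apply] at this ⊢
    simp at this ⊢
    simpa using congrArg g.symm this

end Transport

/-- A sesquilinear form is represented, with respect to a metric, by an operator, because the metric
identifies the module with its dual. -/
theorem IsMetric.exists_repr {R M : Type*} [Ring R] [StarRing R] [AddCommGroup M] [Module R M]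
    {B D : M → M → R} (hB : IsMetric B) (hD : IsSesq D) :
    ∃ S : M →ₗ[R] M, ∀ e e', B (S e) e' = D e e' := by
  choose S hS using fun e => hB.surj (hD.toLinearMap e)
  have hS' : ∀ e e', B (S e) e' = D e e' := hS
  refine ⟨⟨⟨S, fun e₁ e₂ => hB.ext fun e' => ?_⟩, fun a e => hB.ext fun e' => ?_⟩, hS'⟩
  · rw [hB.add_left, hS', hS', hS', hD.add_left]
  · rw [RingHom.id_apply, hB.smul_left, hS', hS', hD.smul_left]

/-! ### Normed frames -/

/-- A frame of a normed module `P` over `A`: it displays `P` as a direct summand of `A ^ n`, whose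
norm is equivalent to that of `P`. -/
structure Frame (A P : Type*) [NormedRing A] [NormedAddCommGroup P] [Module A P] where
  n : ℕ
  vec : Fin n → P
  coord : Fin n → P →ₗ[A] A
  sum_eq : ∀ p, ∑ i, coord i p • vec i = p
  norm_coord_le : ∀ i p, ‖coord i p‖ ≤ ‖p‖

theorem IsPos.norm_le {A : Type*} [NormedRing A] [NormedAlgebra ℝ A] [StarRing A]
    [StarModule ℝ A] [RealCStar A] {a b : A} (ha : IsPos a) (hab : IsPos (b - a)) :
    ‖a‖ ≤ ‖b‖ := by
  obtain ⟨d, rfl⟩ := ha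
  have h : ‖star d‖ ^ 2 ≤ ‖b‖ := RealCStar.norm_sq_le (by rwa [star_star])
  calc ‖star d * d‖ ≤ ‖star d‖ * ‖d‖ := norm_mul_le _ _
    _ = ‖star d‖ ^ 2 := by rw [norm_star, sq]
    _ ≤ ‖b‖ := h

theorem isPos_smul_one_sub {A : Type*} [NormedRing A] [NormedAlgebra ℝ A] [StarRing A]
    [StarModule ℝ A] [RealCStar A] {a : A} (ha : star a = a) {r : ℝ} (hr : ‖a‖ ≤ r) :
    IsPos (r • (1 : A) - a) := by
  have h := (RealCStar.isPos_norm_sub ha).add (isPos_smul_one (R := A) (sub_nonneg.2 hr))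
  rwa [sub_smul, sub_add_sub_cancel'] at h

namespace Frame

variable {A : Type*} [NormedRing A] [NormedAlgebra ℝ A] [CompleteSpace A] [StarRing A]
  [StarModule ℝ A] [RealCStar A]
  {P : Type*} [NormedAddCommGroup P] [NormedSpace ℝ P] [CompleteSpace P] [Module A P]
  [IsScalarTower ℝ A P] [IsBoundedSMul A P]

theorem continuous_coord (F : Frame A P) (i : Fin F.n) : Continuous (F.coord i) :=
  AddMonoidHomClass.continuous_of_bound (F.coord i) 1 fun p => by
    rw [one_mul]
    exact F.norm_coord_le i p

theorem map_eq_sum (F : Frame A P) {Q : Type*} [AddCommGroup Q] [Module A Q] (T : P →ₗ[A] Q)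
    (p : P) : T p = ∑ i, F.coord i p • T (F.vec i) := by
  conv_lhs => rw [← F.sum_eq p]
  simp

theorem norm_map_le (F : Frame A P) {Q : Type*} [NormedAddCommGroup Q] [Module A Q]
    [IsBoundedSMul A Q] (T : P →ₗ[A] Q) (p : P) : ‖T p‖ ≤ (∑ i, ‖T (F.vec i)‖) * ‖p‖ := by
  rw [F.map_eq_sum T p, sum_mul]
  refine (norm_sum_le _ _).trans (sum_le_sum fun i _ => ?_)
  refine (norm_smul_le _ _).trans ?_
  rw [mul_comm]
  exact mul_le_mul_of_nonneg_left (F.norm_coord_le i p) (norm_nonneg _)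

/-- An `A`-linear endomorphism as an element of the Banach algebra of bounded operators. -/
noncomputable def toCLM (F : Frame A P) (T : P →ₗ[A] P) : P →L[ℝ] P :=
  (T.restrictScalars ℝ).mkContinuous (∑ i, ‖T (F.vec i)‖) (F.norm_map_le T)

@[simp] theorem toCLM_apply (F : Frame A P) (T : P →ₗ[A] P) (p : P) : F.toCLM T p = T p := rfl

theorem norm_toCLM_le (F : Frame A P) (T : P →ₗ[A] P) : ‖F.toCLM T‖ ≤ ∑ i, ‖T (F.vec i)‖ :=
  LinearMap.mkContinuous_norm_le _ (sum_nonneg fun _ _ => norm_nonneg _) _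

theorem toCLM_pow_apply (F : Frame A P) (T : Module.End A P) (n : ℕ) (p : P) :
    (F.toCLM T ^ n) p = (T ^ n) p := by
  induction n generalizing p with
  | zero => rfl
  | succ n ih =>
    rw [pow_succ, pow_succ, mul_apply_eq_comp, Module.End.mul_apply, ih]
    rfl

variable {Y : Type*} [TopologicalSpace Y] {y₀ : Y}

/-- Operators depend continuously on a parameter in the operator norm if they do so pointwise. -/
theorem continuousAt_toCLM (F : Frame A P) {T : Y → P →ₗ[A] P}
    (hT : ∀ p, ContinuousAt (fun y => T y p) y₀) :
    ContinuousAt (fun y => F.toCLM (T y)) y₀ := by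
  rw [ContinuousAt, tendsto_iff_norm_sub_tendsto_zero]
  refine squeeze_zero (fun _ => norm_nonneg _) (fun y => ?_)
    (g := fun y => ∑ i, ‖T y (F.vec i) - T y₀ (F.vec i)‖) ?_
  · have : F.toCLM (T y) - F.toCLM (T y₀) = F.toCLM (T y - T y₀) := by ext; rfl
    rw [this]
    exact F.norm_toCLM_le _
  · rw [← sum_const_zero (s := univ) (ι := Fin F.n)]
    exact tendsto_finsetSum _ fun i _ => tendsto_iff_norm_sub_tendsto_zero.1 (hT (F.vec i))

/-- Joint continuity of a family of operators. -/
theorem continuousAt_apply (F : Frame A P) {Z : Type*} [TopologicalSpace Z] {z₀ : Z}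
    {T : Z → P →ₗ[A] P} (hT : ∀ p, ContinuousAt (fun z => T z p) z₀) {p : Z → P}
    (hp : ContinuousAt p z₀) :
    ContinuousAt (fun z => T z (p z)) z₀ :=
  (F.continuousAt_toCLM hT).clm_apply hp

section Sesq

variable {B D : P → P → A}

theorem form_eq_sum (F : Frame A P) (hB : IsSesq B) (e e' : P) :
    B e e' = ∑ i, ∑ j, F.coord j e' * B (F.vec i) (F.vec j) * star (F.coord i e) := by
  conv_lhs => rw [← F.sum_eq e, ← F.sum_eq e', hB.sum_left]
  refine sum_congr rfl fun i _ => ?_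
  rw [hB.sum_right]
  refine sum_congr rfl fun j _ => ?_
  rw [hB.smul_left, hB.smul_right]

theorem norm_form_le (F : Frame A P) (hB : IsSesq B) (e e' : P) :
    ‖B e e'‖ ≤ (∑ i, ∑ j, ‖B (F.vec i) (F.vec j)‖) * ‖e‖ * ‖e'‖ := by
  rw [F.form_eq_sum hB e e', sum_mul, sum_mul]
  refine (norm_sum_le _ _).trans (sum_le_sum fun i _ => ?_)
  rw [sum_mul, sum_mul]
  refine (norm_sum_le _ _).trans (sum_le_sum fun j _ => ?_)
  calc ‖F.coord j e' * B (F.vec i) (F.vec j) * star (F.coord i e)‖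
      ≤ ‖F.coord j e'‖ * ‖B (F.vec i) (F.vec j)‖ * ‖F.coord i e‖ := by
        rw [← norm_star (F.coord i e)]
        exact norm_mul₃_le
    _ ≤ ‖e'‖ * ‖B (F.vec i) (F.vec j)‖ * ‖e‖ := by
        gcongr <;> exact F.norm_coord_le _ _
    _ = ‖B (F.vec i) (F.vec j)‖ * ‖e‖ * ‖e'‖ := by ring

theorem continuous_form_left (F : Frame A P) (hB : IsSesq B) (e' : P) :
    Continuous fun e => B e e' := by
  have h : (fun e => B e e') = fun e => ∑ i, ∑ j,
      F.coord j e' * B (F.vec i) (F.vec j) * star (F.coord i e) :=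
    funext fun e => F.form_eq_sum hB e e'
  rw [h]
  have := F.continuous_coord
  fun_prop

theorem continuous_form_right (F : Frame A P) (hB : IsSesq B) (e : P) :
    Continuous fun e' => B e e' := by
  have h : (fun e' => B e e') = fun e' => ∑ i, ∑ j,
      F.coord j e' * B (F.vec i) (F.vec j) * star (F.coord i e) :=
    funext fun e' => F.form_eq_sum hB e e'
  rw [h]
  have := F.continuous_coord
  fun_prop

/-- Joint continuity of a family of sesquilinear forms. -/
theorem continuousAt_form (F : Frame A P) {Z : Type*} [TopologicalSpace Z] {z₀ : Z}
    {B : Z → P → P → A} (hB : ∀ᶠ z in 𝓝 z₀, IsSesq (B z))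
    (hc : ∀ e e', ContinuousAt (fun z => B z e e') z₀)
    {p p' : Z → P} (hp : ContinuousAt p z₀) (hp' : ContinuousAt p' z₀) :
    ContinuousAt (fun z => B z (p z) (p' z)) z₀ := by
  have h : (fun z => B z (p z) (p' z)) =ᶠ[𝓝 z₀] fun z => ∑ i, ∑ j,
      F.coord j (p' z) * B z (F.vec i) (F.vec j) * star (F.coord i (p z)) := by
    filter_upwards [hB] with z hz using F.form_eq_sum hz _ _
  refine ContinuousAt.congr ?_ h.symm
  refine tendsto_finsetSum _ fun i _ => tendsto_finsetSum _ fun j _ => ?_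
  exact ((((F.continuous_coord j).continuousAt).comp hp').mul (hc _ _)).mul
    (((F.continuous_coord i).continuousAt).comp hp).star

end Sesq

theorem _root_.TwistedK.IsSesq.real_smul_left {B : P → P → A} (hB : IsSesq B) (r : ℝ) (e e' : P) :
    B (r • e) e' = r • B e e' := by
  rw [← one_smul A e, ← smul_assoc, hB.smul_left, star_smul, star_one, star_trivial r,
    mul_smul_comm, mul_one, one_smul]

theorem _root_.TwistedK.IsSesq.real_smul_right {B : P → P → A} (hB : IsSesq B) (r : ℝ) (e e' : P) :
    B e (r • e') = r • B e e' := by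
  rw [← one_smul A e', ← smul_assoc, hB.smul_right, smul_mul_assoc, one_mul, one_smul]

/-! ### Comparison of a metric with the norm -/

section Estimates

variable {B : Y → P → P → A}

/-- A metric bounds the norm from below: the coordinate functionals of the frame are of the form
`B f`, so that the Cauchy–Schwarz inequality bounds the coordinates of `e` by `B e e`. -/
theorem exists_norm_sq_le (F : Frame A P) {B : P → P → A} (hB : IsMetric B) :
    ∃ K : ℝ, 0 < K ∧ ∀ e, ‖e‖ ^ 2 ≤ K * ‖B e e‖ := by
  choose f hf using fun i => hB.surj (F.coord i)
  choose c hc hcf using fun i => PositiveCone.bounded (hB.symm (f i) (f i)).symm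
  refine ⟨(∑ i, √(c i) * ‖F.vec i‖) ^ 2 + 1, by positivity, fun e => ?_⟩
  have h1 : ∀ i, ‖F.coord i e‖ ≤ √(c i) * √‖B e e‖ := fun i => by
    have h2 := RealCStar.norm_sq_le (hB.cauchy_schwarz (hc i) (hcf i) e)
    rw [hf, norm_smul, Real.norm_of_nonneg (hc i).le] at h2
    rw [← Real.sqrt_mul (hc i).le]
    exact Real.le_sqrt_of_sq_le h2
  have h3 : ‖e‖ ≤ (∑ i, √(c i) * ‖F.vec i‖) * √‖B e e‖ := by
    conv_lhs => rw [← F.sum_eq e]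
    rw [sum_mul]
    refine (norm_sum_le _ _).trans (sum_le_sum fun i _ => (norm_smul_le _ _).trans ?_)
    calc ‖F.coord i e‖ * ‖F.vec i‖ ≤ √(c i) * √‖B e e‖ * ‖F.vec i‖ := by gcongr; exact h1 i
      _ = √(c i) * ‖F.vec i‖ * √‖B e e‖ := by ring
  calc ‖e‖ ^ 2 ≤ ((∑ i, √(c i) * ‖F.vec i‖) * √‖B e e‖) ^ 2 := by gcongr
    _ = (∑ i, √(c i) * ‖F.vec i‖) ^ 2 * ‖B e e‖ := by
      rw [mul_pow, Real.sq_sqrt (norm_nonneg _)]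
    _ ≤ _ := by nlinarith [norm_nonneg (B e e)]

/-- The lower bound for a metric is locally uniform. -/
theorem eventually_norm_sq_le (F : Frame A P) (hB : ∀ᶠ y in 𝓝 y₀, IsMetric (B y))
    (hc : ∀ e e', ContinuousAt (fun y => B y e e') y₀) :
    ∃ K : ℝ, 0 < K ∧ ∀ᶠ y in 𝓝 y₀, ∀ e, ‖e‖ ^ 2 ≤ K * ‖B y e e‖ := by
  have h0 := hB.self_of_nhds
  obtain ⟨K, hK, h⟩ := F.exists_norm_sq_le h0
  have hlim : Tendsto (fun y => ∑ i, ∑ j,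
      ‖B y (F.vec i) (F.vec j) - B y₀ (F.vec i) (F.vec j)‖) (𝓝 y₀) (𝓝 0) := by
    rw [← sum_const_zero (s := univ) (ι := Fin F.n)]
    refine tendsto_finsetSum _ fun i _ => ?_
    rw [← sum_const_zero (s := univ) (ι := Fin F.n)]
    exact tendsto_finsetSum _ fun j _ => tendsto_iff_norm_sub_tendsto_zero.1 (hc _ _)
  refine ⟨2 * K, by positivity, ?_⟩
  have hη : (0 : ℝ) < 1 / (2 * K) := by positivity
  filter_upwards [hB, hlim.eventually_lt_const hη] with y hy hlt e
  have h1 := F.norm_form_le (hy.toIsSesq.sub h0.toIsSesq) e e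
  have h2 : ‖B y e e - B y₀ e e‖ ≤ 1 / (2 * K) * ‖e‖ * ‖e‖ := by
    refine h1.trans ?_
    gcongr
  have h3 : ‖B y₀ e e‖ ≤ ‖B y e e‖ + ‖B y e e - B y₀ e e‖ := by
    rw [norm_sub_rev]
    exact norm_le_insert' _ _
  have h4 : K * (1 / (2 * K) * ‖e‖ * ‖e‖) = ‖e‖ ^ 2 / 2 := by field_simp
  have h5 := h e
  nlinarith [mul_le_mul_of_nonneg_left (h3.trans (add_le_add_right h2 ‖B y e e‖)) hK.le]

/-- A vector which is represented continuously, by a continuous family of metrics, depends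
continuously on the parameter. -/
theorem continuousAt_of_form (F : Frame A P) (hB : ∀ᶠ y in 𝓝 y₀, IsMetric (B y))
    (hc : ∀ e e', ContinuousAt (fun y => B y e e') y₀) {v : Y → P}
    (hv : ∀ e', ContinuousAt (fun y => B y (v y) e') y₀) : ContinuousAt v y₀ := by
  obtain ⟨K, hK, h⟩ := F.eventually_norm_sq_le hB hc
  rw [ContinuousAt, tendsto_iff_norm_sub_tendsto_zero]
  refine squeeze_zero' (Eventually.of_forall fun _ => norm_nonneg _)
    (g := fun y => K * ∑ j, ‖B y (v y) (F.vec j) - B y (v y₀) (F.vec j)‖) ?_ ?_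
  · filter_upwards [hB, h] with y hy hKy
    have h1 := hKy (v y - v y₀)
    have h2 := F.norm_map_le (hy.toLinearMap (v y - v y₀)) (v y - v y₀)
    have h3 : ∀ e', hy.toLinearMap (v y - v y₀) e' = B y (v y) e' - B y (v y₀) e' := fun e' =>
      hy.sub_left _ _ _
    have h4 : hy.toLinearMap (v y - v y₀) (v y - v y₀) = B y (v y - v y₀) (v y - v y₀) := rfl
    rw [h4] at h2
    simp only [h3] at h2
    have h5 := h1.trans (mul_le_mul_of_nonneg_left h2 hK.le)
    rw [sq, ← mul_assoc] at h5
    by_cases h6 : ‖v y - v y₀‖ = 0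
    · rw [h6]
      positivity
    · exact le_of_mul_le_mul_right h5 (lt_of_le_of_ne (norm_nonneg _) (Ne.symm h6))
  · rw [← mul_zero K, ← sum_const_zero (s := univ) (ι := Fin F.n)]
    refine (tendsto_finsetSum _ fun j _ => ?_).const_mul K
    have := ((hv (F.vec j)).sub (hc (v y₀) (F.vec j))).norm
    simpa [ContinuousAt] using this

/-- The difference is half the sum of the squares `C (x i - x j) (x i - x j)`. -/
theorem isPos_card_smul_sum_sub {ι : Type*} (s : Finset ι) {C : P → P → A} (hC : IsPosForm C)
    (x : ι → P) :
    IsPos ((#s : ℝ) • ∑ i ∈ s, C (x i) (x i) - C (∑ i ∈ s, x i) (∑ i ∈ s, x i)) := by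
  have h : IsPos ((1 / 2 : ℝ) • ∑ i ∈ s, ∑ j ∈ s, C (x i - x j) (x i - x j)) :=
    (isPos_sum _ _ fun i _ => isPos_sum _ _ fun j _ => hC.pos _).smul (by norm_num)
  convert h using 1
  have h1 : ∑ i ∈ s, ∑ j ∈ s, C (x j) (x i) = ∑ i ∈ s, ∑ j ∈ s, C (x i) (x j) := sum_comm
  simp only [hC.sub_left, hC.sub_right, sum_sub_distrib, sum_const, hC.sum_left, hC.sum_right,
    h1, ← smul_sum, ← Nat.cast_smul_eq_nsmul ℝ]
  module

/-- A metric dominates every positive form, locally uniformly: each summand of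
`e = ∑ coord i e • vec i` is dominated by the Cauchy–Schwarz inequality, and then
`isPos_card_smul_sum_sub` applies. -/
theorem eventually_isPos_sub (F : Frame A P) {C : Y → P → P → A}
    (hB : ∀ᶠ y in 𝓝 y₀, IsMetric (B y))
    (hc : ∀ e e', ContinuousAt (fun y => B y e e') y₀) (hC : ∀ᶠ y in 𝓝 y₀, IsPosForm (C y))
    (hc' : ∀ e e', ContinuousAt (fun y => C y e e') y₀) :
    ∃ c : ℝ, 0 < c ∧ ∀ᶠ y in 𝓝 y₀, ∀ e, IsPos (c • B y e e - C y e e) := by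
  -- The dual frame `f`: the coordinate functionals are the `B y (f i y)`.
  have hf : ∀ i, ∃ f : Y → P, ∀ᶠ y in 𝓝 y₀, ∀ e, B y (f y) e = F.coord i e := fun i => by
    classical
    refine ⟨fun y => if h : IsMetric (B y) then (h.surj (F.coord i)).choose else 0, ?_⟩
    filter_upwards [hB] with y hy
    simp only [dif_pos hy]
    exact (hy.surj (F.coord i)).choose_spec
  choose f hf using hf
  have hfc : ∀ i, ContinuousAt (f i) y₀ := fun i =>
    F.continuousAt_of_form hB hc fun e' =>
      continuousAt_const.congr ((hf i).mono fun y hy => (hy e').symm)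
  obtain ⟨μ, hμ, hμf⟩ : ∃ μ : ℝ, 0 < μ ∧ ∀ᶠ y in 𝓝 y₀, ∀ i, ‖F.coord i (f i y)‖ ≤ μ := by
    refine ⟨∑ i, ‖F.coord i (f i y₀)‖ + 1, by positivity, eventually_all.2 fun i => ?_⟩
    have h1 : ContinuousAt (fun y => ‖F.coord i (f i y)‖) y₀ :=
      ((F.continuous_coord i).continuousAt.comp (hfc i)).norm
    refine (h1.eventually_lt continuousAt_const ?_).mono fun y hy => hy.le
    have := single_le_sum (fun j _ => norm_nonneg (F.coord j (f j y₀))) (mem_univ i)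
    linarith
  obtain ⟨ν, hν, hνC⟩ : ∃ ν : ℝ, 0 < ν ∧ ∀ᶠ y in 𝓝 y₀, ∀ i,
      ‖C y (F.vec i) (F.vec i)‖ ≤ ν := by
    refine ⟨∑ i, ‖C y₀ (F.vec i) (F.vec i)‖ + 1, by positivity, eventually_all.2 fun i => ?_⟩
    refine ((hc' _ _).norm.eventually_lt continuousAt_const ?_).mono fun y hy => hy.le
    have := single_le_sum (fun j _ => norm_nonneg (C y₀ (F.vec j) (F.vec j))) (mem_univ i)
    linarith
  refine ⟨F.n * (F.n * (ν * μ)) + 1, by positivity, ?_⟩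
  filter_upwards [hB, hC, eventually_all.2 hf, hμf, hνC] with y hBy hCy hfy hμy hνy e
  have h1 : ∀ i, IsPos ((ν * μ) • B y e e -
      C y (F.coord i e • F.vec i) (F.coord i e • F.vec i)) := fun i => by
    have h2 := (hBy.cauchy_schwarz hμ (isPos_smul_one_sub (hBy.symm (f i y) (f i y)).symm
      (by rw [hfy]; exact hμy i)) e).smul hν.le
    rw [hfy] at h2
    have h3 := (isPos_smul_one_sub (hCy.symm (F.vec i) (F.vec i)).symm (hνy i)).conj (F.coord i e)
    have h4 := h2.add h3
    rw [mul_sub, sub_mul, mul_smul_comm, smul_mul_assoc, mul_one, smul_sub, sub_add_sub_cancel,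
      smul_smul] at h4
    rwa [hCy.smul_left, hCy.smul_right]
  have h5 := isPos_card_smul_sum_sub univ hCy fun i => F.coord i e • F.vec i
  have h6 := (isPos_sum univ _ fun i _ => h1 i).smul (Nat.cast_nonneg (α := ℝ) F.n)
  rw [F.sum_eq, card_univ, Fintype.card_fin] at h5
  rw [sum_sub_distrib, sum_const, card_univ, Fintype.card_fin, smul_sub,
    ← Nat.cast_smul_eq_nsmul ℝ, smul_smul] at h6
  have h7 := (h6.add h5).add (hBy.pos e)
  convert h7 using 1
  module

theorem exists_isPos_sub (F : Frame A P) {B C : P → P → A} (hB : IsMetric B) (hC : IsPosForm C) :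
    ∃ c : ℝ, 0 < c ∧ ∀ e, IsPos (c • B e e - C e e) := by
  obtain ⟨c, hc, h⟩ := F.eventually_isPos_sub (y₀ := ()) (B := fun _ => B) (C := fun _ => C)
    (Eventually.of_forall fun _ => hB) (fun _ _ => continuousAt_const)
    (Eventually.of_forall fun _ => hC) (fun _ _ => continuousAt_const)
  exact ⟨c, hc, h.self_of_nhds⟩

end Estimates

end Frame

namespace Frame

variable {A : Type*} [NormedRing A] [NormedAlgebra ℝ A] [CompleteSpace A] [StarRing A]
  [StarModule ℝ A] [RealCStar A]
  {P : Type*} [NormedAddCommGroup P] [NormedSpace ℝ P] [CompleteSpace P] [Module A P]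
  [IsScalarTower ℝ A P] [IsBoundedSMul A P]

/-! ### Operators between `0` and `r` -/

section Order

variable {B : P → P → A} {x : Module.End A P} {r : ℝ}

theorem selfAdj_pow (hx : ∀ e e', B (x e) e' = B e (x e')) (n : ℕ) (e e' : P) :
    B ((x ^ n) e) e' = B e ((x ^ n) e') := by
  induction n generalizing e e' with
  | zero => rfl
  | succ n ih =>
    rw [pow_succ, Module.End.mul_apply, ih, hx, ← Module.End.mul_apply, ← pow_succ', pow_succ]

/-- If `0 ≤ x ≤ r` then `x² ≤ r²`, because `r (r x - x²) = x (r - x) x + (r - x) x (r - x)`. -/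
theorem isPos_sq_sub (hB : IsPosForm B) (hr : 0 < r) (hx : ∀ e e', B (x e) e' = B e (x e'))
    (h0 : ∀ e, IsPos (B (x e) e)) (h1 : ∀ e, IsPos (r • B e e - B (x e) e)) (e : P) :
    IsPos (r ^ 2 • B e e - B (x e) (x e)) := by
  have a1 := (h1 (x e)).smul (inv_nonneg.2 hr.le)
  have a2 := (h0 (r • e - x e)).smul (inv_nonneg.2 hr.le)
  have a3 := (a1.add a2).add ((h1 e).smul hr.le)
  convert a3 using 1
  simp only [map_sub, LinearMap.map_smul_of_tower, hB.sub_left, hB.sub_right,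
    hB.real_smul_left, hB.real_smul_right, smul_sub, smul_smul, inv_mul_cancel₀ hr.ne',
    inv_mul_cancel_left₀ hr.ne', hx (x e) e, one_smul, sq]
  rw [hx e (x e), hx e e]
  rw [← hx e (x e)]
  abel

theorem isPos_pow_sub (hB : IsPosForm B) (hr : 0 < r) (hx : ∀ e e', B (x e) e' = B e (x e'))
    (h0 : ∀ e, IsPos (B (x e) e)) (h1 : ∀ e, IsPos (r • B e e - B (x e) e)) (n : ℕ) (e : P) :
    IsPos ((r ^ 2) ^ n • B e e - B ((x ^ n) e) ((x ^ n) e)) := by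
  induction n generalizing e with
  | zero => simpa using isPos_zero
  | succ n ih =>
    have a1 := ih (x e)
    have a2 := (isPos_sq_sub hB hr hx h0 h1 e).smul (pow_nonneg (sq_nonneg r) n)
    rw [smul_sub, smul_smul, ← pow_succ] at a2
    have := a1.trans a2
    rwa [← Module.End.mul_apply, ← pow_succ] at this

/-- The powers of an operator `0 ≤ x ≤ r` grow at most like `r ^ n` in the operator norm, since the
norm of the module is comparable to `√‖B e e‖`. No adjoint norm identity is needed. -/
theorem norm_pow_sq_le (F : Frame A P) (hB : IsPosForm B) (hr : 0 < r)
    (hx : ∀ e e', B (x e) e' = B e (x e')) (h0 : ∀ e, IsPos (B (x e) e))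
    (h1 : ∀ e, IsPos (r • B e e - B (x e) e)) {K L : ℝ} (hK : 0 ≤ K) (hL : 0 ≤ L)
    (hKB : ∀ e, ‖e‖ ^ 2 ≤ K * ‖B e e‖) (hLB : ∀ e, ‖B e e‖ ≤ L * ‖e‖ ^ 2) (n : ℕ) :
    ‖F.toCLM x ^ n‖ ≤ √(K * L) * r ^ n := by
  refine ContinuousLinearMap.opNorm_le_bound _ (by positivity) fun e => ?_
  rw [F.toCLM_pow_apply]
  have h2 := (hB.pos ((x ^ n) e)).norm_le (isPos_pow_sub hB hr hx h0 h1 n e)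
  rw [norm_smul, Real.norm_of_nonneg (by positivity)] at h2
  refine le_of_sq_le_sq ?_ (by positivity)
  calc ‖(x ^ n) e‖ ^ 2 ≤ K * ‖B ((x ^ n) e) ((x ^ n) e)‖ := hKB _
    _ ≤ K * ((r ^ 2) ^ n * (L * ‖e‖ ^ 2)) := by
      gcongr
      exact h2.trans (by gcongr; exact hLB e)
    _ = (√(K * L) * r ^ n * ‖e‖) ^ 2 := by
      rw [mul_pow, mul_pow, Real.sq_sqrt (by positivity)]
      ring

theorem norm_form_self_le (F : Frame A P) (hB : IsSesq B) (e : P) :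
    ‖B e e‖ ≤ (∑ i, ∑ j, ‖B (F.vec i) (F.vec j)‖) * ‖e‖ ^ 2 := by
  rw [sq, ← mul_assoc]
  exact F.norm_form_le hB e e

end Order

/-! ### Sums of metrics and positive forms -/

/-- The sum of a metric `B` and a positive form `D` is a metric: the operator that represents it
is `c (1 - x)` with `0 ≤ x ≤ r < 1`, so the powers of `x` tend to `0`. -/
theorem isMetric_add (F : Frame A P) {B D : P → P → A} (hB : IsMetric B) (hD : IsPosForm D) :
    IsMetric fun e e' => B e e' + D e e' := by
  have hBD := hB.toIsPosForm.add hD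
  obtain ⟨S, hS⟩ := hB.exists_repr hBD.toIsSesq
  obtain ⟨c₀, hc₀, hc⟩ := F.exists_isPos_sub hB hBD
  set c := c₀ + 1 with hc1
  have hcpos : 0 < c := by positivity
  set x : Module.End A P := 1 - c⁻¹ • S with hx
  have hxe : ∀ e, x e = e - c⁻¹ • S e := fun e => rfl
  have hBx : ∀ e e', B (x e) e' = B e e' - c⁻¹ • (B e e' + D e e') := fun e e' => by
    rw [hxe, hB.sub_left, hB.real_smul_left, hS]
  have hsymm : ∀ e e', B (x e) e' = B e (x e') := fun e e' => by
    rw [hB.symm (x e') e, hBx, hBx, star_sub, star_smul, star_trivial c⁻¹, star_add, ← hB.symm,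
      ← hD.symm]
  set r := 1 - c⁻¹ with hr
  have hr1 : r < 1 := by
    have := inv_pos.2 hcpos
    linarith
  have hr0 : 0 < r := by
    have : c⁻¹ < 1 := inv_lt_one_of_one_lt₀ (by linarith)
    linarith
  have h0 : ∀ e, IsPos (B (x e) e) := fun e => by
    have := ((hc e).add (hB.pos e)).smul (inv_nonneg.2 hcpos.le)
    have h : c₀ • B e e - (B e e + D e e) + B e e = c • B e e - (B e e + D e e) := by
      rw [hc1]
      module
    rw [h, smul_sub, smul_smul, inv_mul_cancel₀ hcpos.ne', one_smul] at this
    rwa [hBx]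
  have h1 : ∀ e, IsPos (r • B e e - B (x e) e) := fun e => by
    have := (hD.pos e).smul (inv_nonneg.2 hcpos.le)
    rw [hBx]
    convert this using 1
    rw [hr]
    module
  obtain ⟨K, hK, hKB⟩ := F.exists_norm_sq_le hB
  set L := ∑ i, ∑ j, ‖B (F.vec i) (F.vec j)‖
  have hL : 0 ≤ L := sum_nonneg fun _ _ => sum_nonneg fun _ _ => norm_nonneg _
  have hpow := F.norm_pow_sq_le hB.toIsPosForm hr0 hsymm h0 h1 hK.le hL hKB
    (F.norm_form_self_le hB.toIsSesq)
  have hlim : Tendsto (fun n => √(K * L) * r ^ n) atTop (𝓝 0) := by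
    simpa using (tendsto_pow_atTop_nhds_zero_of_lt_one hr0.le hr1).const_mul √(K * L)
  -- As `‖x ^ n‖ < 1` for some `n`, the factor `1 - x` of `1 - x ^ n` is invertible.
  obtain ⟨n, hn⟩ := (hlim.eventually_lt_const zero_lt_one).exists
  have hu : IsUnit (1 - F.toCLM x ^ n) := isUnit_one_sub_of_norm_lt_one ((hpow n).trans_lt hn)
  rw [← mul_neg_geom_sum] at hu
  have hcomm : Commute (1 - F.toCLM x) (∑ i ∈ range n, F.toCLM x ^ i) := by
    refine ((Commute.one_left _).sub_left (Commute.sum_right _ _ _ fun i _ => ?_))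
    exact (Commute.refl _).pow_right i
  obtain ⟨v, hv⟩ := (hcomm.isUnit_mul_iff.1 hu).1
  have hsurj : ∀ p, ∃ q, S q = p := fun p => by
    refine ⟨c⁻¹ • (↑v⁻¹ : P →L[ℝ] P) p, ?_⟩
    have h2 : (1 - F.toCLM x) ((↑v⁻¹ : P →L[ℝ] P) p) = p := by
      rw [← hv, ← mul_apply_eq_comp, Units.mul_inv, one_apply_eq_self]
    have h3 : ∀ q, (1 - F.toCLM x) q = c⁻¹ • S q := fun q => by
      rw [sub_apply, one_apply_eq_self, F.toCLM_apply, hxe, sub_sub_cancel]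
    rw [LinearMap.map_smul_of_tower, ← h3, h2]
  exact
  { toIsPosForm := hBD
    inj := fun e he => hB.eq_zero_of_self ((hB.pos e).of_add_eq_zero (hD.pos e) (he e))
    surj := fun l => by
      obtain ⟨f, hf⟩ := hB.surj l
      obtain ⟨q, rfl⟩ := hsurj f
      exact ⟨q, fun e => by rw [← hS, hf]⟩ }

/-! ### Square roots in continuous families -/

/-- The square root of the operator `S` that represents `B'` with respect to `B`, as a power series
in `1 - S / c`. -/
theorem exists_isSqrt (F : Frame A P) {B B' : P → P → A} (hB : IsMetric B) (hB' : IsMetric B')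
    {c : ℝ} (hc : 0 < c) (hcB : ∀ e, IsPos (c • B e e - B' e e)) {S : P →ₗ[A] P}
    (hS : ∀ e e', B (S e) e' = B' e e') {K : ℝ}
    (hK : ∀ n, ‖F.toCLM (LinearMap.id - c⁻¹ • S) ^ (n + 1)‖ ≤ K) :
    ∃ R : P →ₗ[A] P, IsSqrt B B' R ∧
      ∀ p, R p = √c • (p - sqrtSeries (F.toCLM (LinearMap.id - c⁻¹ • S)) p) := by
  set x : Module.End A P := LinearMap.id - c⁻¹ • S with hx
  have hxe : ∀ e, x e = e - c⁻¹ • S e := fun e => rfl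
  set z := sqrtSeries (F.toCLM x) with hz
  have hBx : ∀ e e', B (x e) e' = B e e' - c⁻¹ • B' e e' := fun e e' => by
    rw [hxe, hB.sub_left, hB.real_smul_left, hS]
  have hsymm : ∀ e e', B (x e) e' = B e (x e') := fun e e' => by
    rw [hB.symm (x e') e, hBx, hBx, star_sub, star_smul, star_trivial c⁻¹, ← hB.symm, ← hB'.symm]
  have h0 : ∀ e, IsPos (B (x e) e) := fun e => by
    have := (hcB e).smul (inv_nonneg.2 hc.le)
    rwa [smul_sub, smul_smul, inv_mul_cancel₀ hc.ne', one_smul, ← hBx] at this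
  have h1 : ∀ e, IsPos ((1 : ℝ) • B e e - B (x e) e) := fun e => by
    rw [hBx, one_smul, sub_sub_cancel]
    exact (hB'.pos e).smul (inv_nonneg.2 hc.le)
  have hs : ∀ p, HasSum (fun n => sqrtCoeff n • (x ^ (n + 1)) p) (z p) := fun p => by
    have := (hasSum_sqrtSeries hK).mapL (ContinuousLinearMap.apply ℝ P p)
    refine this.congr_fun fun n => ?_
    rw [ContinuousLinearMap.apply_apply, smul_apply, F.toCLM_pow_apply]
  have hz_smul : ∀ (a : A) p, z (a • p) = a • z p := fun a p => by
    refine (hs (a • p)).unique (((hs p).const_smul a).congr_fun fun n => ?_)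
    rw [map_smul, smul_comm]
  have hz_left : ∀ e e', HasSum (fun n => sqrtCoeff n • B ((x ^ (n + 1)) e) e') (B (z e) e') :=
    fun e e' => by
      refine ((hs e).map (hB.leftHom e') (F.continuous_form_left hB.toIsSesq e')).congr_fun ?_
      exact fun n => (hB.real_smul_left _ _ _).symm
  have hz_right : ∀ e e', HasSum (fun n => sqrtCoeff n • B e ((x ^ (n + 1)) e')) (B e (z e')) :=
    fun e e' => by
      refine ((hs e').map (hB.toLinearMap e) (F.continuous_form_right hB.toIsSesq e)).congr_fun ?_
      exact fun n => (hB.real_smul_right _ _ _).symm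
  have hz_symm : ∀ e e', B (z e) e' = B e (z e') := fun e e' =>
    (hz_left e e').unique ((hz_right e e').congr_fun fun n => by rw [selfAdj_pow hsymm])
  -- The powers of `x` are at most `1`, and so are the partial sums of the coefficients.
  have hz_pos : ∀ e, IsPos (B e e - B (z e) e) := fun e => by
    have hle : ∀ n, IsPos (B e e - B ((x ^ n) e) e) := fun n => by
      have a1 := isPos_pow_sub hB.toIsPosForm one_pos hsymm h0 h1 n e
      have a2 := hB.pos (e - (x ^ n) e)
      have a3 := (a1.add a2).smul (r := 1 / 2) (by norm_num)
      convert a3 using 1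
      simp only [hB.sub_left, hB.sub_right, one_pow, one_smul]
      rw [← selfAdj_pow hsymm n e e]
      module
    refine RealCStar.isClosed_isPos.mem_of_tendsto
      ((hz_left e e).tendsto_sum_nat.const_sub (B e e)) (Eventually.of_forall fun N => ?_)
    have a1 := (hB.pos e).smul (sub_nonneg.2 (sum_sqrtCoeff_le_one N))
    have a2 := isPos_sum (range N) _ fun n _ => (hle (n + 1)).smul (sqrtCoeff_nonneg n)
    have a3 := a1.add a2
    simp only [smul_sub, sum_sub_distrib, sub_smul, sum_smul, one_smul] at a3
    rwa [sub_add_sub_cancel] at a3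
  have hsq : ∀ e, √c • (√c • (e - z e) - z (√c • (e - z e))) = S e := fun e => by
    have h2 : ∀ p, (1 - z) p = p - z p := fun p => rfl
    have h3 : (1 - z) ((1 - z) e) = (1 - F.toCLM x) e := by
      rw [← mul_apply_eq_comp, one_sub_sqrtSeries_mul_self hK]
    rw [map_smul, ← smul_sub, smul_smul, Real.mul_self_sqrt hc.le, ← h2, ← h2, h3, sub_apply,
      one_apply_eq_self, F.toCLM_apply, hxe, sub_sub_cancel, smul_smul, mul_inv_cancel₀ hc.ne',
      one_smul]
  let R : P →ₗ[A] P :=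
    { toFun := fun p => √c • (p - z p)
      map_add' := fun p q => by rw [map_add, add_sub_add_comm, smul_add]
      map_smul' := fun a p => by rw [hz_smul, ← smul_sub, smul_comm, RingHom.id_apply] }
  have hR : ∀ p, R p = √c • (p - z p) := fun p => rfl
  have hRR : ∀ p, R (R p) = S p := fun p => by rw [hR, hR, hsq]
  have hsa : ∀ e e', B (R e) e' = B e (R e') := fun e e' => by
    rw [hR, hR, hB.real_smul_left, hB.real_smul_right, hB.sub_left, hB.sub_right, hz_symm]
  refine ⟨R, ⟨⟨hsa, fun e => ?_, fun e e' => ?_⟩, fun T hT e => ?_⟩, hR⟩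
  · rw [hR, hB.real_smul_left, hB.sub_left]
    exact (hz_pos e).smul (Real.sqrt_nonneg c)
  · rw [← hsa, hRR, hS]
  · have hTS : ∀ p, T (S p) = S (T p) := fun p => by rw [← hRR, ← hRR, hT]
    have hTx : Commute (F.toCLM T) (F.toCLM x) := by
      ext p
      change T (x p) = x (T p)
      rw [hxe, hxe, map_sub, LinearMap.map_smul_of_tower, hTS]
    have hTz := Commute.sqrtSeries_right hK hTx
    have hTzp : T (z e) = z (T e) := congrArg (fun U : P →L[ℝ] P => U e) hTz.eq
    rw [hR, hR, LinearMap.map_smul_of_tower, map_sub, hTzp]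

variable {Y : Type*} [TopologicalSpace Y] {y₀ : Y}

/-- Continuous families of metrics `B`, `B'` have a continuous family of square roots: near a point,
the same constants serve in `exists_isSqrt` for all parameters, and the power series converges
uniformly. -/
theorem exists_sqrt_family (F : Frame A P) {B B' : Y → P → P → A}
    (hB : ∀ᶠ y in 𝓝 y₀, IsMetric (B y)) (hB' : ∀ᶠ y in 𝓝 y₀, IsMetric (B' y))
    (hc : ∀ e e', ContinuousAt (fun y => B y e e') y₀)
    (hc' : ∀ e e', ContinuousAt (fun y => B' y e e') y₀) :
    ∃ R : Y → P →ₗ[A] P, (∀ᶠ y in 𝓝 y₀, IsSqrt (B y) (B' y) (R y)) ∧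
      ∀ p, ContinuousAt (fun y => R y p) y₀ := by
  classical
  have hSex : ∃ S : Y → P →ₗ[A] P, ∀ᶠ y in 𝓝 y₀, ∀ e e', B y (S y e) e' = B' y e e' := by
    refine ⟨fun y => if h : IsMetric (B y) ∧ IsSesq (B' y) then (h.1.exists_repr h.2).choose else 0,
      ?_⟩
    filter_upwards [hB, hB'] with y hy hy'
    have h : IsMetric (B y) ∧ IsSesq (B' y) := ⟨hy, hy'.toIsSesq⟩
    simp only [dif_pos h]
    exact (h.1.exists_repr h.2).choose_spec
  obtain ⟨S, hS⟩ := hSex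
  have hSc : ∀ p, ContinuousAt (fun y => S y p) y₀ := fun p =>
    F.continuousAt_of_form hB hc fun e' => (hc' p e').congr (hS.mono fun y hy => (hy p e').symm)
  obtain ⟨c, hcpos, hcB⟩ := F.eventually_isPos_sub hB hc (hB'.mono fun y hy => hy.toIsPosForm) hc'
  obtain ⟨K, hK, hKB⟩ := F.eventually_norm_sq_le hB hc
  obtain ⟨L, hL, hLB⟩ : ∃ L : ℝ, 0 ≤ L ∧
      ∀ᶠ y in 𝓝 y₀, ∑ i, ∑ j, ‖B y (F.vec i) (F.vec j)‖ ≤ L := by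
    refine ⟨∑ i, ∑ j, ‖B y₀ (F.vec i) (F.vec j)‖ + 1, by positivity, ?_⟩
    have h1 : ContinuousAt (fun y => ∑ i, ∑ j, ‖B y (F.vec i) (F.vec j)‖) y₀ :=
      tendsto_finsetSum _ fun i _ => tendsto_finsetSum _ fun j _ => (hc _ _).norm
    exact (h1.eventually_lt continuousAt_const (by linarith)).mono fun y hy => hy.le
  set x : Y → P →ₗ[A] P := fun y => LinearMap.id - c⁻¹ • S y with hx
  have hxc : ContinuousAt (fun y => F.toCLM (x y)) y₀ :=
    F.continuousAt_toCLM fun p => continuousAt_const.sub ((hSc p).const_smul c⁻¹)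
  have hxK : ∀ᶠ y in 𝓝 y₀, ∀ n, ‖F.toCLM (x y) ^ (n + 1)‖ ≤ √(K * L) := by
    filter_upwards [hB, hB', hS, hcB, hKB, hLB] with y hy hy' hSy hcy hKy hLy n
    have hBx : ∀ e e', B y (x y e) e' = B y e e' - c⁻¹ • B' y e e' := fun e e' => by
      change B y (e - c⁻¹ • S y e) e' = _
      rw [hy.sub_left, hy.real_smul_left, hSy]
    have := F.norm_pow_sq_le (x := x y) (r := 1) hy.toIsPosForm one_pos
      (fun e e' => by
        rw [hy.symm (x y e') e, hBx, hBx, star_sub, star_smul, star_trivial c⁻¹, ← hy.symm,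
          ← hy'.symm])
      (fun e => by
        have := (hcy e).smul (inv_nonneg.2 hcpos.le)
        rwa [smul_sub, smul_smul, inv_mul_cancel₀ hcpos.ne', one_smul, ← hBx] at this)
      (fun e => by
        rw [hBx, one_smul, sub_sub_cancel]
        exact (hy'.pos e).smul (inv_nonneg.2 hcpos.le))
      hK.le hL hKy (fun e => (F.norm_form_self_le hy.toIsSesq e).trans (by gcongr)) (n + 1)
    simpa using this
  have hzc : ContinuousAt (fun y => sqrtSeries (F.toCLM (x y))) y₀ := by
    refine tendsto_tsum_of_dominated_convergence (bound := fun n => sqrtCoeff n * √(K * L))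
      (summable_sqrtCoeff.mul_right _) (fun n => ?_) ?_
    · exact (hxc.pow (n + 1)).const_smul (sqrtCoeff n)
    · filter_upwards [hxK] with y hy n using norm_sqrtCoeff_smul_le hy n
  have hex : ∀ y, ∃ R : P →ₗ[A] P, (IsMetric (B y) ∧ IsMetric (B' y) ∧
      (∀ e, IsPos (c • B y e e - B' y e e)) ∧ (∀ e e', B y (S y e) e' = B' y e e') ∧
      ∀ n, ‖F.toCLM (x y) ^ (n + 1)‖ ≤ √(K * L)) → IsSqrt (B y) (B' y) R ∧
        ∀ p, R p = √c • (p - sqrtSeries (F.toCLM (x y)) p) := fun y => by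
    by_cases h : (IsMetric (B y) ∧ IsMetric (B' y) ∧
      (∀ e, IsPos (c • B y e e - B' y e e)) ∧ (∀ e e', B y (S y e) e' = B' y e e') ∧
      ∀ n, ‖F.toCLM (x y) ^ (n + 1)‖ ≤ √(K * L))
    · obtain ⟨R, hR⟩ := F.exists_isSqrt h.1 h.2.1 hcpos h.2.2.1 h.2.2.2.1 h.2.2.2.2
      exact ⟨R, fun _ => hR⟩
    · exact ⟨0, fun h' => absurd h' h⟩
  choose R hR using hex
  have hRev : ∀ᶠ y in 𝓝 y₀, IsSqrt (B y) (B' y) (R y) ∧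
        ∀ p, R y p = √c • (p - sqrtSeries (F.toCLM (x y)) p) := by
    filter_upwards [hB, hB', hcB, hS, hxK] with y h1 h2 h3 h4 h5 using hR y ⟨h1, h2, h3, h4, h5⟩
  refine ⟨R, hRev.mono fun y hy => hy.1, fun p => ?_⟩
  refine ContinuousAt.congr (f := fun y => √c • (p - sqrtSeries (F.toCLM (x y)) p)) ?_
    (hRev.mono fun y hy => (hy.2 p).symm)
  exact (continuousAt_const.sub (hzc.clm_apply continuousAt_const)).const_smul _

end Frame

/-! ### Existence of metrics on projective modules -/

section Standard

variable {A : Type*} [NormedRing A] [NormedAlgebra ℝ A] [CompleteSpace A] [StarRing A]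
  [StarModule ℝ A] [RealCStar A]

/-- The standard metric on `A ^ n`. -/
def stdForm (n : ℕ) (v w : Fin n → A) : A := ∑ i, w i * star (v i)

theorem isMetric_stdForm (n : ℕ) : IsMetric (stdForm (A := A) n) where
  add_left e₁ e₂ e' := by simp [stdForm, mul_add, sum_add_distrib]
  add_right e e₁ e₂ := by simp [stdForm, add_mul, sum_add_distrib]
  smul_left a e e' := by simp [stdForm, sum_mul, mul_assoc]
  smul_right a e e' := by simp [stdForm, mul_sum, mul_assoc]
  symm e e' := by simp [stdForm]
  pos e := isPos_sum _ _ fun i _ => isPos_mul_star_self _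
  inj e he := by
    ext i
    have := he (Pi.single i 1)
    simpa [stdForm, Pi.single_apply] using this
  surj l := by
    refine ⟨fun i => star (l (Pi.single i 1)), fun e => ?_⟩
    conv_rhs => rw [← univ_sum_single e]
    rw [map_sum]
    simp only [stdForm, star_star]
    refine sum_congr rfl fun i _ => ?_
    rw [← smul_eq_mul, ← map_smul, ← Pi.single_smul, smul_eq_mul, mul_one]

/-- The standard frame of `A ^ n`. -/
def stdFrame (A : Type*) [NormedRing A] (n : ℕ) : Frame A (Fin n → A) where
  n := n
  vec i := Pi.single i 1
  coord i := LinearMap.proj i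
  sum_eq p := by
    conv_rhs => rw [← univ_sum_single p]
    refine sum_congr rfl fun i _ => ?_
    rw [← Pi.single_smul, LinearMap.proj_apply, smul_eq_mul, mul_one]
  norm_coord_le i p := norm_le_pi_norm p i

/-- A direct summand of `A ^ n` has a metric, the restriction of the standard one. To see that it
is nondegenerate, the standard metric is replaced by one for which the summand and the given
complement are orthogonal. -/
theorem exists_isMetric_of_summand {P : Type*} [AddCommGroup P] [Module A P] {n : ℕ}
    (i : P →ₗ[A] Fin n → A) (q : (Fin n → A) →ₗ[A] P) (hq : ∀ p, q (i p) = p) :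
    ∃ B : P → P → A, IsMetric B := by
  have hst := isMetric_stdForm (A := A) n
  let T : (Fin n → A) →ₗ[A] Fin n → A := i ∘ₗ q
  let T' : (Fin n → A) →ₗ[A] Fin n → A := LinearMap.id - T
  have hD : IsPosForm fun v w => (1 / 2 : ℝ) • stdForm n ((T - T') v) ((T - T') w) :=
    (hst.toIsPosForm.comp (T - T')).smul (by norm_num)
  have hC := (stdFrame A n).isMetric_add (hst.smul (r := 1 / 2) (by norm_num)) hD
  have hCeq : ∀ v w, (1 / 2 : ℝ) • stdForm n v w + (1 / 2 : ℝ) • stdForm n ((T - T') v)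
      ((T - T') w) = stdForm n (T v) (T w) + stdForm n (T' v) (T' w) := fun v w => by
    have hT' : ∀ u, T' u = u - T u := fun u => rfl
    simp only [LinearMap.sub_apply, hT', hst.sub_left, hst.sub_right]
    module
  simp only [hCeq] at hC
  have hTi : ∀ p, T (i p) = i p := fun p => congrArg i (hq p)
  have hTi' : ∀ p, T' (i p) = 0 := fun p => sub_eq_zero.2 (hTi p).symm
  have hi := hst.toIsPosForm.comp i
  refine ⟨fun e e' => stdForm n (i e) (i e'), ⟨hi, fun e he => ?_, fun l => ?_⟩⟩
  · have : i e = 0 := hst.eq_zero_of_self (he e)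
    rw [← hq e, this, map_zero]
  · obtain ⟨v, hv⟩ := hC.surj (l ∘ₗ q)
    refine ⟨q v, fun e => ?_⟩
    have := hv (i e)
    rw [hTi, hTi', hst.zero_right, add_zero] at this
    exact this.trans (congrArg l (hq e))

theorem Frame.exists_isMetric {P : Type*} [NormedAddCommGroup P] [Module A P] (F : Frame A P) :
    ∃ B : P → P → A, IsMetric B := by
  refine exists_isMetric_of_summand (LinearMap.pi F.coord)
    (∑ i, (LinearMap.proj i : (Fin F.n → A) →ₗ[A] A).smulRight (F.vec i)) fun p => ?_
  simp [LinearMap.sum_apply, F.sum_eq]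

end Standard

section

variable {X : Type v}

/-! ### Local coordinates on total spaces -/

section Local

variable [TopologicalSpace X] {E : X → Type u} {F : Type u}

open Classical in
/-- A trivialization over `U` as a map on all fibres, with the value `0` outside `U`. -/
noncomputable def trivTo [Zero F] {U : Set X} (g : ∀ y : U, E y ≃ F) (y : X) (e : E y) : F :=
  if h : y ∈ U then g ⟨y, h⟩ e else 0

open Classical in
/-- The inverse of a trivialization over `U` as a map to all fibres, with the value `0` outside
`U`. -/
noncomputable def trivOf [∀ y, Zero (E y)] {U : Set X} (g : ∀ y : U, E y ≃ F) (y : X) (f : F) :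
    E y :=
  if h : y ∈ U then (g ⟨y, h⟩).symm f else 0

theorem trivTo_of_mem [Zero F] {U : Set X} (g : ∀ y : U, E y ≃ F) {y : X} (h : y ∈ U) (e : E y) :
    trivTo g y e = g ⟨y, h⟩ e := dif_pos h

theorem trivOf_of_mem [∀ y, Zero (E y)] {U : Set X} (g : ∀ y : U, E y ≃ F) {y : X} (h : y ∈ U)
    (f : F) : trivOf g y f = (g ⟨y, h⟩).symm f := dif_pos h

/-- The topology of a total space, described in a trivialization. -/
theorem IsTrivialization.continuousAt_iff [Zero F] [∀ y, Zero (E y)] [TopologicalSpace F]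
    {tE : TopologicalSpace (Tot E)} {U : Set X} {g : ∀ y : U, E y ≃ F}
    (h : IsTrivialization tE U g) (hU : IsOpen U) (hp : Continuous fun p : Tot E => p.proj)
    {Z : Type*} [TopologicalSpace Z] {q : Z → Tot E} {z₀ : Z} (hz : (q z₀).proj ∈ U) :
    ContinuousAt q z₀ ↔ ContinuousAt (fun z => (q z).proj) z₀ ∧
      ContinuousAt (fun z => trivTo g (q z).proj (q z).snd) z₀ := by
  constructor
  · intro hq
    refine ⟨hp.continuousAt.comp hq, ?_⟩
    have h1 : ContinuousOn (fun p : Tot E => trivTo g p.proj p.snd) {p | p.proj ∈ U} := by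
      rw [continuousOn_iff_continuous_domRestrict]
      exact h.1.congr fun p => (trivTo_of_mem g p.2 _).symm
    exact (h1.continuousAt ((hU.preimage hp).mem_nhds hz)).comp (f := q) hq
  · rintro ⟨h1, h2⟩
    have h3 : ContinuousOn (fun r : X × F => (⟨r.1, trivOf g r.1 r.2⟩ : Tot E)) {r | r.1 ∈ U} := by
      rw [continuousOn_iff_continuous_domRestrict]
      refine (h.2.comp (f := fun r : {r : X × F // r.1 ∈ U} => ((⟨r.1.1, r.2⟩ : U), r.1.2))
        (by fun_prop)).congr fun r => ?_
      exact congrArg (Bundle.TotalSpace.mk _) (trivOf_of_mem g r.2 _).symm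
    have h4 := (h3.continuousAt ((hU.preimage continuous_fst).mem_nhds
      (x := ((q z₀).proj, trivTo g (q z₀).proj (q z₀).snd)) hz)).comp
      (f := fun z => ((q z).proj, trivTo g (q z).proj (q z).snd)) (h1.prodMk h2)
    refine h4.congr ?_
    filter_upwards [h1.preimage_mem_nhds (hU.mem_nhds hz)] with z hz'
    have hz'' : (q z).proj ∈ U := hz'
    simp only [Function.comp_apply, trivTo_of_mem g hz'', trivOf_of_mem g hz'',
      Equiv.symm_apply_apply]

theorem IsTrivialization.continuousAt_trivOf [Zero F] [∀ y, Zero (E y)] [TopologicalSpace F]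
    {tE : TopologicalSpace (Tot E)} {U : Set X} {g : ∀ y : U, E y ≃ F}
    (h : IsTrivialization tE U g) (hU : IsOpen U) (hp : Continuous fun p : Tot E => p.proj)
    {y₀ : X} (hy : y₀ ∈ U) (f : F) :
    ContinuousAt (fun y => (⟨y, trivOf g y f⟩ : Tot E)) y₀ := by
  rw [h.continuousAt_iff hU hp hy]
  refine ⟨continuousAt_id, continuousAt_const.congr (x := y₀) (f := fun _ => f) ?_⟩
  filter_upwards [hU.mem_nhds hy] with y hy'
  simp only [trivTo_of_mem g hy', trivOf_of_mem g hy', Equiv.apply_symm_apply]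

end Local

theorem continuousAt_toProd {E F : X → Type u} {tE : TopologicalSpace (Tot E)}
    {tF : TopologicalSpace (Tot F)} {Z : Type*} [TopologicalSpace Z]
    {f : Z → Tot fun x => E x × F x} {z₀ : Z}
    (h1 : ContinuousAt (fun z => (⟨(f z).proj, (f z).snd.1⟩ : Tot E)) z₀)
    (h2 : ContinuousAt (fun z => (⟨(f z).proj, (f z).snd.2⟩ : Tot F)) z₀) :
    @ContinuousAt _ _ _ (fibProdTop tE tF) f z₀ := by
  let _ := fibProdTop tE tF
  exact (Topology.IsInducing.induced (Tot.pair (E := E) (F := F))).continuousAt_iff.2 (h1.prodMk h2)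

variable [TopologicalSpace X] {σ : Involution X}

/-- An involution of a total space that covers `σ` is bijective on the fibres. -/
theorem bijective_bar {E : X → Type u} (bar : ∀ x, E x → E (σ x))
    (h : ∀ x e, (⟨σ (σ x), bar (σ x) (bar x e)⟩ : Tot E) = ⟨x, e⟩) (x : X) :
    Function.Bijective (bar x) := by
  refine ⟨fun a b hab => ?_, fun b => ?_⟩
  · have h1 := h x a
    rw [hab, h x b] at h1
    exact (Bundle.TotalSpace.mk_injective _ h1).symm
  · have key : ∀ (y : X) (c : E y), y = x → ∃ a : E x, (⟨x, a⟩ : Tot E) = ⟨y, c⟩ := by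
      rintro y c rfl
      exact ⟨c, rfl⟩
    obtain ⟨a, ha⟩ := key _ (bar (σ x) b) (σ.involutive x)
    have h1 := congrArg (fun p : Tot E => (⟨σ p.proj, bar p.proj p.snd⟩ : Tot E)) ha
    exact ⟨a, Bundle.TotalSpace.mk_injective _ (h1.trans (h (σ x) b))⟩

section Bundle

variable {A : Type u} [NormedRing A] [NormedAlgebra ℝ A] [CompleteSpace A] [StarRing A]
  [StarModule ℝ A] [RealCStar A] {𝒜 : RealStarAlgBundle σ A}

attribute [local instance] RealAlgBundle.top RealBundle.top

instance (x : X) : PositiveCone (𝒜.fib x) :=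
  PositiveCone.of_equiv (𝒜.triv x ⟨x, 𝒜.mem_base x⟩) (𝒜.triv_star x ⟨x, 𝒜.mem_base x⟩)

/-- The coordinates in `A` of an element of the fibre of `𝒜` over a point close to `x`. -/
noncomputable def RealStarAlgBundle.coord (𝒜 : RealStarAlgBundle σ A) (x y : X) (a : 𝒜.fib y) : A :=
  trivTo (fun y => (𝒜.triv x y).toEquiv) y a

theorem RealStarAlgBundle.coord_of_mem (x : X) {y : X} (hy : y ∈ 𝒜.base x) (a : 𝒜.fib y) :
    𝒜.coord x y a = 𝒜.triv x ⟨y, hy⟩ a :=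
  trivTo_of_mem (fun y => (𝒜.triv x y).toEquiv) hy a

theorem RealStarAlgBundle.continuousAt_iff (x : X) {Z : Type*} [TopologicalSpace Z]
    {q : Z → Tot 𝒜.fib} {z₀ : Z} (hz : (q z₀).proj ∈ 𝒜.base x) :
    ContinuousAt q z₀ ↔ ContinuousAt (fun z => (q z).proj) z₀ ∧
      ContinuousAt (fun z => 𝒜.coord x (q z).proj (q z).snd) z₀ :=
  (𝒜.isTrivialization x).continuousAt_iff (𝒜.isOpen_base x) 𝒜.continuous_proj hz

/-- The involution between two fibres of `𝒜`. -/
noncomputable def RealStarAlgBundle.barEquiv (𝒜 : RealStarAlgBundle σ A) (x : X) :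
    𝒜.fib x ≃ₐ[ℝ] 𝒜.fib (σ x) :=
  AlgEquiv.ofBijective (𝒜.bar x) (bijective_bar (fun x => 𝒜.bar x) 𝒜.bar_bar x)

variable {E : RealBundle 𝒜.toRealAlgBundle}

/-- The involution between two fibres of a Real `𝒜`-bundle. -/
noncomputable def _root_.TwistedK.RealBundle.barEquiv (E : RealBundle 𝒜.toRealAlgBundle) (x : X) :
    E.fib x ≃+ E.fib (σ x) :=
  AddEquiv.ofBijective (E.bar x) (bijective_bar (fun x => E.bar x) E.bar_bar x)

theorem isSemiIso_bar (E : RealBundle 𝒜.toRealAlgBundle) (x : X) :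
    IsSemiIso (𝒜.barEquiv x) (E.barEquiv x) where
  star := 𝒜.bar_star x
  smul := E.bar_smul x

/-! ### Normed charts -/

/-- A local trivialization of a Real `𝒜`-bundle around `x₀` whose model fibre is a Banach module
over `A` with a frame. -/
structure Chart (E : RealBundle 𝒜.toRealAlgBundle) (x₀ : X) where
  P : Type u
  [normedAddCommGroup : NormedAddCommGroup P]
  [normedSpace : NormedSpace ℝ P]
  [completeSpace : CompleteSpace P]
  [module : Module A P]
  [isScalarTower : IsScalarTower ℝ A P]
  [isBoundedSMul : IsBoundedSMul A P]
  [isModuleTopology : IsModuleTopology A P]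
  frame : Frame A P
  U : Set X
  subset_base : U ⊆ 𝒜.base x₀
  g : ∀ y : U, E.fib y ≃+ P
  isOpen : IsOpen U
  mem : x₀ ∈ U
  smul : ∀ (y : U) (a : 𝒜.fib y) (e : E.fib y),
    g y (a • e) = 𝒜.triv x₀ ⟨y, subset_base y.2⟩ a • g y e
  isTrivialization : IsTrivialization E.top U fun y => (g y).toEquiv

attribute [instance] Chart.normedAddCommGroup Chart.normedSpace Chart.completeSpace Chart.module
  Chart.isScalarTower Chart.isBoundedSMul Chart.isModuleTopology

/-- A summand of `A ^ n`, with its module topology, is a Banach module with a frame. -/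
theorem exists_chart (E : RealBundle 𝒜.toRealAlgBundle) (x₀ : X) : Nonempty (Chart E x₀) := by
  obtain ⟨P, iG, iM, τ, iT, U, hU, g, oU, xU, hg, tg⟩ := E.locally_trivial x₀
  have hs : IsSemiIso (𝒜.triv x₀ ⟨x₀, hU xU⟩) (g ⟨x₀, xU⟩) :=
    ⟨𝒜.triv_star x₀ _, hg ⟨x₀, xU⟩⟩
  obtain ⟨n, q₀, i₀, -, -, hqi⟩ :=
    Module.Finite.exists_comp_eq_id_of_projective (𝒜.fib x₀) (E.fib x₀)
  let vec : Fin n → P := fun i => g ⟨x₀, xU⟩ (q₀ (Pi.single i 1))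
  let coord : Fin n → P →ₗ[A] A := fun i => hs.symm.pullDual (LinearMap.proj i ∘ₗ i₀)
  have hsum : ∀ p, ∑ i, coord i p • vec i = p := fun p => by
    have h1 : ∀ i, coord i p = 𝒜.triv x₀ ⟨x₀, hU xU⟩ (i₀ ((g ⟨x₀, xU⟩).symm p) i) := fun i => rfl
    have h2 : ∑ i, i₀ ((g ⟨x₀, xU⟩).symm p) i • q₀ (Pi.single i 1) = (g ⟨x₀, xU⟩).symm p := by
      simp only [← map_smul, ← map_sum, ← Pi.single_smul, smul_eq_mul, mul_one, univ_sum_single]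
      exact LinearMap.congr_fun hqi _
    simp only [h1, vec, ← hs.smul, ← map_sum, h2, AddEquiv.apply_symm_apply]
  let ι : P →ₗ[A] Fin n → A := LinearMap.pi coord
  let q : (Fin n → A) →ₗ[A] P :=
    ∑ i, (LinearMap.proj i : (Fin n → A) →ₗ[A] A).smulRight (vec i)
  have hq : ∀ p, q (ι p) = p := fun p => by
    simp [q, ι, LinearMap.sum_apply, hsum]
  have hι : Function.Injective ι := Function.LeftInverse.injective hq
  have hcι : Continuous[τ, _] ι := by
    have := IsModuleTopology.toContinuousAdd A P
    exact IsModuleTopology.continuous_of_linearMap ι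
  have hcq : Continuous[_, τ] q := by
    have := IsModuleTopology.toContinuousAdd A P
    exact IsModuleTopology.continuous_of_linearMap q
  obtain rfl : τ = TopologicalSpace.induced ι inferInstance := by
    refine le_antisymm (continuous_iff_le_induced.1 hcι) ?_
    rw [← continuous_id_iff_le]
    have h1 : Continuous[TopologicalSpace.induced ι inferInstance, τ] fun p => q (ι p) :=
      @Continuous.comp P (Fin n → A) P (TopologicalSpace.induced ι inferInstance) _ τ ι q hcq
        continuous_induced_dom
    rwa [show (fun p => q (ι p)) = id from funext hq] at h1
  let N : NormedAddCommGroup P := NormedAddCommGroup.induced P (Fin n → A) ι hι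
  have hnorm : ∀ p : P, ‖p‖ = ‖ι p‖ := fun p => rfl
  let _ : Module ℝ P := Module.compHom P (algebraMap ℝ A)
  have hsm : ∀ (r : ℝ) (p : P), r • p = algebraMap ℝ A r • p := fun r p => rfl
  let _ : NormedSpace ℝ P :=
    { norm_smul_le := fun r p => by
        rw [hnorm, hnorm, hsm, map_smul, algebraMap_smul]
        exact norm_smul_le r (ι p) }
  have hT : IsScalarTower ℝ A P := ⟨fun r a p => by
    rw [hsm, smul_smul, Algebra.smul_def]⟩
  have hb : IsBoundedSMul A P := IsBoundedSMul.of_norm_smul_le fun a p => by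
    rw [hnorm, hnorm, map_smul]
    exact norm_smul_le a (ι p)
  have hiso : Isometry ι := by
    refine AddMonoidHomClass.isometry_of_norm ι fun p => rfl
  have hcl : IsClosed (Set.range ι) := by
    have : Set.range ι = {w | ι (q w) = w} := by
      ext w
      constructor
      · rintro ⟨p, rfl⟩
        exact congrArg ι (hq p)
      · intro hw
        exact ⟨q w, hw⟩
    rw [this]
    exact isClosed_eq (hcι.comp hcq) continuous_id
  have hC : CompleteSpace P :=
    (completeSpace_iff_isComplete_range hiso.isUniformInducing).2 hcl.isComplete
  refine ⟨{ P := P, frame := ⟨n, vec, coord, hsum, fun i p => ?_⟩, U := U, subset_base := hU,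
            g := g, isOpen := oU, mem := xU, smul := hg, isTrivialization := tg,
            isModuleTopology := iT }⟩
  rw [hnorm]
  exact norm_le_pi_norm (ι p) i

end Bundle

end

section

variable {X : Type v} [TopologicalSpace X] {σ : Involution X}

section Bundle

variable {A : Type u} [NormedRing A] [NormedAlgebra ℝ A] [CompleteSpace A] [StarRing A]
  [StarModule ℝ A] [RealCStar A] {𝒜 : RealStarAlgBundle σ A}
  {E F : RealBundle 𝒜.toRealAlgBundle}

attribute [local instance] RealAlgBundle.top RealBundle.top

/-! ### Continuity of fibrewise forms and maps -/

/-- Continuity of a family of forms, as a map from `E ×_X E` to `𝒜`. -/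
def FormContinuous (B : ∀ x, E.fib x → E.fib x → 𝒜.fib x) : Prop :=
  Continuous[fibProdTop E.top E.top, 𝒜.top]
    fun p => (⟨p.proj, B p.proj p.snd.1 p.snd.2⟩ : Tot 𝒜.fib)

/-- Continuity of a family of maps of the fibres on the total space. -/
def MapContinuous (T : ∀ x, E.fib x → F.fib x) : Prop :=
  Continuous fun p : Tot E.fib => (⟨p.proj, T p.proj p.snd⟩ : Tot F.fib)

theorem FormContinuous.continuousAt {B : ∀ x, E.fib x → E.fib x → 𝒜.fib x}
    (hB : FormContinuous B) {Z : Type*} [TopologicalSpace Z] {z₀ : Z} {y : Z → X}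
    {s s' : ∀ z, E.fib (y z)} (hs : ContinuousAt (fun z => (⟨y z, s z⟩ : Tot E.fib)) z₀)
    (hs' : ContinuousAt (fun z => (⟨y z, s' z⟩ : Tot E.fib)) z₀) :
    ContinuousAt (fun z => (⟨y z, B (y z) (s z) (s' z)⟩ : Tot 𝒜.fib)) z₀ := by
  let _ := fibProdTop E.top E.top
  have h : ContinuousAt (fun z => (⟨y z, (s z, s' z)⟩ : Tot fun x => E.fib x × E.fib x)) z₀ :=
    continuousAt_toProd hs hs'
  exact (Continuous.continuousAt hB).comp h

theorem FormContinuous.comp {B : ∀ x, E.fib x → E.fib x → 𝒜.fib x} (hB : FormContinuous B)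
    {T T' : ∀ x, F.fib x → E.fib x} (hT : MapContinuous T) (hT' : MapContinuous T') :
    FormContinuous fun x e e' => B x (T x e) (T' x e') := by
  let _ := fibProdTop E.top E.top
  let _ := fibProdTop F.top F.top
  exact Continuous.comp hB (f := fun p : Tot fun x => F.fib x × F.fib x =>
    (⟨p.proj, (T p.proj p.snd.1, T' p.proj p.snd.2)⟩ : Tot fun x => E.fib x × E.fib x))
    (continuous_toProd (Continuous.comp hT (continuous_left F.top F.top))
      (Continuous.comp hT' (continuous_right F.top F.top)))

theorem mapContinuous_id : MapContinuous fun (x : X) (e : E.fib x) => e := continuous_id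

namespace Chart

variable {x₀ : X}

theorem isSemiIso (c : Chart E x₀) (y : c.U) :
    IsSemiIso (𝒜.triv x₀ ⟨y, c.subset_base y.2⟩) (c.g y) :=
  ⟨𝒜.triv_star x₀ _, c.smul y⟩

/-- The coordinates of a vector in a chart. -/
noncomputable def coord (c : Chart E x₀) (y : X) (e : E.fib y) : c.P :=
  trivTo (fun y => (c.g y).toEquiv) y e

/-- The vector with given coordinates in a chart. -/
noncomputable def vec (c : Chart E x₀) (y : X) (p : c.P) : E.fib y :=
  trivOf (fun y => (c.g y).toEquiv) y p

theorem coord_of_mem (c : Chart E x₀) {y : X} (hy : y ∈ c.U) (e : E.fib y) :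
    c.coord y e = c.g ⟨y, hy⟩ e := trivTo_of_mem (fun y => (c.g y).toEquiv) hy e

theorem vec_of_mem (c : Chart E x₀) {y : X} (hy : y ∈ c.U) (p : c.P) :
    c.vec y p = (c.g ⟨y, hy⟩).symm p := trivOf_of_mem (fun y => (c.g y).toEquiv) hy p

theorem continuousAt_iff (c : Chart E x₀) {Z : Type*} [TopologicalSpace Z] {q : Z → Tot E.fib}
    {z₀ : Z} (hz : (q z₀).proj ∈ c.U) :
    ContinuousAt q z₀ ↔ ContinuousAt (fun z => (q z).proj) z₀ ∧
      ContinuousAt (fun z => c.coord (q z).proj (q z).snd) z₀ :=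
  c.isTrivialization.continuousAt_iff c.isOpen E.continuous_proj hz

theorem continuousAt_vec (c : Chart E x₀) {y₁ : X} (hy : y₁ ∈ c.U) (p : c.P) :
    ContinuousAt (fun y => (⟨y, c.vec y p⟩ : Tot E.fib)) y₁ :=
  c.isTrivialization.continuousAt_trivOf c.isOpen E.continuous_proj hy p

/-- A family of forms in a chart. -/
noncomputable def form (c : Chart E x₀) (B : ∀ x, E.fib x → E.fib x → 𝒜.fib x) (y : X)
    (p p' : c.P) : A :=
  𝒜.coord x₀ y (B y (c.vec y p) (c.vec y p'))

theorem form_of_mem (c : Chart E x₀) (B : ∀ x, E.fib x → E.fib x → 𝒜.fib x) {y : X}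
    (hy : y ∈ c.U) :
    c.form B y = transportForm (𝒜.triv x₀ ⟨y, c.subset_base hy⟩) (c.g ⟨y, hy⟩) (B y) := by
  ext p p'
  rw [form, 𝒜.coord_of_mem x₀ (c.subset_base hy), c.vec_of_mem hy, c.vec_of_mem hy]
  rfl

theorem isSesq_form (c : Chart E x₀) {B : ∀ x, E.fib x → E.fib x → 𝒜.fib x} {y : X}
    (hy : y ∈ c.U) (hB : IsSesq (B y)) : IsSesq (c.form B y) := by
  rw [c.form_of_mem B hy]
  exact (c.isSemiIso ⟨y, hy⟩).isSesq hB

theorem isMetric_form (c : Chart E x₀) {B : ∀ x, E.fib x → E.fib x → 𝒜.fib x} {y : X}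
    (hy : y ∈ c.U) (hB : IsMetric (B y)) : IsMetric (c.form B y) := by
  rw [c.form_of_mem B hy]
  exact (c.isSemiIso ⟨y, hy⟩).isMetric hB

open Classical in
/-- A family of endomorphisms in a chart. -/
noncomputable def rep (c : Chart E x₀) (T : ∀ x, E.fib x →ₗ[𝒜.fib x] E.fib x) (y : X) :
    c.P →ₗ[A] c.P :=
  if h : y ∈ c.U then (c.isSemiIso ⟨y, h⟩).symm.pullEnd (T y) else 0

theorem rep_of_mem (c : Chart E x₀) (T : ∀ x, E.fib x →ₗ[𝒜.fib x] E.fib x) {y : X}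
    (hy : y ∈ c.U) (p : c.P) :
    c.rep T y p = c.g ⟨y, hy⟩ (T y ((c.g ⟨y, hy⟩).symm p)) := by
  rw [rep, dif_pos hy]
  rfl

theorem eventually_mem (c : Chart E x₀) {y : X} (hy : y ∈ c.U) : ∀ᶠ z in 𝓝 y, z ∈ c.U :=
  c.isOpen.mem_nhds hy

theorem continuousAt_form (c : Chart E x₀) {B : ∀ x, E.fib x → E.fib x → 𝒜.fib x}
    (hB : FormContinuous B) {y : X} (hy : y ∈ c.U) (p p' : c.P) :
    ContinuousAt (fun y => c.form B y p p') y :=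
  ((𝒜.continuousAt_iff x₀ (z₀ := y) (c.subset_base hy)).1
    (hB.continuousAt (c.continuousAt_vec hy p) (c.continuousAt_vec hy p'))).2

theorem continuousAt_rep (c : Chart E x₀) {T : ∀ x, E.fib x →ₗ[𝒜.fib x] E.fib x}
    (hT : MapContinuous fun x => T x) {y : X} (hy : y ∈ c.U) (p : c.P) :
    ContinuousAt (fun y => c.rep T y p) y := by
  have h1 := (Continuous.continuousAt hT).comp (c.continuousAt_vec hy p)
  refine ((c.continuousAt_iff (z₀ := y) hy).1 h1).2.congr ?_
  filter_upwards [c.eventually_mem hy] with z hz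
  rw [c.rep_of_mem _ hz]
  change c.coord z (T z (c.vec z p)) = _
  rw [c.coord_of_mem hz, c.vec_of_mem hz]

end Chart

/-- Continuity of a family of forms can be checked pointwise in charts. -/
theorem formContinuous_of_charts {B : ∀ x, E.fib x → E.fib x → 𝒜.fib x}
    (hB : ∀ x, IsSesq (B x))
    (h : ∀ x₀, ∃ c : Chart E x₀, ∀ p p', ContinuousAt (fun y => c.form B y p p') x₀) :
    FormContinuous B := by
  let _ := fibProdTop E.top E.top
  refine continuous_iff_continuousAt.2 fun p₀ => ?_
  obtain ⟨c, hc⟩ := h p₀.proj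
  have hl := continuous_left E.top E.top
  have hr := continuous_right E.top E.top
  have hp : Continuous fun p : Tot (fun x => E.fib x × E.fib x) => p.proj :=
    E.continuous_proj.comp hl
  refine (𝒜.continuousAt_iff p₀.proj (z₀ := p₀) (𝒜.mem_base _)).2 ⟨hp.continuousAt, ?_⟩
  have hU : ∀ᶠ p in 𝓝 p₀, p.proj ∈ c.U := hp.continuousAt (c.isOpen.mem_nhds c.mem)
  have h1 := ((c.continuousAt_iff (z₀ := p₀) c.mem).1 hl.continuousAt).2
  have h2 := ((c.continuousAt_iff (z₀ := p₀) c.mem).1 hr.continuousAt).2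
  have h3 := c.frame.continuousAt_form (z₀ := p₀) (B := fun p => c.form B p.proj)
    (hU.mono fun p hpU => c.isSesq_form hpU (hB _))
    (fun e e' => ContinuousAt.comp (g := fun y => c.form B y e e')
      (f := fun p : Tot fun x => E.fib x × E.fib x => p.proj) (hc e e') hp.continuousAt) h1 h2
  refine h3.congr (hU.mono fun p hpU => ?_)
  simp only [c.form_of_mem B hpU, c.coord_of_mem hpU, transportForm, AddEquiv.symm_apply_apply,
    𝒜.coord_of_mem _ (c.subset_base hpU)]

/-- Continuity of a family of endomorphisms can be checked pointwise in charts. -/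
theorem mapContinuous_of_charts {T : ∀ x, E.fib x →ₗ[𝒜.fib x] E.fib x}
    (h : ∀ x₀, ∃ c : Chart E x₀, ∀ p, ContinuousAt (fun y => c.rep T y p) x₀) :
    MapContinuous fun x => T x := by
  refine continuous_iff_continuousAt.2 fun p₀ => ?_
  obtain ⟨c, hc⟩ := h p₀.proj
  have hp : Continuous fun p : Tot E.fib => p.proj := E.continuous_proj
  have hU : ∀ᶠ p in 𝓝 p₀, p.proj ∈ c.U := hp.continuousAt (c.isOpen.mem_nhds c.mem)
  refine (c.continuousAt_iff (z₀ := p₀) c.mem).2 ⟨hp.continuousAt, ?_⟩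
  have h1 := ((c.continuousAt_iff (z₀ := p₀) c.mem).1 continuousAt_id).2
  have h2 := c.frame.continuousAt_apply (z₀ := p₀) (T := fun p => c.rep T p.proj)
    (fun e => ContinuousAt.comp (g := fun y => c.rep T y e) (f := fun p : Tot E.fib => p.proj)
      (hc e) hp.continuousAt) h1
  refine h2.congr (hU.mono fun p hpU => ?_)
  have hpU' : (id p).proj ∈ c.U := hpU
  simp only [c.coord_of_mem hpU, c.coord_of_mem hpU', c.rep_of_mem T hpU]
  exact congrArg _ (congrArg _ (AddEquiv.symm_apply_apply _ _))

/-- A family of endomorphisms which is represented, with respect to a continuous family of metrics,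
by a continuous family of forms, is continuous. -/
theorem mapContinuous_of_form {B C : ∀ x, E.fib x → E.fib x → 𝒜.fib x} (hB : ∀ x, IsMetric (B x))
    (hBc : FormContinuous B) (hC : FormContinuous C) {T : ∀ x, E.fib x →ₗ[𝒜.fib x] E.fib x}
    (hT : ∀ x e e', B x (T x e) e' = C x e e') : MapContinuous fun x => T x := by
  refine mapContinuous_of_charts fun x₀ => ?_
  obtain ⟨c⟩ := exists_chart E x₀
  refine ⟨c, fun p => c.frame.continuousAt_of_form (B := fun y => c.form B y) ?_
    (fun e e' => c.continuousAt_form hBc c.mem e e') fun e' => ?_⟩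
  · filter_upwards [c.eventually_mem c.mem] with y hy using c.isMetric_form hy (hB y)
  · refine (c.continuousAt_form hC c.mem p e').congr ?_
    filter_upwards [c.eventually_mem c.mem] with y hy
    rw [c.form_of_mem B hy, c.form_of_mem C hy, c.rep_of_mem T hy, transportForm, transportForm,
      AddEquiv.symm_apply_apply, hT]

/-! ### Square roots on bundles -/

/-- Square roots of continuous families of metrics. They exist in the charts, and are continuous
because they are unique. -/
theorem exists_isSqrt_bundle {B B' : ∀ x, E.fib x → E.fib x → 𝒜.fib x}
    (hB : ∀ x, IsMetric (B x)) (hB' : ∀ x, IsMetric (B' x)) (hBc : FormContinuous B)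
    (hBc' : FormContinuous B') :
    ∃ R : ∀ x, E.fib x →ₗ[𝒜.fib x] E.fib x, (∀ x, IsSqrt (B x) (B' x) (R x)) ∧
      MapContinuous fun x => R x := by
  obtain ⟨c⟩ : Nonempty (∀ x₀, Chart E x₀) := ⟨fun x₀ => (exists_chart E x₀).some⟩
  have hloc : ∀ x₀, ∃ R : X → (c x₀).P →ₗ[A] (c x₀).P,
      (∀ᶠ y in 𝓝 x₀, IsSqrt ((c x₀).form B y) ((c x₀).form B' y) (R y)) ∧
      ∀ p, ContinuousAt (fun y => R y p) x₀ := fun x₀ => by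
    refine (c x₀).frame.exists_sqrt_family ?_ ?_ ((c x₀).continuousAt_form hBc (c x₀).mem)
      ((c x₀).continuousAt_form hBc' (c x₀).mem)
    · filter_upwards [(c x₀).eventually_mem (c x₀).mem] with y hy
        using (c x₀).isMetric_form hy (hB y)
    · filter_upwards [(c x₀).eventually_mem (c x₀).mem] with y hy
        using (c x₀).isMetric_form hy (hB' y)
  choose r hr hrc using hloc
  have hpull : ∀ x₀ y (hy : y ∈ (c x₀).U), IsSqrt ((c x₀).form B y) ((c x₀).form B' y) (r x₀ y) →
      IsSqrt (B y) (B' y) (((c x₀).isSemiIso ⟨y, hy⟩).pullEnd (r x₀ y)) := fun x₀ y hy h => by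
    rw [(c x₀).form_of_mem B hy, (c x₀).form_of_mem B' hy] at h
    exact ((c x₀).isSemiIso ⟨y, hy⟩).isSqrt h
  have hR : ∀ x, IsSqrt (B x) (B' x) (((c x).isSemiIso ⟨x, (c x).mem⟩).pullEnd (r x x)) :=
    fun x => hpull x x (c x).mem (hr x).self_of_nhds
  refine ⟨_, hR, mapContinuous_of_charts fun x₀ => ⟨c x₀, fun p => (hrc x₀ p).congr ?_⟩⟩
  filter_upwards [(c x₀).eventually_mem (c x₀).mem, hr x₀] with y hy hry
  rw [(c x₀).rep_of_mem _ hy, (hR y).unique (hB y) (hB' y) (hpull x₀ y hy hry).toIsPosSqrt,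
    IsSemiIso.pullEnd_apply, AddEquiv.apply_symm_apply, AddEquiv.apply_symm_apply]

/-- The forms `B x` are compatible with the involutions. -/
def BarInvariant (B : ∀ x, E.fib x → E.fib x → 𝒜.fib x) : Prop :=
  ∀ x e e', B (σ x) (E.bar x e) (E.bar x e') = 𝒜.bar x (B x e e')

theorem BarInvariant.transportForm_eq {B : ∀ x, E.fib x → E.fib x → 𝒜.fib x}
    (h : BarInvariant B) (x : X) :
    transportForm (𝒜.barEquiv x) (E.barEquiv x) (B x) = B (σ x) := by
  ext p p'
  have := h x ((E.barEquiv x).symm p) ((E.barEquiv x).symm p')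
  have hb : ∀ e, E.bar x e = E.barEquiv x e := fun e => rfl
  rw [hb, hb, AddEquiv.apply_symm_apply, AddEquiv.apply_symm_apply] at this
  exact this.symm

/-- Square roots of invariant forms are compatible with the involution, by their uniqueness. -/
theorem isSqrt_bar {B B' : ∀ x, E.fib x → E.fib x → 𝒜.fib x} (hB : ∀ x, IsMetric (B x))
    (hB' : ∀ x, IsMetric (B' x)) (hBb : BarInvariant B) (hBb' : BarInvariant B')
    {R : ∀ x, E.fib x →ₗ[𝒜.fib x] E.fib x} (hR : ∀ x, IsSqrt (B x) (B' x) (R x)) (x : X)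
    (e : E.fib x) : R (σ x) (E.bar x e) = E.bar x (R x e) := by
  have h1 := hR (σ x)
  rw [← hBb.transportForm_eq, ← hBb'.transportForm_eq] at h1
  have h2 := (hR x).unique (hB x) (hB' x) ((isSemiIso_bar E x).isSqrt h1).toIsPosSqrt
  have h3 := congrArg (E.barEquiv x) (LinearMap.congr_fun h2 e)
  rw [IsSemiIso.pullEnd_apply, AddEquiv.apply_symm_apply] at h3
  exact h3.symm

/-! ### Metrics on bundles -/

theorem isMetric_add_fib {x : X} {B D : E.fib x → E.fib x → 𝒜.fib x} (hB : IsMetric B)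
    (hD : IsPosForm D) : IsMetric fun e e' => B e e' + D e e' := by
  obtain ⟨c⟩ := exists_chart E x
  have hs := c.isSemiIso ⟨x, c.mem⟩
  have h := hs.symm.isMetric (c.frame.isMetric_add (hs.isMetric hB) (hs.isPosForm hD))
  convert h using 3
  simp [transportForm]

theorem formContinuous_add {B D : ∀ x, E.fib x → E.fib x → 𝒜.fib x} (hB : FormContinuous B)
    (hD : FormContinuous D) : FormContinuous fun x e e' => B x e e' + D x e e' := by
  let _ := fibProdTop E.top E.top
  let _ := fibProdTop 𝒜.top 𝒜.top
  exact 𝒜.continuous_add.comp (f := fun p : Tot fun x => E.fib x × E.fib x =>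
    (⟨p.proj, (B p.proj p.snd.1 p.snd.2, D p.proj p.snd.1 p.snd.2)⟩ :
      Tot fun x => 𝒜.fib x × 𝒜.fib x)) (continuous_toProd hB hD)

open Classical in
/-- The form on the fibres over the domain of a chart given by a form on the model fibre, extended
by zero. -/
noncomputable def Chart.constForm {x₀ : X} (c : Chart E x₀) (D : c.P → c.P → A) (y : X)
    (e e' : E.fib y) : 𝒜.fib y :=
  if h : y ∈ c.U then (𝒜.triv x₀ ⟨y, c.subset_base h⟩).symm (D (c.g ⟨y, h⟩ e) (c.g ⟨y, h⟩ e'))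
  else 0

theorem Chart.constForm_of_mem {x₀ : X} (c : Chart E x₀) (D : c.P → c.P → A) {y : X}
    (hy : y ∈ c.U) : c.constForm D y =
      transportForm (𝒜.triv x₀ ⟨y, c.subset_base hy⟩).symm (c.g ⟨y, hy⟩).symm D := by
  ext e e'
  rw [constForm, dif_pos hy]
  rfl

theorem Chart.isMetric_constForm {x₀ : X} (c : Chart E x₀) {D : c.P → c.P → A} (hD : IsMetric D)
    {y : X} (hy : y ∈ c.U) : IsMetric (c.constForm D y) := by
  rw [c.constForm_of_mem D hy]
  exact (c.isSemiIso ⟨y, hy⟩).symm.isMetric hD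

theorem Chart.isPosForm_constForm {x₀ : X} (c : Chart E x₀) {D : c.P → c.P → A} (hD : IsMetric D)
    (y : X) : IsPosForm (c.constForm D y) := by
  by_cases hy : y ∈ c.U
  · exact (c.isMetric_constForm hD hy).toIsPosForm
  · have : c.constForm D y = fun _ _ => 0 := by
      ext e e'
      rw [constForm, dif_neg hy]
    rw [this]
    exact IsPosForm.zero

theorem Chart.continuousAt_constForm {x₀ : X} (c : Chart E x₀) {D : c.P → c.P → A}
    (hD : IsSesq D) {y₀ : X} (hy : y₀ ∈ c.U) {s s' : ∀ y, E.fib y}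
    (hs : ContinuousAt (fun y => (⟨y, s y⟩ : Tot E.fib)) y₀)
    (hs' : ContinuousAt (fun y => (⟨y, s' y⟩ : Tot E.fib)) y₀) :
    ContinuousAt (fun y => (⟨y, c.constForm D y (s y) (s' y)⟩ : Tot 𝒜.fib)) y₀ := by
  refine (𝒜.continuousAt_iff x₀ (z₀ := y₀) (c.subset_base hy)).2 ⟨continuousAt_id, ?_⟩
  have h := c.frame.continuousAt_form (z₀ := y₀) (B := fun _ => D)
    (Eventually.of_forall fun _ => hD) (fun _ _ => continuousAt_const)
    ((c.continuousAt_iff (z₀ := y₀) hy).1 hs).2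
    ((c.continuousAt_iff (z₀ := y₀) hy).1 hs').2
  refine h.congr ?_
  filter_upwards [c.eventually_mem hy] with z hz
  rw [𝒜.coord_of_mem x₀ (c.subset_base hz), c.constForm_of_mem D hz, transportForm,
    AlgEquiv.apply_symm_apply, c.coord_of_mem hz, c.coord_of_mem hz]
  rfl

/-- Metrics of the charts, glued by a partition of unity. -/
theorem exists_isMetric_bundle [T2Space X] [ParacompactSpace X]
    (E : RealBundle 𝒜.toRealAlgBundle) :
    ∃ B : ∀ x, E.fib x → E.fib x → 𝒜.fib x, (∀ x, IsMetric (B x)) ∧ FormContinuous B := by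
  obtain ⟨c⟩ : Nonempty (∀ x₀, Chart E x₀) := ⟨fun x₀ => (exists_chart E x₀).some⟩
  choose D hD using fun x₀ => (c x₀).frame.exists_isMetric
  obtain ⟨ρ, hρ⟩ := PartitionOfUnity.exists_isSubordinate (s := Set.univ) isClosed_univ
    (fun x => (c x).U) (fun x => (c x).isOpen) fun x _ => Set.mem_iUnion.2 ⟨x, (c x).mem⟩
  let B : ∀ x, E.fib x → E.fib x → 𝒜.fib x := fun x e e' =>
    ∑ i ∈ ρ.finsupport x, ρ i x • (c i).constForm (D i) x e e'
  have hterm : ∀ i x, IsPosForm fun e e' => ρ i x • (c i).constForm (D i) x e e' := fun i x =>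
    ((c i).isPosForm_constForm (hD i) x).smul (ρ.nonneg i x)
  have hB : ∀ x, IsMetric (B x) := fun x => by
    classical
    obtain ⟨i, hi⟩ := ρ.exists_pos (Set.mem_univ x)
    have hi' : i ∈ ρ.finsupport x := (ρ.mem_finsupport x).2 hi.ne'
    have hx : x ∈ (c i).U := hρ i (subset_tsupport _ hi.ne')
    have h1 := ((c i).isMetric_constForm (hD i) hx).smul hi
    have h2 := IsPosForm.sum ((ρ.finsupport x).erase i) fun j _ => hterm j x
    have h3 := isMetric_add_fib h1 h2
    convert h3 using 1
    ext e e'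
    exact (add_sum_erase _ (fun j => ρ j x • (c j).constForm (D j) x e e') hi').symm
  refine ⟨B, hB, formContinuous_of_charts (fun x => (hB x).toIsSesq) fun x₀ =>
    ⟨c x₀, fun p p' => ?_⟩⟩
  have h1 : ∀ i ∈ ρ.fintsupport x₀, ContinuousAt (fun y => ρ i y •
      𝒜.coord x₀ y ((c i).constForm (D i) y ((c x₀).vec y p) ((c x₀).vec y p'))) x₀ :=
      fun i hi => by
    have hx : x₀ ∈ (c i).U := hρ i ((ρ.mem_fintsupport_iff x₀ i).1 hi)
    have h2 := (c i).continuousAt_constForm (hD i).toIsSesq hx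
      ((c x₀).continuousAt_vec (c x₀).mem p) ((c x₀).continuousAt_vec (c x₀).mem p')
    exact (ρ i).continuous.continuousAt.smul
      ((𝒜.continuousAt_iff x₀ (z₀ := x₀) (𝒜.mem_base x₀)).1 h2).2
  have h2 : ContinuousAt (fun y => ∑ i ∈ ρ.fintsupport x₀, ρ i y •
      𝒜.coord x₀ y ((c i).constForm (D i) y ((c x₀).vec y p) ((c x₀).vec y p'))) x₀ :=
    tendsto_finsetSum _ h1
  refine h2.congr ?_
  filter_upwards [(c x₀).eventually_mem (c x₀).mem, ρ.eventually_finsupport_subset x₀]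
    with y hy hsub
  simp only [Chart.form, B, 𝒜.coord_of_mem x₀ ((c x₀).subset_base hy), map_sum, map_smul]
  symm
  refine sum_subset hsub fun i _ hi => ?_
  rw [ρ.mem_finsupport, Function.mem_support, not_not] at hi
  rw [hi, zero_smul]

/-- The values of a family of forms at equal points. -/
theorem form_congr (B : ∀ x, E.fib x → E.fib x → 𝒜.fib x) {x y : X} {e e' : E.fib x}
    {f f' : E.fib y} {a : 𝒜.fib y} (h : (⟨y, f⟩ : Tot E.fib) = ⟨x, e⟩)
    (h' : (⟨y, f'⟩ : Tot E.fib) = ⟨x, e'⟩) (ha : (⟨y, a⟩ : Tot 𝒜.fib) = ⟨x, B x e e'⟩) :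
    B y f f' = a := by
  obtain rfl : y = x := congrArg Bundle.TotalSpace.proj h
  rw [Bundle.TotalSpace.mk_injective _ h, Bundle.TotalSpace.mk_injective _ h',
    Bundle.TotalSpace.mk_injective _ ha]

/-- The average of a metric over the involution is an invariant metric. -/
theorem exists_isMetric_invariant [T2Space X] [ParacompactSpace X]
    (E : RealBundle 𝒜.toRealAlgBundle) :
    ∃ B : ∀ x, E.fib x → E.fib x → 𝒜.fib x,
      (∀ x, IsMetric (B x)) ∧ FormContinuous B ∧ BarInvariant B := by
  obtain ⟨B, hB, hBc⟩ := exists_isMetric_bundle E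
  let C : ∀ x, E.fib x → E.fib x → 𝒜.fib x := fun x =>
    transportForm (𝒜.barEquiv x).symm (E.barEquiv x).symm (B (σ x))
  have hC : ∀ x, IsMetric (C x) := fun x => (isSemiIso_bar E x).symm.isMetric (hB (σ x))
  have hCb : ∀ x e e', 𝒜.bar x (C x e e') = B (σ x) (E.bar x e) (E.bar x e') := fun x e e' =>
    (𝒜.barEquiv x).apply_symm_apply _
  have hCbar : ∀ x e e', C (σ x) (E.bar x e) (E.bar x e') = 𝒜.bar x (B x e e') := fun x e e' => by
    apply (𝒜.barEquiv (σ x)).injective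
    change 𝒜.bar (σ x) _ = 𝒜.bar (σ x) _
    rw [hCb]
    exact form_congr B (E.bar_bar x e) (E.bar_bar x e') (𝒜.bar_bar x _)
  have hCc : FormContinuous C := by
    let _ := fibProdTop E.top E.top
    have h1 : Continuous fun p : Tot (fun x => E.fib x × E.fib x) =>
        (⟨σ p.proj, (E.bar p.proj p.snd.1, E.bar p.proj p.snd.2)⟩ :
          Tot fun x => E.fib x × E.fib x) :=
      continuous_toProd (E.continuous_bar.comp (continuous_left E.top E.top))
        (E.continuous_bar.comp (continuous_right E.top E.top))
    refine (𝒜.continuous_bar.comp (Continuous.comp hBc h1)).congr fun p => ?_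
    change (⟨_, 𝒜.bar _ (B (σ p.proj) (E.bar p.proj p.snd.1) (E.bar p.proj p.snd.2))⟩ : Tot 𝒜.fib)
      = _
    rw [← hCb]
    exact 𝒜.bar_bar _ _
  refine ⟨fun x e e' => B x e e' + C x e e', fun x => isMetric_add_fib (hB x) (hC x).toIsPosForm,
    formContinuous_add hBc hCc, fun x e e' => ?_⟩
  change B _ _ _ + C _ _ _ = 𝒜.bar x (B x e e' + C x e e')
  rw [map_add, hCb, hCbar, add_comm]

end Bundle

end

/-! ### The algebra `R ⊗ ℝ[t]/(t² = ε)` -/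

section RootAlg

variable {ε : ℝ}

theorem monic_root (ε : ℝ) : (Polynomial.X ^ 2 - Polynomial.C ε : ℝ[X]).Monic :=
  Polynomial.monic_X_pow_sub_C ε two_ne_zero

/-- The element `t` of `ℝ[t]/(t² = ε)`. -/
noncomputable abbrev rootElt (ε : ℝ) : RootAlg ε := AdjoinRoot.root _

theorem rootElt_mul_self (ε : ℝ) : rootElt ε * rootElt ε = algebraMap ℝ _ ε := by
  have h := AdjoinRoot.eval₂_root (Polynomial.X ^ 2 - Polynomial.C ε : ℝ[X])
  simp only [Polynomial.eval₂_sub, Polynomial.eval₂_pow, Polynomial.eval₂_X,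
    Polynomial.eval₂_C] at h
  rw [← sq]
  exact sub_eq_zero.1 h

/-- The coefficient of `t ^ i` in an element of `ℝ[t]/(t² = ε)`. -/
noncomputable def rootCoeff (ε : ℝ) (i : ℕ) : RootAlg ε →ₗ[ℝ] ℝ :=
  Polynomial.lcoeff ℝ i ∘ₗ AdjoinRoot.modByMonicHom (monic_root ε)

theorem rootCoeff_one (ε : ℝ) (i : ℕ) :
    rootCoeff ε i 1 = (Polynomial.C 1 : ℝ[X]).coeff i := by
  have h : (1 : RootAlg ε) = AdjoinRoot.mk _ 1 := (map_one _).symm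
  rw [rootCoeff, LinearMap.comp_apply, h, AdjoinRoot.modByMonicHom_mk,
    (Polynomial.modByMonic_eq_self_iff (monic_root ε)).2]
  · rfl
  · rw [Polynomial.degree_X_pow_sub_C two_pos, Polynomial.degree_one]
    norm_num

theorem rootCoeff_root (ε : ℝ) (i : ℕ) :
    rootCoeff ε i (rootElt ε) = (Polynomial.X : ℝ[X]).coeff i := by
  have h : rootElt ε = AdjoinRoot.mk _ Polynomial.X := rfl
  rw [rootCoeff, LinearMap.comp_apply, h, AdjoinRoot.modByMonicHom_mk,
    (Polynomial.modByMonic_eq_self_iff (monic_root ε)).2]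
  · rfl
  · rw [Polynomial.degree_X_pow_sub_C two_pos, Polynomial.degree_X]
    norm_num

theorem rootAlg_eq (q : RootAlg ε) :
    q = rootCoeff ε 0 q • 1 + rootCoeff ε 1 q • rootElt ε := by
  have h1 := AdjoinRoot.mk_leftInverse (monic_root ε) q
  set r := AdjoinRoot.modByMonicHom (monic_root ε) q with hr
  have hdeg : r.natDegree ≤ 1 := by
    obtain ⟨f, rfl⟩ := AdjoinRoot.mk_surjective q
    rw [AdjoinRoot.modByMonicHom_mk] at hr
    have h2 := Polynomial.natDegree_modByMonic_lt f (monic_root ε) (by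
      intro h
      have := congrArg Polynomial.natDegree h
      rw [Polynomial.natDegree_X_pow_sub_C, Polynomial.natDegree_one] at this
      norm_num at this)
    rw [Polynomial.natDegree_X_pow_sub_C, ← hr] at h2
    omega
  have h2 := Polynomial.eq_X_add_C_of_natDegree_le_one hdeg
  have h3 : ∀ i, rootCoeff ε i q = r.coeff i := fun i => rfl
  rw [h3, h3]
  conv_lhs => rw [← h1, h2]
  rw [map_add, map_mul, AdjoinRoot.mk_X, AdjoinRoot.mk_C, AdjoinRoot.mk_C, Algebra.smul_def,
    Algebra.smul_def, mul_one, add_comm]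
  rfl

variable {R : Type u} [Ring R] [Algebra ℝ R]

theorem contract_tmul {B : Type} [Ring B] [Algebra ℝ B] (f : B →ₗ[ℝ] ℝ) (a : R) (b : B) :
    contract R f (a ⊗ₜ b) = f b • a := by
  simp [contract]

/-- The coefficient of `1` in an element of `R ⊗ ℝ[t]/(t² = ε)`. -/
noncomputable def re (z : R ⊗[ℝ] RootAlg ε) : R := contract R (rootCoeff ε 0) z

/-- The coefficient of `t` in an element of `R ⊗ ℝ[t]/(t² = ε)`. -/
noncomputable def im (z : R ⊗[ℝ] RootAlg ε) : R := contract R (rootCoeff ε 1) z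

theorem re_add (z w : R ⊗[ℝ] RootAlg ε) : re (z + w) = re z + re w := map_add _ _ _

theorem im_add (z w : R ⊗[ℝ] RootAlg ε) : im (z + w) = im z + im w := map_add _ _ _

@[simp] theorem re_tmul_one (a : R) : re (a ⊗ₜ (1 : RootAlg ε)) = a := by
  rw [re, contract_tmul, rootCoeff_one]
  simp

@[simp] theorem im_tmul_one (a : R) : im (a ⊗ₜ (1 : RootAlg ε)) = 0 := by
  rw [im, contract_tmul, rootCoeff_one]
  simp [Polynomial.coeff_one]

@[simp] theorem re_tmul_root (a : R) : re (a ⊗ₜ rootElt ε) = 0 := by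
  rw [re, contract_tmul, rootCoeff_root]
  simp

@[simp] theorem im_tmul_root (a : R) : im (a ⊗ₜ rootElt ε) = a := by
  rw [im, contract_tmul, rootCoeff_root]
  simp

theorem re_add_im (z : R ⊗[ℝ] RootAlg ε) :
    re z ⊗ₜ[ℝ] (1 : RootAlg ε) + im z ⊗ₜ[ℝ] rootElt ε = z := by
  induction z using TensorProduct.induction_on with
  | zero => simp [re, im]
  | tmul a q =>
    rw [re, im, contract_tmul, contract_tmul, TensorProduct.smul_tmul, TensorProduct.smul_tmul,
      ← TensorProduct.tmul_add, ← rootAlg_eq]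
  | add z w hz hw =>
    rw [re_add, im_add, TensorProduct.add_tmul, TensorProduct.add_tmul, add_add_add_comm, hz, hw]

theorem root_ext {z w : R ⊗[ℝ] RootAlg ε} (h : re z = re w) (h' : im z = im w) : z = w := by
  rw [← re_add_im z, ← re_add_im w, h, h']

theorem mul_eq (z w : R ⊗[ℝ] RootAlg ε) : z * w =
    (re z * re w + ε • (im z * im w)) ⊗ₜ[ℝ] (1 : RootAlg ε) +
      (re z * im w + im z * re w) ⊗ₜ[ℝ] rootElt ε := by
  conv_lhs => rw [← re_add_im z, ← re_add_im w]
  simp only [mul_add, add_mul, Algebra.TensorProduct.tmul_mul_tmul, mul_one, one_mul,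
    rootElt_mul_self, TensorProduct.add_tmul, Algebra.algebraMap_eq_smul_one,
    TensorProduct.smul_tmul]
  abel

theorem re_mul (z w : R ⊗[ℝ] RootAlg ε) : re (z * w) = re z * re w + ε • (im z * im w) := by
  rw [mul_eq, re_add]
  simp

theorem im_mul (z w : R ⊗[ℝ] RootAlg ε) : im (z * w) = re z * im w + im z * re w := by
  rw [mul_eq, im_add]
  simp

theorem re_map {S : Type u} [Ring S] [Algebra ℝ S] (φ : R →ₐ[ℝ] S) (z : R ⊗[ℝ] RootAlg ε) :
    re (Algebra.TensorProduct.map φ (AlgHom.id ℝ (RootAlg ε)) z) = φ (re z) :=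
  contract_map _ φ z

theorem im_map {S : Type u} [Ring S] [Algebra ℝ S] (φ : R →ₐ[ℝ] S) (z : R ⊗[ℝ] RootAlg ε) :
    im (Algebra.TensorProduct.map φ (AlgHom.id ℝ (RootAlg ε)) z) = φ (im z) :=
  contract_map _ φ z

/-! ### Modules over `R ⊗ ℝ[t]/(t² = ε)` -/

variable {M : Type*} [AddCommGroup M] [Module R M]

/-- The module structure over `R ⊗ ℝ[t]/(t² = ε)` on an `R`-module, in which `t` acts by an operator
`J` with `J² = ε`. -/
noncomputable abbrev rootModule (J : M →ₗ[R] M) (hJ : ∀ m, J (J m) = (ε • (1 : R)) • m) :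
    Module (R ⊗[ℝ] RootAlg ε) M where
  smul z m := re z • m + im z • J m
  one_smul m := by
    change re (1 ⊗ₜ 1) • m + im (1 ⊗ₜ 1) • J m = m
    simp
  mul_smul z w m := by
    change re (z * w) • m + im (z * w) • J m =
      re z • (re w • m + im w • J m) + im z • J (re w • m + im w • J m)
    simp only [re_mul, im_mul, map_add, map_smul, hJ, smul_add, add_smul, smul_smul, mul_smul_comm,
      mul_one]
    abel
  smul_zero z := by
    change re z • (0 : M) + im z • J 0 = 0
    simp
  smul_add z m n := by
    change re z • (m + n) + im z • J (m + n) = (re z • m + im z • J m) + (re z • n + im z • J n)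
    simp only [map_add, smul_add]
    abel
  add_smul z w m := by
    change re (z + w) • m + im (z + w) • J m = (re z • m + im z • J m) + (re w • m + im w • J m)
    simp only [re_add, im_add, add_smul]
    abel
  zero_smul m := by
    change re (0 : R ⊗[ℝ] RootAlg ε) • m + im (0 : R ⊗[ℝ] RootAlg ε) • J m = 0
    simp [re, im]

/-- A finite dual basis of a module. -/
theorem exists_dualBasis (R M : Type*) [Ring R] [AddCommGroup M] [Module R M] [Module.Finite R M]
    [Module.Projective R M] : ∃ (n : ℕ) (vec : Fin n → M) (coord : Fin n → M →ₗ[R] R),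
      ∀ m, ∑ i, coord i m • vec i = m := by
  obtain ⟨n, q, i, -, -, hq⟩ := Module.Finite.exists_comp_eq_id_of_projective R M
  refine ⟨n, fun k => q (Pi.single k 1), fun k => LinearMap.proj k ∘ₗ i, fun m => ?_⟩
  simp only [← map_smul, ← map_sum, ← Pi.single_smul, smul_eq_mul, mul_one, LinearMap.comp_apply,
    LinearMap.proj_apply, univ_sum_single]
  exact LinearMap.congr_fun hq m

theorem finite_projective_of_dualBasis {R M : Type*} [Ring R] [AddCommGroup M] [Module R M]
    {ι : Type*} [Fintype ι] {vec : ι → M} {coord : ι → M →ₗ[R] R}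
    (h : ∀ m, ∑ i, coord i m • vec i = m) : Module.Finite R M ∧ Module.Projective R M := by
  classical
  let q : (ι → R) →ₗ[R] M := ∑ i, (LinearMap.proj i : (ι → R) →ₗ[R] R).smulRight (vec i)
  have hq : q ∘ₗ LinearMap.pi coord = LinearMap.id := by
    ext m
    simp [q, h]
  exact ⟨Module.Finite.of_surjective q fun m => ⟨LinearMap.pi coord m, LinearMap.congr_fun hq m⟩,
    Module.Projective.of_split _ _ hq⟩

variable [Module (R ⊗[ℝ] RootAlg ε) M] {J : M →ₗ[R] M}

theorem root_smul_smul (hM : ∀ (z : R ⊗[ℝ] RootAlg ε) (m : M), z • m = re z • m + im z • J m)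
    (m : M) : J (J m) = (ε • (1 : R)) • m := by
  have h1 : ∀ m, J m = ((1 : R) ⊗ₜ[ℝ] rootElt ε) • m := fun m => by simp [hM]
  rw [h1, h1, smul_smul, hM, re_mul, im_mul]
  simp

/-- Restriction of scalars to `R` preserves finitely generated projective modules: a dual basis
over `R ⊗ ℝ[t]/(t² = ε)` gives one over `R` with twice as many elements. -/
theorem finite_projective_restrict
    (hM : ∀ (z : R ⊗[ℝ] RootAlg ε) (m : M), z • m = re z • m + im z • J m)
    [Module.Finite (R ⊗[ℝ] RootAlg ε) M] [Module.Projective (R ⊗[ℝ] RootAlg ε) M] :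
    Module.Finite R M ∧ Module.Projective R M := by
  obtain ⟨n, vec, coord, h⟩ := exists_dualBasis (R ⊗[ℝ] RootAlg ε) M
  have ha : ∀ (a : R) (m : M), a • m = (a ⊗ₜ[ℝ] (1 : RootAlg ε)) • m := fun a m => by simp [hM]
  let c : Fin n ⊕ Fin n → M →ₗ[R] R := Sum.elim
    (fun i =>
      { toFun := fun m => re (coord i m)
        map_add' := fun m m' => by rw [map_add, re_add]
        map_smul' := fun a m => by
          rw [ha, map_smul, smul_eq_mul, re_mul]
          simp })
    (fun i =>
      { toFun := fun m => im (coord i m)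
        map_add' := fun m m' => by rw [map_add, im_add]
        map_smul' := fun a m => by
          rw [ha, map_smul, smul_eq_mul, im_mul]
          simp })
  refine finite_projective_of_dualBasis (vec := Sum.elim vec fun i => J (vec i)) (coord := c)
    fun m => ?_
  rw [Fintype.sum_sum_type, ← sum_add_distrib]
  conv_rhs => rw [← h m]
  exact sum_congr rfl fun i _ => (hM _ _).symm

/-- For `ε² = 1`, a module over `R ⊗ ℝ[t]/(t² = ε)` is finitely generated projective if it is so
over `R`: a dual basis over `R` gives one over `R ⊗ ℝ[t]/(t² = ε)` by averaging. -/
theorem finite_projective_extend (hε : ε * ε = 1)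
    (hM : ∀ (z : R ⊗[ℝ] RootAlg ε) (m : M), z • m = re z • m + im z • J m)
    [Module.Finite R M] [Module.Projective R M] :
    Module.Finite (R ⊗[ℝ] RootAlg ε) M ∧ Module.Projective (R ⊗[ℝ] RootAlg ε) M := by
  obtain ⟨n, vec, coord, h⟩ := exists_dualBasis R M
  have hJ := root_smul_smul hM
  let c : Fin n → M → R ⊗[ℝ] RootAlg ε := fun i m =>
    ((1 / 2 : ℝ) • coord i m) ⊗ₜ 1 + ((1 / 2 * ε : ℝ) • coord i (J m)) ⊗ₜ rootElt ε
  have hre : ∀ i m, re (c i m) = (1 / 2 : ℝ) • coord i m := fun i m => by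
    rw [re_add]; simp
  have him : ∀ i m, im (c i m) = (1 / 2 * ε : ℝ) • coord i (J m) := fun i m => by
    rw [im_add]; simp
  have hJc : ∀ i m, coord i (J (J m)) = ε • coord i m := fun i m => by
    rw [hJ, map_smul, smul_eq_mul, smul_mul_assoc, one_mul]
  let c' : Fin n → M →ₗ[R ⊗[ℝ] RootAlg ε] R ⊗[ℝ] RootAlg ε := fun i =>
    { toFun := c i
      map_add' := fun m m' => by
        apply root_ext
        · rw [hre, re_add (c i m) (c i m'), hre, hre, map_add, smul_add]
        · rw [him, im_add (c i m) (c i m'), him, him, map_add, map_add, smul_add]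
      map_smul' := fun z m => by
        rw [RingHom.id_apply, smul_eq_mul]
        have hε' : ε * (1 / 2 * ε) = 1 / 2 := by rw [mul_left_comm, hε, mul_one]
        have hε'' : 1 / 2 * ε * ε = 1 / 2 := by rw [mul_assoc, hε, mul_one]
        apply root_ext
        · rw [re_mul, hre, hre, him, hM, map_add, map_smul, map_smul]
          simp only [smul_eq_mul, smul_add, mul_smul_comm, smul_smul, hε']
        · rw [im_mul, him, hre, him, hM, map_add, map_smul, map_smul, map_add, map_smul, map_smul,
            hJc]
          simp only [smul_eq_mul, smul_add, mul_smul_comm, smul_smul, hε''] }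
  refine finite_projective_of_dualBasis (vec := vec) (coord := c') fun m => ?_
  have h1 : ∀ i, c' i m • vec i = ((1 / 2 : ℝ) • (1 : R)) • coord i m • vec i +
      ((1 / 2 * ε : ℝ) • (1 : R)) • J (coord i (J m) • vec i) := fun i => by
    change c i m • vec i = _
    rw [hM, hre, him, map_smul, smul_smul, smul_smul, smul_mul_assoc, one_mul, smul_mul_assoc,
      one_mul]
  rw [sum_congr rfl fun i _ => h1 i, sum_add_distrib, ← smul_sum, ← smul_sum, ← map_sum, h, h, hJ,
    smul_smul, ← add_smul]
  have h2 : ((1 / 2 * ε : ℝ) • (1 : R)) * ε • 1 = (1 / 2 : ℝ) • (1 : R) := by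
    rw [smul_mul_smul_comm, mul_one, mul_assoc, hε, mul_one]
  rw [h2, ← add_smul]
  norm_num

variable [TopologicalSpace R] [IsTopologicalRing R] [ContinuousConstSMul ℝ R]

theorem continuous_tmul_one : Continuous fun a : R => a ⊗ₜ[ℝ] (1 : RootAlg ε) := by
  refine continuous_iInf_rng.2 fun f => continuous_induced_rng.2 ?_
  refine (continuous_id.const_smul (f 1)).congr fun a => ?_
  exact (contract_tmul f a 1).symm

theorem continuous_re : Continuous (re : R ⊗[ℝ] RootAlg ε → R) :=
  continuous_contract_model _ _

theorem continuous_im : Continuous (im : R ⊗[ℝ] RootAlg ε → R) :=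
  continuous_contract_model _ _

/-- The module topologies over `R` and `R ⊗ ℝ[t]/(t² = ε)` agree. -/
theorem moduleTopology_root
    (hM : ∀ (z : R ⊗[ℝ] RootAlg ε) (m : M), z • m = re z • m + im z • J m) :
    moduleTopology R M = moduleTopology (R ⊗[ℝ] RootAlg ε) M := by
  apply le_antisymm
  · let _ := moduleTopology (R ⊗[ℝ] RootAlg ε) M
    have h1 : ContinuousSMul (R ⊗[ℝ] RootAlg ε) M := ModuleTopology.continuousSMul _ _
    have h2 : ContinuousAdd M := ModuleTopology.continuousAdd (R ⊗[ℝ] RootAlg ε) M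
    have h3 : ContinuousSMul R M := ⟨by
      have := (continuous_tmul_one (R := R) (ε := ε)).comp (continuous_fst (X := R) (Y := M))
      refine (this.smul continuous_snd).congr fun p => ?_
      simp [hM]⟩
    exact moduleTopology_le R M
  · let _ := moduleTopology R M
    have h0 : IsModuleTopology R M := ⟨rfl⟩
    have h1 : ContinuousSMul R M := ModuleTopology.continuousSMul _ _
    have h2 : ContinuousAdd M := ModuleTopology.continuousAdd R M
    have hJ : Continuous J := IsModuleTopology.continuous_of_linearMap J
    have h3 : ContinuousSMul (R ⊗[ℝ] RootAlg ε) M := ⟨by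
      have hr := (continuous_re (R := R) (ε := ε)).comp (continuous_fst (Y := M))
      have hi := (continuous_im (R := R) (ε := ε)).comp (continuous_fst (Y := M))
      refine ((hr.smul continuous_snd).add (hi.smul (hJ.comp continuous_snd))).congr fun p => ?_
      exact (hM p.1 p.2).symm⟩
    exact moduleTopology_le (R ⊗[ℝ] RootAlg ε) M

end RootAlg

section

variable {X : Type v} [TopologicalSpace X] {σ : Involution X}

section Bundle

variable {A : Type u} [NormedRing A] [NormedAlgebra ℝ A] [CompleteSpace A] [StarRing A]
  [StarModule ℝ A] [RealCStar A] {𝒜 : RealStarAlgBundle σ A} {ε : ℝ}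

/-! ### Real bundles over `𝒜 ⊗ ℝ[t]/(t² = ε)` as Real bundles with an operator -/

theorem RealBundle.continuous_add (E : RealBundle 𝒜.toRealAlgBundle) :
    Continuous[fibProdTop E.top E.top, E.top]
      fun p => (⟨p.proj, p.snd.1 + p.snd.2⟩ : Tot E.fib) := by
  let _ := E.top
  let _ := fibProdTop E.top E.top
  refine continuous_iff_continuousAt.2 fun p₀ => ?_
  obtain ⟨c⟩ := exists_chart E p₀.proj
  have hl := continuous_left E.top E.top
  have hr := continuous_right E.top E.top
  have hp : Continuous fun p : Tot (fun x => E.fib x × E.fib x) => p.proj :=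
    E.continuous_proj.comp hl
  refine (c.continuousAt_iff (z₀ := p₀) c.mem).2 ⟨hp.continuousAt, ?_⟩
  have h1 := ((c.continuousAt_iff (z₀ := p₀) c.mem).1 hl.continuousAt).2
  have h2 := ((c.continuousAt_iff (z₀ := p₀) c.mem).1 hr.continuousAt).2
  refine (h1.add h2).congr ?_
  filter_upwards [hp.continuousAt (c.isOpen.mem_nhds c.mem)] with p hpU
  have hpU' : p.proj ∈ c.U := hpU
  simp only [Pi.add_apply, c.coord_of_mem hpU', map_add]

theorem continuous_re_tot : Continuous[𝒜.tensorTop (RootAlg ε), 𝒜.top]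
    fun p => (⟨p.proj, re p.snd⟩ : Tot 𝒜.fib) :=
  𝒜.continuous_contract (RootAlg ε) (rootCoeff ε 0)

theorem continuous_im_tot : Continuous[𝒜.tensorTop (RootAlg ε), 𝒜.top]
    fun p => (⟨p.proj, im p.snd⟩ : Tot 𝒜.fib) :=
  𝒜.continuous_contract (RootAlg ε) (rootCoeff ε 1)

/-- For operators with `J² = J'² = ε = ±1`, the operator `(1 + ε J J') / 2` intertwines `J'`
and `J`. It is the identity for `J = J'`, hence invertible for `J` close to `J'`. -/
noncomputable def intertwiner {P : Type*} [AddCommGroup P] [Module ℝ P] [Module A P]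
    [IsScalarTower ℝ A P] (ε : ℝ) (J J' : P →ₗ[A] P) : P →ₗ[A] P :=
  (1 / 2 : ℝ) • (LinearMap.id + ε • J ∘ₗ J')

section intertwiner

variable {P : Type*} [AddCommGroup P] [Module ℝ P] [Module A P] [IsScalarTower ℝ A P]
  {J J' : P →ₗ[A] P}

theorem intertwiner_apply (p : P) :
    intertwiner ε J J' p = (1 / 2 : ℝ) • (p + ε • J (J' p)) := rfl

theorem intertwiner_comm (hε : ε * ε = 1) (hJ : ∀ p, J (J p) = ε • p)
    (hJ' : ∀ p, J' (J' p) = ε • p) (p : P) :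
    J (intertwiner ε J J' p) = intertwiner ε J J' (J' p) := by
  simp only [intertwiner_apply, hJ', LinearMap.map_smul_of_tower, map_add, hJ, smul_smul, hε,
    one_smul, add_comm]

theorem intertwiner_self (hε : ε * ε = 1) (hJ : ∀ p, J (J p) = ε • p) (p : P) :
    intertwiner ε J J p = p := by
  rw [intertwiner_apply, hJ, smul_smul, hε, one_smul, ← two_smul ℝ p, smul_smul]
  norm_num

end intertwiner

variable {E : RealBundle 𝒜.toRealAlgBundle}

/-- An operator `J` with `J² = ε` on a Real `𝒜`-bundle is constant in suitable local
trivializations. -/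
theorem exists_rootChart (hε : ε * ε = 1) {J : ∀ x, E.fib x →ₗ[𝒜.fib x] E.fib x}
    (hJ : ∀ x e, J x (J x e) = (ε • (1 : 𝒜.fib x)) • e) (hJc : MapContinuous fun x => J x)
    {x₀ : X} (c : Chart E x₀) :
    (∀ p, c.rep J x₀ (c.rep J x₀ p) = (ε • (1 : A)) • p) ∧
    ∃ (V : Set X) (hV : V ⊆ 𝒜.base x₀) (g : ∀ y : V, E.fib y ≃+ c.P), IsOpen V ∧ x₀ ∈ V ∧
      (∀ (y : V) (a : 𝒜.fib y) (e : E.fib y), g y (a • e) = 𝒜.triv x₀ ⟨y, hV y.2⟩ a • g y e) ∧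
      (∀ (y : V) (e : E.fib y), g y (J y e) = c.rep J x₀ (g y e)) ∧
      IsTrivialization E.top V fun y => (g y).toEquiv := by
  have hrep : ∀ y ∈ c.U, ∀ p, c.rep J y (c.rep J y p) = (ε • (1 : A)) • p := fun y hy p => by
    rw [c.rep_of_mem J hy, c.rep_of_mem J hy, AddEquiv.symm_apply_apply, hJ, c.smul, map_smul,
      map_one, AddEquiv.apply_symm_apply]
  have hrep' : ∀ y ∈ c.U, ∀ p, c.rep J y (c.rep J y p) = ε • p := fun y hy p => by
    rw [hrep y hy, smul_assoc, one_smul]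
  refine ⟨hrep x₀ c.mem, ?_⟩
  let s : X → c.P →ₗ[A] c.P := fun y => intertwiner ε (c.rep J y) (c.rep J x₀)
  let S : X → c.P →L[ℝ] c.P := fun y => c.frame.toCLM (s y)
  have hS : ContinuousOn S c.U := fun y hy => ContinuousAt.continuousWithinAt <| by
    refine c.frame.continuousAt_toCLM fun p => ?_
    exact (continuousAt_const.add
      ((c.continuousAt_rep hJc hy _).const_smul ε)).const_smul (1 / 2 : ℝ)
  -- The intertwiner is the identity at `x₀`, and invertibility is an open condition.
  let V : Set X := c.U ∩ S ⁻¹' {f | IsUnit f}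
  have hVo : IsOpen V := hS.isOpen_inter_preimage c.isOpen Units.isOpen
  have hx₀ : x₀ ∈ V := by
    refine ⟨c.mem, ?_⟩
    have : S x₀ = 1 := by
      ext p
      exact intertwiner_self hε (hrep' x₀ c.mem) p
    simp [this]
  have hinv : ∀ y ∈ V, ∀ p, s y ((Ring.inverse (S y) : c.P →L[ℝ] c.P) p) = p := fun y hy p =>
    congrArg (fun f : c.P →L[ℝ] c.P => f p) (Ring.mul_inverse_cancel (S y) hy.2)
  have hinv' : ∀ y ∈ V, ∀ p, (Ring.inverse (S y) : c.P →L[ℝ] c.P) (s y p) = p := fun y hy p =>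
    congrArg (fun f : c.P →L[ℝ] c.P => f p) (Ring.inverse_mul_cancel (S y) hy.2)
  let r : ∀ y : V, c.P ≃+ c.P := fun y =>
    { toFun := (Ring.inverse (S y) : c.P →L[ℝ] c.P)
      invFun := s y
      left_inv := hinv y y.2
      right_inv := hinv' y y.2
      map_add' := map_add _ }
  have hr : ∀ (y : V) p, (r y).symm p = s y p := fun _ _ => rfl
  refine ⟨V, fun y hy => c.subset_base hy.1, fun y => (c.g ⟨y, y.2.1⟩).trans (r y), hVo, hx₀,
    fun y a e => ?_, fun y e => ?_, ?_, ?_⟩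
  · rw [AddEquiv.trans_apply, AddEquiv.trans_apply, c.smul, ← AddEquiv.eq_symm_apply, hr, map_smul,
      ← hr, AddEquiv.symm_apply_apply]
  · rw [AddEquiv.trans_apply, AddEquiv.trans_apply, ← AddEquiv.eq_symm_apply, hr]
    rw [← intertwiner_comm hε (hrep' y y.2.1) (hrep' x₀ c.mem)]
    change _ = c.rep J y (s y _)
    rw [← hr, AddEquiv.symm_apply_apply, c.rep_of_mem J y.2.1, AddEquiv.symm_apply_apply]
  · let _ := E.top
    have h1 : Continuous fun p : {p : Tot E.fib // p.proj ∈ V} => S p.1.proj :=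
      (hS.mono Set.inter_subset_left).comp_continuous
        (E.continuous_proj.comp continuous_subtype_val) fun p => p.2
    have h2 : Continuous fun p : {p : Tot E.fib // p.proj ∈ V} => Ring.inverse (S p.1.proj) := by
      refine continuous_iff_continuousAt.2 fun p => ?_
      obtain ⟨w, hw⟩ := p.2.2
      have := NormedRing.inverse_continuousAt w
      rw [hw] at this
      exact ContinuousAt.comp (f := fun p : {p : Tot E.fib // p.proj ∈ V} => S p.1.proj) this
        h1.continuousAt
    exact h2.clm_apply (c.isTrivialization.mono (Set.inter_subset_left (t := S ⁻¹' _))).1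
  · let _ := E.top
    have h1 : Continuous fun q : V × c.P => S q.1 :=
      (hS.mono Set.inter_subset_left).comp_continuous (by fun_prop) fun q => q.1.2
    have h2 : Continuous fun q : V × c.P => s q.1 q.2 := h1.clm_apply continuous_snd
    exact (c.isTrivialization.mono (Set.inter_subset_left (t := S ⁻¹' _))).2.comp
      (continuous_fst.prodMk h2)

/-- The Real bundle over `𝒜 ⊗ ℝ[t]/(t² = ε)` given by a Real `𝒜`-bundle with an operator `J`
such that `J² = ε`. -/
noncomputable def RealBundle.ofRoot (hε : ε * ε = 1) (E : RealBundle 𝒜.toRealAlgBundle)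
    (J : ∀ x, E.fib x →ₗ[𝒜.fib x] E.fib x) (hJ : ∀ x e, J x (J x e) = (ε • (1 : 𝒜.fib x)) • e)
    (hJc : MapContinuous fun x => J x) (hJb : ∀ x e, J (σ x) (E.bar x e) = E.bar x (J x e)) :
    RealBundle (𝒜.adjoinRoot ε) where
  fib := E.fib
  module x := rootModule (J x) (hJ x)
  finite x := by
    let _ := rootModule (J x) (hJ x)
    exact (finite_projective_extend (J := J x) hε fun _ _ => rfl).1
  projective x := by
    let _ := rootModule (J x) (hJ x)
    exact (finite_projective_extend (J := J x) hε fun _ _ => rfl).2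
  top := E.top
  continuous_proj := E.continuous_proj
  locally_trivial x := by
    obtain ⟨c⟩ := exists_chart E x
    obtain ⟨hJ₀, V, hV, g, hVo, hx, hg, hgJ, ht⟩ := exists_rootChart hε hJ hJc c
    let _ := rootModule (c.rep J x) hJ₀
    refine ⟨c.P, inferInstance, rootModule (c.rep J x) hJ₀, inferInstance, ⟨?_⟩, V, hV, g, hVo, hx,
      fun y (z : 𝒜.fib y ⊗[ℝ] RootAlg ε) e => ?_, ht⟩
    · rw [← moduleTopology_root (R := A) (J := c.rep J x) (ε := ε) fun _ _ => rfl]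
      exact IsModuleTopology.eq_moduleTopology'
    · change g y (re z • e + im z • J y e) = re (Algebra.TensorProduct.map
        (𝒜.triv x ⟨y, hV y.2⟩).toAlgHom (AlgHom.id ℝ (RootAlg ε)) z) • g y e + im
        (Algebra.TensorProduct.map (𝒜.triv x ⟨y, hV y.2⟩).toAlgHom (AlgHom.id ℝ (RootAlg ε)) z) •
          c.rep J x (g y e)
      rw [map_add, hg, hg, hgJ, re_map, im_map]
      rfl
  continuous_smul := by
    let _ := E.top
    let _ := 𝒜.top
    let _ := 𝒜.tensorTop (RootAlg ε)
    let _ := fibProdTop (𝒜.tensorTop (RootAlg ε)) E.top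
    let _ := fibProdTop 𝒜.top E.top
    let _ := fibProdTop E.top E.top
    have hl := continuous_left (𝒜.tensorTop (RootAlg ε)) E.top
    have hr := continuous_right (𝒜.tensorTop (RootAlg ε)) E.top
    have h1 := E.continuous_smul.comp
      (f := fun p : Tot fun x => (𝒜.fib x ⊗[ℝ] RootAlg ε) × E.fib x =>
        (⟨p.proj, (re p.snd.1, p.snd.2)⟩ : Tot fun x => 𝒜.fib x × E.fib x))
      (continuous_toProd (continuous_re_tot.comp hl) hr)
    have h2 := E.continuous_smul.comp
      (f := fun p : Tot fun x => (𝒜.fib x ⊗[ℝ] RootAlg ε) × E.fib x =>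
        (⟨p.proj, (im p.snd.1, J p.proj p.snd.2)⟩ : Tot fun x => 𝒜.fib x × E.fib x))
      (continuous_toProd (continuous_im_tot.comp hl) (Continuous.comp hJc hr))
    exact E.continuous_add.comp
      (f := fun p : Tot fun x => (𝒜.fib x ⊗[ℝ] RootAlg ε) × E.fib x =>
        (⟨p.proj, (re p.snd.1 • p.snd.2, im p.snd.1 • J p.proj p.snd.2)⟩ :
          Tot fun x => E.fib x × E.fib x)) (continuous_toProd h1 h2)
  bar := E.bar
  bar_smul x (z : 𝒜.fib x ⊗[ℝ] RootAlg ε) e := by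
    change E.bar x (re z • e + im z • J x e) =
      re (Algebra.TensorProduct.map (𝒜.bar x) (AlgHom.id ℝ (RootAlg ε)) z) • E.bar x e +
      im (Algebra.TensorProduct.map (𝒜.bar x) (AlgHom.id ℝ (RootAlg ε)) z) • J (σ x) (E.bar x e)
    rw [map_add, E.bar_smul, E.bar_smul, re_map, im_map, hJb]
  bar_bar := E.bar_bar
  continuous_bar := E.continuous_bar

theorem RealBundle.inclRoot_smul_ofRoot (hε : ε * ε = 1)
    {J : ∀ x, E.fib x →ₗ[𝒜.fib x] E.fib x} (hJ : ∀ x e, J x (J x e) = (ε • (1 : 𝒜.fib x)) • e)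
    (hJc : MapContinuous fun x => J x) (hJb : ∀ x e, J (σ x) (E.bar x e) = E.bar x (J x e))
    (x : X) (a : 𝒜.fib x) (e : (E.ofRoot hε J hJ hJc hJb).fib x) :
    𝒜.inclRoot ε x a • e = (a • (show E.fib x from e) : E.fib x) := by
  change re (a ⊗ₜ[ℝ] (1 : RootAlg ε)) • (show E.fib x from e) +
    im (a ⊗ₜ[ℝ] (1 : RootAlg ε)) • J x e = _
  rw [re_tmul_one, im_tmul_one, zero_smul, add_zero]

theorem RealBundle.root_smul_ofRoot (hε : ε * ε = 1)
    {J : ∀ x, E.fib x →ₗ[𝒜.fib x] E.fib x} (hJ : ∀ x e, J x (J x e) = (ε • (1 : 𝒜.fib x)) • e)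
    (hJc : MapContinuous fun x => J x) (hJb : ∀ x e, J (σ x) (E.bar x e) = E.bar x (J x e))
    (x : X) (e : (E.ofRoot hε J hJ hJc hJb).fib x) : 𝒜.root ε x • e = J x e := by
  change re ((1 : 𝒜.fib x) ⊗ₜ[ℝ] rootElt ε) • (show E.fib x from e) +
    im ((1 : 𝒜.fib x) ⊗ₜ[ℝ] rootElt ε) • J x e = _
  rw [re_tmul_root, im_tmul_root, zero_smul, zero_add, one_smul]

/-! ### The underlying Real `𝒜`-bundle -/

theorem RealStarAlgBundle.continuous_const_smul (𝒜 : RealStarAlgBundle σ A) (r : ℝ) :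
    Continuous[𝒜.top, 𝒜.top] fun p => (⟨p.proj, r • p.snd⟩ : Tot 𝒜.fib) := by
  let _ := 𝒜.top
  refine continuous_iff_continuousAt.2 fun p₀ => ?_
  have hp : Continuous fun p : Tot 𝒜.fib => p.proj := 𝒜.continuous_proj
  refine (𝒜.continuousAt_iff p₀.proj (z₀ := p₀) (𝒜.mem_base _)).2 ⟨hp.continuousAt, ?_⟩
  have h := ((𝒜.continuousAt_iff p₀.proj (z₀ := p₀) (𝒜.mem_base _)).1 continuousAt_id).2
  refine (h.const_smul r).congr ?_
  filter_upwards [hp.continuousAt ((𝒜.isOpen_base _).mem_nhds (𝒜.mem_base p₀.proj))] with p hpU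
  have hpU' : p.proj ∈ 𝒜.base p₀.proj := hpU
  change r • 𝒜.coord _ p.proj p.snd = _
  rw [𝒜.coord_of_mem _ hpU', 𝒜.coord_of_mem _ hpU', map_smul]

theorem continuous_tmul_const (q : RootAlg ε) : Continuous[𝒜.top, 𝒜.tensorTop (RootAlg ε)]
    fun p => (⟨p.proj, p.snd ⊗ₜ[ℝ] q⟩ : Tot fun x => 𝒜.fib x ⊗[ℝ] RootAlg ε) := by
  let _ := 𝒜.top
  refine continuous_iInf_rng.2 fun f => continuous_induced_rng.2 ?_
  refine (𝒜.continuous_const_smul (f q)).congr fun p => congrArg (Bundle.TotalSpace.mk _) ?_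
  exact (contract_tmul f p.snd q).symm

theorem RealStarAlgBundle.continuous_one (𝒜 : RealStarAlgBundle σ A) :
    Continuous[_, 𝒜.top] fun x => (⟨x, 1⟩ : Tot 𝒜.fib) := by
  let _ := 𝒜.top
  refine continuous_iff_continuousAt.2 fun x => ?_
  refine (𝒜.continuousAt_iff x (z₀ := x) (𝒜.mem_base x)).2 ⟨continuousAt_id, ?_⟩
  refine (continuousAt_const (y := (1 : A))).congr ?_
  filter_upwards [(𝒜.isOpen_base x).mem_nhds (𝒜.mem_base x)] with y hy
  rw [𝒜.coord_of_mem x hy, map_one]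

section underlying

/-- Restriction of scalars along `R → R ⊗ ℝ[t]/(t² = ε)`. -/
noncomputable abbrev restrictModule (R : Type u) [Ring R] [Algebra ℝ R] (ε : ℝ) (M : Type*)
    [AddCommGroup M] [Module (R ⊗[ℝ] RootAlg ε) M] : Module R M :=
  Module.compHom M (Algebra.TensorProduct.includeLeftRingHom : R →+* R ⊗[ℝ] RootAlg ε)

variable {R : Type u} [Ring R] [Algebra ℝ R] {M : Type*} [AddCommGroup M]
  [Module (R ⊗[ℝ] RootAlg ε) M] [Module R M]

/-- The action of `t` on a module over `R ⊗ ℝ[t]/(t² = ε)`, as an `R`-linear operator. -/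
noncomputable def rootLin (h : ∀ (a : R) (m : M), a • m = (a ⊗ₜ[ℝ] (1 : RootAlg ε)) • m) :
    M →ₗ[R] M where
  toFun m := ((1 : R) ⊗ₜ[ℝ] rootElt ε) • m
  map_add' := smul_add _
  map_smul' a m := by
    rw [RingHom.id_apply, h, h, smul_smul, smul_smul]
    congr 1
    simp

theorem smul_eq_rootLin (h : ∀ (a : R) (m : M), a • m = (a ⊗ₜ[ℝ] (1 : RootAlg ε)) • m)
    (z : R ⊗[ℝ] RootAlg ε) (m : M) : z • m = re z • m + im z • rootLin h m := by
  conv_lhs => rw [← re_add_im z]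
  rw [add_smul, h, h]
  congr 1
  change _ = _ • ((1 : R) ⊗ₜ[ℝ] rootElt ε) • m
  rw [smul_smul]
  congr 1
  simp

end underlying

variable (F : RealBundle (𝒜.adjoinRoot ε))

noncomputable instance (x : X) : Module (𝒜.fib x ⊗[ℝ] RootAlg ε) (F.fib x) := F.module x

instance (x : X) : Module.Finite (𝒜.fib x ⊗[ℝ] RootAlg ε) (F.fib x) := F.finite x

instance (x : X) : Module.Projective (𝒜.fib x ⊗[ℝ] RootAlg ε) (F.fib x) := F.projective x

/-- The underlying Real `𝒜`-bundle of a Real bundle over `𝒜 ⊗ ℝ[t]/(t² = ε)`. -/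
noncomputable def RealBundle.underlying : RealBundle 𝒜.toRealAlgBundle where
  fib := F.fib
  module x := restrictModule (𝒜.fib x) ε (F.fib x)
  finite x := by
    let _ := restrictModule (𝒜.fib x) ε (F.fib x)
    exact (finite_projective_restrict (smul_eq_rootLin fun _ _ => rfl)).1
  projective x := by
    let _ := restrictModule (𝒜.fib x) ε (F.fib x)
    exact (finite_projective_restrict (smul_eq_rootLin fun _ _ => rfl)).2
  top := F.top
  continuous_proj := F.continuous_proj
  locally_trivial x := by
    obtain ⟨P, _, _, _, _, U, hU, g, oU, xU, hg, tg⟩ := F.locally_trivial x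
    let _ := restrictModule A ε P
    refine ⟨P, inferInstance, restrictModule A ε P, inferInstance, ⟨?_⟩, U, hU, g, oU, xU,
      fun y a e => ?_, tg⟩
    · rw [moduleTopology_root (R := A) (ε := ε) (smul_eq_rootLin fun _ _ => rfl)]
      exact IsModuleTopology.eq_moduleTopology'
    · exact hg y (a ⊗ₜ[ℝ] (1 : RootAlg ε)) e
  continuous_smul := by
    let _ := F.top
    let _ := 𝒜.top
    let _ := 𝒜.tensorTop (RootAlg ε)
    let _ := fibProdTop (𝒜.tensorTop (RootAlg ε)) F.top
    let _ := fibProdTop 𝒜.top F.top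
    exact F.continuous_smul.comp (f := fun p : Tot fun x => 𝒜.fib x × F.fib x =>
      (⟨p.proj, (p.snd.1 ⊗ₜ[ℝ] (1 : RootAlg ε), p.snd.2)⟩ :
        Tot fun x => (𝒜.fib x ⊗[ℝ] RootAlg ε) × F.fib x))
      (continuous_toProd ((continuous_tmul_const 1).comp (continuous_left 𝒜.top F.top))
        (continuous_right 𝒜.top F.top))
  bar := F.bar
  bar_smul x a e := F.bar_smul x (a ⊗ₜ[ℝ] (1 : RootAlg ε)) e
  bar_bar := F.bar_bar
  continuous_bar := F.continuous_bar

/-- The action of `t` on the underlying Real `𝒜`-bundle. -/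
noncomputable def RealBundle.rootAct (x : X) : F.underlying.fib x →ₗ[𝒜.fib x] F.underlying.fib x :=
  let _ := restrictModule (𝒜.fib x) ε (F.fib x)
  rootLin (R := 𝒜.fib x) (M := F.fib x) (ε := ε) fun _ _ => rfl

theorem RealBundle.rootAct_rootAct (x : X) (e : F.underlying.fib x) :
    F.rootAct x (F.rootAct x e) = (ε • (1 : 𝒜.fib x)) • e := by
  let _ := restrictModule (𝒜.fib x) ε (F.fib x)
  exact root_smul_smul (smul_eq_rootLin fun (_ : 𝒜.fib x) (_ : F.fib x) => rfl) e

theorem RealBundle.mapContinuous_rootAct : MapContinuous fun x => F.rootAct x := by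
  let _ := F.top
  let _ := 𝒜.top
  let _ := 𝒜.tensorTop (RootAlg ε)
  let _ := fibProdTop (𝒜.tensorTop (RootAlg ε)) F.top
  have h1 : Continuous fun p : Tot F.fib =>
      (⟨p.proj, (1 : 𝒜.fib p.proj) ⊗ₜ[ℝ] rootElt ε⟩ : Tot fun x => 𝒜.fib x ⊗[ℝ] RootAlg ε) :=
    (continuous_tmul_const (rootElt ε)).comp (𝒜.continuous_one.comp F.continuous_proj)
  exact F.continuous_smul.comp (f := fun p : Tot F.fib =>
    (⟨p.proj, ((1 : 𝒜.fib p.proj) ⊗ₜ[ℝ] rootElt ε, p.snd)⟩ :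
      Tot fun x => (𝒜.fib x ⊗[ℝ] RootAlg ε) × F.fib x)) (continuous_toProd h1 continuous_id)

theorem RealBundle.rootAct_bar (x : X) (e : F.underlying.fib x) :
    F.rootAct (σ x) (F.underlying.bar x e) = F.underlying.bar x (F.rootAct x e) := by
  refine ((F.bar_smul x (𝒜.root ε x) e).trans ?_).symm
  congr 1
  change 𝒜.bar x 1 ⊗ₜ[ℝ] rootElt ε = 1 ⊗ₜ[ℝ] rootElt ε
  rw [map_one]

end Bundle

end

/-! ### Operators with square `±1` and metrics -/

section Fibre

variable {R M : Type*} [Ring R] [Algebra ℝ R] [StarRing R] [StarModule ℝ R] [PositiveCone R]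
  [AddCommGroup M] [Module R M] {B B' φ : M → M → R} {ε : ℝ} {J J' S T : M →ₗ[R] M}

theorem IsSesq.const_smul_left (hB : IsSesq B) (r : ℝ) (e e' : M) :
    B ((r • (1 : R)) • e) e' = r • B e e' := by
  rw [hB.smul_left, star_smul, star_one, star_trivial r, mul_smul_comm, mul_one]

theorem IsSesq.const_smul_right (hB : IsSesq B) (r : ℝ) (e e' : M) :
    B e ((r • (1 : R)) • e') = r • B e e' := by
  rw [hB.smul_right, smul_mul_assoc, one_mul]

theorem const_smul_const_smul (hε : ε * ε = 1) (e : M) :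
    (ε • (1 : R)) • (ε • (1 : R)) • e = e := by
  rw [smul_smul, smul_mul_smul_comm, hε, mul_one, one_smul, one_smul]

/-- An operator `J` with `J² = ε` as a linear equivalence. -/
noncomputable def rootEquiv (hε : ε * ε = 1) (hJ : ∀ e, J (J e) = (ε • (1 : R)) • e) : M ≃ₗ[R] M :=
  LinearEquiv.ofBijective J
    ⟨fun a b hab => by
      have h := congrArg J hab
      rw [hJ, hJ] at h
      rw [← const_smul_const_smul (R := R) hε a, h, const_smul_const_smul hε],
    fun b => ⟨(ε • (1 : R)) • J b, by rw [map_smul, hJ, const_smul_const_smul hε]⟩⟩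

/-- If `B(J e, e')` is `ε`-symmetric and `J² = ε`, then `J` preserves `B`. -/
theorem isometry_of_symm (hε : ε * ε = 1) (hB : IsMetric B)
    (hJ : ∀ e, J (J e) = (ε • (1 : R)) • e)
    (hs : ∀ e e', B (J e') e = ε • star (B (J e) e')) (e e' : M) : B (J e) (J e') = B e e' := by
  have h := hs e' (J e)
  rw [← hB.symm, hJ, hB.const_smul_left] at h
  have h2 := congrArg (ε • ·) h
  simpa only [smul_smul, hε, one_smul] using h2.symm

/-- If `J² = ε` and `J` preserves `B`, then `B(J e, e')` is `ε`-symmetric. -/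
theorem symm_of_isometry (hε : ε * ε = 1) (hB : IsMetric B)
    (hJ : ∀ e, J (J e) = (ε • (1 : R)) • e) (hi : ∀ e e', B (J e) (J e') = B e e') (e e' : M) :
    B (J e') e = ε • star (B (J e) e') := by
  rw [← hB.symm, ← hi e', hJ, hB.const_smul_right, smul_smul, hε, one_smul, hB.symm]

/-- The square root of a metric with respect to another one commutes with the operators that
preserve both of them. -/
theorem IsSqrt.comm_of_isometry (hε : ε * ε = 1) (hB : IsMetric B) (hB' : IsMetric B')
    (hS : IsSqrt B B' S) (hJ : ∀ e, J (J e) = (ε • (1 : R)) • e)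
    (hi : ∀ e e', B (J e) (J e') = B e e') (hi' : ∀ e e', B' (J e) (J e') = B' e e') (e : M) :
    J (S e) = S (J e) := by
  let j := rootEquiv hε hJ
  have hj : ∀ e, J (j.symm e) = e := j.apply_symm_apply
  have hiso : ∀ e e', B (j.symm e) e' = B e (J e') := fun e e' => by rw [← hi, hj]
  have hK : IsPosSqrt B B' (j.symm.toLinearMap ∘ₗ S ∘ₗ J) :=
    { selfAdj := fun e e' => by
        change B (j.symm (S (J e))) e' = B e (j.symm (S (J e')))
        rw [hiso, hS.selfAdj, ← hi e, hj]
      pos := fun e => by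
        change IsPos (B (j.symm (S (J e))) e)
        rw [hiso]
        exact hS.pos _
      sq := fun e e' => by
        change B (j.symm (S (J e))) (j.symm (S (J e'))) = _
        rw [hiso, hj, hS.sq, hi'] }
  have h := LinearMap.congr_fun (hS.unique hB hB' hK) e
  rw [h]
  exact hj _

/-- If the same form is written as `B(J e, e')` and as `B'(J' e, e')`, with operators `J` and `J'`
of square `ε`, of which `J` preserves `B`, then the square root `S` of `B'` with respect to `B`
intertwines `J'` and `J`. Indeed `J = S² J'`, and `J S⁻¹ J⁻¹` is again a square root of `B'`, hence
equal to `S`. -/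
theorem IsSqrt.intertwines (hε : ε * ε = 1) (hB : IsMetric B) (hB' : IsMetric B')
    (hS : IsSqrt B B' S) (hJ : ∀ e, J (J e) = (ε • (1 : R)) • e)
    (hJ' : ∀ e, J' (J' e) = (ε • (1 : R)) • e)
    (hi : ∀ e e', B (J e) (J e') = B e e')
    (h : ∀ e e', B (J e) e' = B' (J' e) e') (e : M) : S (J' e) = J (S e) := by
  let j := rootEquiv hε hJ
  let s : M ≃ₗ[R] M := LinearEquiv.ofBijective S (hS.bijective hB hB')
  have hj : ∀ e, J (j.symm e) = e := j.apply_symm_apply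
  have hs : ∀ e, S (s.symm e) = e := s.apply_symm_apply
  have hiso : ∀ e e', B (J e) e' = B e (j.symm e') := fun e e' => by rw [← hi e, hj]
  have hself : ∀ e e', B (s.symm e) e' = B e (s.symm e') := fun e e' => by
    conv_lhs => rw [← hs e']
    rw [← hS.selfAdj, hs]
  have h2 : ∀ e, J e = S (S (J' e)) := fun e => hB.ext fun e' => by
    rw [hS.selfAdj, hS.sq, h]
  have hjJ : ∀ a, j.symm (J a) = a := j.symm_apply_apply
  have hsS : ∀ a, s.symm (S a) = a := s.symm_apply_apply
  have h4 : ∀ a, S (S (J a)) = J (s.symm (s.symm a)) := fun a => by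
    have h5 := congrArg (fun e => (ε • (1 : R)) • S (S e)) (hJ' (J a))
    simp only [map_smul, const_smul_const_smul hε, ← h2] at h5
    rw [← h5, ← hsS (J' _), ← hsS (S (J' _)), ← h2, hJ, map_smul, map_smul, map_smul,
      const_smul_const_smul hε]
  have hK : IsPosSqrt B B' (J ∘ₗ s.symm.toLinearMap ∘ₗ j.symm.toLinearMap) :=
    { selfAdj := fun e e' => by
        change B (J (s.symm (j.symm e))) e' = B e (J (s.symm (j.symm e')))
        rw [hiso, hself]
        conv_rhs => rw [← hj e, hi]
      pos := fun e => by
        change IsPos (B (J (s.symm (j.symm e))) e)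
        have h5 := hS.pos (s.symm (j.symm e))
        rwa [hs, ← hself, ← hi, hj] at h5
      sq := fun e e' => by
        change B (J (s.symm (j.symm e))) (J (s.symm (j.symm e'))) = _
        obtain ⟨a, rfl⟩ : ∃ a, J a = e := ⟨_, hj e⟩
        obtain ⟨b, rfl⟩ : ∃ b, J b = e' := ⟨_, hj e'⟩
        rw [hjJ, hjJ, hi, ← hself, ← hi, ← h4, hS.selfAdj, hS.sq] }
  have h3 : S (J (S e)) = J (s.symm (j.symm (J (S e)))) :=
    LinearMap.congr_fun (hS.unique hB hB' hK) (J (S e))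
  rw [hjJ, hsS, h2 e] at h3
  exact (s.injective h3).symm

/-- The polar decomposition of a form `φ(e, e') = B(T e, e')`, where `S` is the square root of
`T*T = ε T²`: the operator `J = T S⁻¹` has square `ε`, and commutes with `S`. -/
theorem IsSqrt.polar (hε : ε * ε = 1) (hB : IsMetric B)
    (hs : ∀ e e', B (T e') e = ε • star (B (T e) e'))
    (hS : IsSqrt B (fun e e' => B (T e) (T e')) S) :
    (∀ e, T (T e) = (ε • (1 : R)) • S (S e)) ∧ ∀ e, T (S e) = S (T e) := by
  have h1 : ∀ e, T (T e) = (ε • (1 : R)) • S (S e) := fun e => hB.ext fun e' => by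
    have h2 := hs e' (T e)
    rw [← hB.symm] at h2
    rw [hB.const_smul_left, hS.selfAdj, hS.sq, h2]
  refine ⟨h1, hS.comm T fun e => ?_⟩
  have h3 : ∀ e, S (S e) = (ε • (1 : R)) • T (T e) := fun e => by
    rw [h1, const_smul_const_smul hε]
  rw [h3, h3, map_smul]

end Fibre

section Bundle

variable {X : Type v} [TopologicalSpace X] {σ : Involution X}
  {A : Type u} [NormedRing A] [NormedAlgebra ℝ A] [CompleteSpace A] [StarRing A]
  [StarModule ℝ A] [RealCStar A] {𝒜 : RealStarAlgBundle σ A} {ε : ℝ}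
  {E F : RealBundle 𝒜.toRealAlgBundle}

/-! ### Forms on Real bundles -/

theorem Form.isSesq (φ : Form 𝒜 ε E) (x : X) : IsSesq fun e e' => φ.toDual x e e' where
  add_left e₁ e₂ e' := by rw [map_add, StarDual.add_apply]
  add_right e e₁ e₂ := map_add _ _ _
  smul_left a e e' := by rw [map_smul, StarDual.smul_apply]
  smul_right a e e' := map_smul _ _ _

theorem Form.ext_left (φ : Form 𝒜 ε E) {x : X} {e₁ e₂ : E.fib x}
    (h : ∀ e', φ.toDual x e₁ e' = φ.toDual x e₂ e') : e₁ = e₂ :=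
  (φ.toDual x).injective (StarDual.ext h)

theorem Form.isMetric {ψ : Form 𝒜 1 E} (hψ : ψ.IsMetric) (x : X) :
    TwistedK.IsMetric fun e e' => ψ.toDual x e e' where
  toIsSesq := ψ.isSesq x
  symm e e' := by rw [ψ.symm, one_smul]
  pos := hψ x
  inj e he := ψ.ext_left fun e' => by rw [he, map_zero]; rfl
  surj l := by
    obtain ⟨f, hf⟩ := (ψ.toDual x).surjective (show StarDual _ _ from l)
    exact ⟨f, fun e => congrArg (fun g : StarDual (𝒜.fib x) (E.fib x) => g e) hf⟩

/-- A form given by a continuous invariant family of `ε`-symmetric bijective pairings. -/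
noncomputable def Form.ofBijective {B : ∀ x, E.fib x → E.fib x → 𝒜.fib x}
    (hB : ∀ x, IsSesq (B x)) (inj : ∀ x e, (∀ e', B x e e' = 0) → e = 0)
    (surj : ∀ x (l : E.fib x →ₗ[𝒜.fib x] 𝒜.fib x), ∃ f, ∀ e, B x f e = l e)
    (symm : ∀ x e e', B x e' e = ε • star (B x e e')) (hBb : BarInvariant B)
    (hBc : FormContinuous B) : Form 𝒜 ε E where
  toDual x := LinearEquiv.ofBijective
    ({ toFun := fun e => (hB x).toLinearMap e
       map_add' := fun e₁ e₂ => StarDual.ext fun e' => (hB x).add_left e₁ e₂ e'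
       map_smul' := fun a e => StarDual.ext fun e' => (hB x).smul_left a e e' } :
      E.fib x →ₗ[𝒜.fib x] StarDual (𝒜.fib x) (E.fib x))
    ⟨(injective_iff_map_eq_zero _).2 fun e he => inj x e fun e' =>
      congrArg (fun g : StarDual (𝒜.fib x) (E.fib x) => g e') he,
    fun l => by
      obtain ⟨f, hf⟩ := surj x l
      exact ⟨f, StarDual.ext hf⟩⟩
  symm := symm
  map_bar := hBb
  continuous := hBc

/-- The form of a continuous invariant family of metrics. -/
noncomputable def Form.ofMetric {B : ∀ x, E.fib x → E.fib x → 𝒜.fib x}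
    (hB : ∀ x, TwistedK.IsMetric (B x))
    (hBb : BarInvariant B) (hBc : FormContinuous B) : Form 𝒜 1 E :=
  Form.ofBijective (fun x => (hB x).toIsSesq) (fun x => (hB x).inj) (fun x => (hB x).surj)
    (fun x e e' => by rw [one_smul, (hB x).symm]) hBb hBc

theorem Form.isMetric_ofMetric {B : ∀ x, E.fib x → E.fib x → 𝒜.fib x}
    (hB : ∀ x, TwistedK.IsMetric (B x))
    (hBb : BarInvariant B) (hBc : FormContinuous B) : (Form.ofMetric hB hBb hBc).IsMetric :=
  fun x e => (hB x).pos e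

/-! ### Continuous isomorphisms -/

theorem MapContinuous.comp {G : RealBundle 𝒜.toRealAlgBundle} {S : ∀ x, F.fib x → G.fib x}
    {T : ∀ x, E.fib x → F.fib x} (hS : MapContinuous S) (hT : MapContinuous T) :
    MapContinuous fun x e => S x (T x e) :=
  @Continuous.comp _ _ _ E.top F.top G.top _ _ hS hT

/-- The inverse of a continuous family of isomorphisms is continuous: with respect to the metrics
`B(S e, S e')` it is represented by the continuous family of forms `B(e, S e')`. -/
theorem mapContinuous_symm {B : ∀ x, E.fib x → E.fib x → 𝒜.fib x} (hB : ∀ x, IsMetric (B x))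
    (hBc : FormContinuous B) {S : ∀ x, E.fib x ≃ₗ[𝒜.fib x] E.fib x}
    (hS : MapContinuous fun x => S x) : MapContinuous fun x => (S x).symm :=
  mapContinuous_of_form (B := fun x e e' => B x (S x e) (S x e'))
    (C := fun x e e' => B x e (S x e')) (T := fun x => (S x).symm.toLinearMap)
    (fun x => (hB x).comp (S x)) (hBc.comp hS hS) (hBc.comp mapContinuous_id hS)
    fun x e e' => by simp

end Bundle

section

variable {X : Type v} [TopologicalSpace X] {σ : Involution X}
  {A : Type u} [NormedRing A] [NormedAlgebra ℝ A] [CompleteSpace A] [StarRing A]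
  [StarModule ℝ A] [RealCStar A] {𝒜 : RealStarAlgBundle σ A} {ε : ℝ}

/-! ### The correspondence between forms and Real bundles over `𝒜 ⊗ ℝ[t]/(t² = ε)` -/

section Represents

variable {E : RealBundle 𝒜.toRealAlgBundle} {F F' : RealBundle (𝒜.adjoinRoot ε)}

/-- The operator on `E` that corresponds, under an isomorphism of `E` with the underlying Real
`𝒜`-bundle of `F`, to the action of `t` on `F`. -/
noncomputable def RealBundle.Iso.root (i : RealBundle.Iso E F.underlying) (x : X) :
    E.fib x →ₗ[𝒜.fib x] E.fib x :=
  (i.toEquiv x).symm.toLinearMap ∘ₗ F.rootAct x ∘ₗ (i.toEquiv x).toLinearMap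

namespace RealBundle.Iso

variable (i : RealBundle.Iso E F.underlying)

theorem root_apply (x : X) (e : E.fib x) :
    i.root x e = (i.toEquiv x).symm (F.rootAct x (i.toEquiv x e)) := rfl

theorem toEquiv_root (x : X) (e : E.fib x) :
    i.toEquiv x (i.root x e) = F.rootAct x (i.toEquiv x e) :=
  (i.toEquiv x).apply_symm_apply _

theorem root_root (x : X) (e : E.fib x) : i.root x (i.root x e) = (ε • (1 : 𝒜.fib x)) • e := by
  rw [root_apply, toEquiv_root, F.rootAct_rootAct, map_smul, LinearEquiv.symm_apply_apply]

end RealBundle.Iso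

/-- `Represents` in terms of the isomorphism `E ≅ F.underlying` of Real `𝒜`-bundles and of the
operator on `E` that corresponds to `t`. -/
theorem represents_iff {E : FormBundle 𝒜 ε} :
    Represents E F ↔ ∃ (i : RealBundle.Iso E.bundle F.underlying) (ψ : Form 𝒜 1 E.bundle),
      ψ.IsMetric ∧ ∀ x e e', E.form.toDual x e e' = ψ.toDual x (i.root x e) e' := by
  constructor
  · rintro ⟨u, hu, hub, huc, huc', ψ, hψ, h⟩
    refine ⟨⟨fun x =>
      ({ u x with map_smul' := hu x } : E.bundle.fib x ≃ₗ[𝒜.fib x] F.underlying.fib x),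
      huc, huc', hub⟩, ψ, hψ, h⟩
  · rintro ⟨i, ψ, hψ, h⟩
    exact ⟨fun x => (i.toEquiv x).toAddEquiv, fun x => map_smul (i.toEquiv x), i.map_bar,
      i.continuous_toFun, i.continuous_invFun, ψ, hψ, h⟩

/-- An isomorphism of the underlying Real `𝒜`-bundles that commutes with `t` is an isomorphism of
Real bundles over `𝒜 ⊗ ℝ[t]/(t² = ε)`. -/
noncomputable def RealBundle.Iso.ofUnderlying (i : RealBundle.Iso F.underlying F'.underlying)
    (h : ∀ x e, i.toEquiv x (F.rootAct x e) = F'.rootAct x (i.toEquiv x e)) :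
    RealBundle.Iso F F' where
  toEquiv x :=
    ({ (i.toEquiv x).toAddEquiv with
        map_smul' := fun (z : 𝒜.fib x ⊗[ℝ] RootAlg ε) (e : F.fib x) => by
          let _ := restrictModule (𝒜.fib x) ε (F.fib x)
          let _ := restrictModule (𝒜.fib x) ε (F'.fib x)
          have h1 : z • e = re z • e + im z • (show F.fib x from F.rootAct x e) :=
            smul_eq_rootLin (fun _ _ => rfl) z e
          have h2 : ∀ f : F'.fib x, z • f = re z • f + im z • (show F'.fib x from F'.rootAct x f) :=
            smul_eq_rootLin (fun _ _ => rfl) z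
          change i.toEquiv x (z • e) = z • (show F'.fib x from i.toEquiv x e)
          rw [h1, h2]
          refine (map_add (i.toEquiv x) _ _).trans ?_
          refine congrArg₂ (· + ·) (map_smul (i.toEquiv x) _ _) ?_
          refine (map_smul (i.toEquiv x) _ _).trans ?_
          exact congrArg _ (h x e) } : F.fib x ≃ₗ[𝒜.fib x ⊗[ℝ] RootAlg ε] F'.fib x)
  continuous_toFun := i.continuous_toFun
  continuous_invFun := i.continuous_invFun
  map_bar := i.map_bar

/-- A continuous family of automorphisms that commutes with the involutions is an automorphism of
the Real bundle. -/
noncomputable def RealBundle.Iso.ofMap {B : ∀ x, E.fib x → E.fib x → 𝒜.fib x}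
    (hB : ∀ x, IsMetric (B x)) (hBc : FormContinuous B) (S : ∀ x, E.fib x ≃ₗ[𝒜.fib x] E.fib x)
    (hS : MapContinuous fun x => S x) (hSb : ∀ x e, S (σ x) (E.bar x e) = E.bar x (S x e)) :
    RealBundle.Iso E E where
  toEquiv := S
  continuous_toFun := hS
  continuous_invFun := mapContinuous_symm hB hBc hS
  map_bar := hSb

theorem RealBundle.bar_surjective (E : RealBundle 𝒜.toRealAlgBundle) (x : X) :
    Function.Surjective (E.bar x) :=
  (bijective_bar (fun x => E.bar x) E.bar_bar x).2

/-- Polar decomposition: every `ε`-symmetric form `φ` can be written as `φ(e, e') = ψ(J e, e')` with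
a metric `ψ` and an operator `J` with `J² = ε`. If `φ(e, e') = B(T e, e')` for some metric `B`, and
`S` is the square root of `T*T`, these are `ψ(e, e') = B(S e, e')` and `J = T S⁻¹`. -/
theorem Form.exists_polar [T2Space X] [ParacompactSpace X] (hε : ε * ε = 1) (φ : Form 𝒜 ε E) :
    ∃ (J : ∀ x, E.fib x →ₗ[𝒜.fib x] E.fib x) (ψ : Form 𝒜 1 E), ψ.IsMetric ∧
      (∀ x e, J x (J x e) = (ε • (1 : 𝒜.fib x)) • e) ∧ (MapContinuous fun x => J x) ∧
      (∀ x e, J (σ x) (E.bar x e) = E.bar x (J x e)) ∧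
      ∀ x e e', φ.toDual x e e' = ψ.toDual x (J x e) e' := by
  obtain ⟨B, hB, hBc, hBb⟩ := exists_isMetric_invariant E
  choose T hT using fun x => (hB x).exists_repr (φ.isSesq x)
  have hTc : MapContinuous fun x => T x :=
    mapContinuous_of_form (C := fun x e e' => φ.toDual x e e') hB hBc φ.continuous hT
  have hTb : ∀ x e, T (σ x) (E.bar x e) = E.bar x (T x e) := fun x e =>
    (hB (σ x)).ext fun e' => by
      obtain ⟨f, rfl⟩ := E.bar_surjective x e'
      rw [hT, φ.map_bar, hBb, hT]
  have hTbij : ∀ x, Function.Bijective (T x) := fun x => by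
    refine ⟨fun e₁ e₂ h => φ.ext_left fun e' => by rw [← hT, ← hT, h], fun v => ?_⟩
    obtain ⟨e, he⟩ := (φ.toDual x).surjective
      (show StarDual (𝒜.fib x) (E.fib x) from (hB x).toLinearMap v)
    refine ⟨e, (hB x).ext fun e' => ?_⟩
    rw [hT, he]
    rfl
  let B' : ∀ x, E.fib x → E.fib x → 𝒜.fib x := fun x e e' => B x (T x e) (T x e')
  have hB' : ∀ x, TwistedK.IsMetric (B' x) := fun x =>
    (hB x).comp (LinearEquiv.ofBijective _ (hTbij x))
  have hBc' : FormContinuous B' := hBc.comp hTc hTc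
  have hBb' : BarInvariant B' := fun x e e' => by
    change B _ (T _ _) (T _ _) = _
    rw [hTb, hTb, hBb]
  obtain ⟨S, hS, hSc⟩ := exists_isSqrt_bundle hB hB' hBc hBc'
  have hSb := isSqrt_bar hB hB' hBb hBb' hS
  have hpol := fun x => (hS x).polar hε (hB x) (T := T x) fun e e' => by
    rw [hT, hT, φ.symm x e e']
  let s : ∀ x, E.fib x ≃ₗ[𝒜.fib x] E.fib x := fun x =>
    LinearEquiv.ofBijective (S x) ((hS x).bijective (hB x) (hB' x))
  have hs : ∀ x e, S x ((s x).symm e) = e := fun x => (s x).apply_symm_apply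
  have hs' : ∀ x e, (s x).symm (S x e) = e := fun x => (s x).symm_apply_apply
  have hsc : MapContinuous fun x => (s x).symm := mapContinuous_symm hB hBc hSc
  have hTs : ∀ x e, T x ((s x).symm e) = (s x).symm (T x e) := fun x e =>
    (s x).injective <| by
      change S x _ = S x _
      rw [hs, ← (hpol x).2, hs]
  refine ⟨fun x => T x ∘ₗ (s x).symm.toLinearMap,
    Form.ofMetric (fun x => (hS x).isMetric (hB x) (hB' x)) (fun x e e' => ?_)
      (hBc.comp hSc mapContinuous_id), Form.isMetric_ofMetric _ _ _, fun x e => ?_,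
      hTc.comp hsc, fun x e => ?_, fun x e e' => ?_⟩
  · rw [hSb, hBb]
  · change T x ((s x).symm (T x ((s x).symm e))) = _
    rw [← hTs, (hpol x).1, hs, hs]
  · change T _ ((s _).symm _) = E.bar x (T x ((s x).symm e))
    rw [← hTb]
    congr 1
    apply (s (σ x)).injective
    change S _ _ = S _ _
    rw [hs, hSb, hs]
  · change _ = B x (S x (T x ((s x).symm e))) e'
    rw [← (hpol x).2, hs, hT]

/-- Every form is represented. -/
theorem exists_represents_left [T2Space X] [ParacompactSpace X] (hε : ε * ε = 1)
    (E : FormBundle 𝒜 ε) : ∃ F, Represents E F := by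
  obtain ⟨J, ψ, hψ, hJ, hJc, hJb, h⟩ := E.form.exists_polar hε
  refine ⟨E.bundle.ofRoot hε J hJ hJc hJb, fun x => AddEquiv.refl _, fun x a e => ?_,
    fun x e => rfl, @continuous_id _ E.bundle.top, @continuous_id _ E.bundle.top, ψ, hψ,
    fun x e e' => ?_⟩
  · exact (E.bundle.inclRoot_smul_ofRoot hε hJ hJc hJb x a e).symm
  · rw [h]
    congr 2
    exact (E.bundle.root_smul_ofRoot hε hJ hJc hJb x e).symm

/-- Every Real bundle over `𝒜 ⊗ ℝ[t]/(t² = ε)` represents a form: the sum of a metric `B` and of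
`B(t e, t e')` is a metric preserved by `t`. -/
theorem exists_represents_right [T2Space X] [ParacompactSpace X] (hε : ε * ε = 1)
    (F : RealBundle (𝒜.adjoinRoot ε)) : ∃ E, Represents E F := by
  obtain ⟨B, hB, hBc, hBb⟩ := exists_isMetric_invariant F.underlying
  let J := F.rootAct
  have hJ : ∀ x e, J x (J x e) = (ε • (1 : 𝒜.fib x)) • e := F.rootAct_rootAct
  let C : ∀ x, F.underlying.fib x → F.underlying.fib x → 𝒜.fib x := fun x e e' =>
    B x e e' + B x (J x e) (J x e')
  have hC : ∀ x, IsMetric (C x) := fun x =>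
    isMetric_add_fib (hB x) ((hB x).toIsPosForm.comp (J x))
  have hCc : FormContinuous C :=
    formContinuous_add hBc (hBc.comp F.mapContinuous_rootAct F.mapContinuous_rootAct)
  have hCb : BarInvariant C := fun x e e' => by
    change B _ _ _ + B _ (F.rootAct _ _) (F.rootAct _ _) = 𝒜.bar x (B x e e' + B x (J x e) (J x e'))
    rw [F.rootAct_bar, F.rootAct_bar, hBb, hBb, map_add]
  have hi : ∀ x e e', C x (J x e) (J x e') = C x e e' := fun x e e' => by
    change B x (J x e) (J x e') + B x (J x (J x e)) (J x (J x e')) = B x e e' + B x (J x e) (J x e')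
    rw [hJ, hJ, (hB x).const_smul_left, (hB x).const_smul_right, smul_smul, hε, one_smul, add_comm]
  let j := fun x => rootEquiv hε (hJ x)
  let φ : Form 𝒜 ε F.underlying := Form.ofBijective (B := fun x e e' => C x (J x e) e')
    (fun x => (hC x).toIsSesq.comp (J x) LinearMap.id)
    (fun x e he => (j x).map_eq_zero_iff.1 ((hC x).inj _ he))
    (fun x l => by
      obtain ⟨f, hf⟩ := (hC x).surj l
      refine ⟨(j x).symm f, fun e => ?_⟩
      have : J x ((j x).symm f) = f := (j x).apply_symm_apply f
      rw [this, hf])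
    (fun x e e' => symm_of_isometry hε (hC x) (hJ x) (hi x) e e')
    (fun x e e' => by
      change C _ (F.rootAct _ _) _ = _
      rw [F.rootAct_bar, hCb])
    (hCc.comp F.mapContinuous_rootAct mapContinuous_id)
  exact ⟨⟨F.underlying, φ⟩, represents_iff.2 ⟨RealBundle.Iso.refl _, Form.ofMetric hC hCb hCc,
    Form.isMetric_ofMetric _ _ _, fun x e e' => rfl⟩⟩

end Represents

end

section

/-! ### Grothendieck groups -/

section Grothendieck

open Algebra

variable {M N : Type*} [AddCommMonoid M] [AddCommMonoid N]

theorem grothendieck_lift_of {G : Type*} [AddCommGroup G] (f : M →+ G) (m : M) :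
    GrothendieckAddGroup.lift f (GrothendieckAddGroup.of m) = f m :=
  DFunLike.congr_fun (GrothendieckAddGroup.lift.symm_apply_apply f) m

theorem grothendieck_hom_ext {G : Type*} [AddCommGroup G] {f g : GrothendieckAddGroup M →+ G}
    (h : ∀ m, f (GrothendieckAddGroup.of m) = g (GrothendieckAddGroup.of m)) : f = g :=
  GrothendieckAddGroup.lift.symm.injective (AddMonoidHom.ext h)

/-- The isomorphism of Grothendieck groups induced by an isomorphism of monoids. -/
noncomputable def grothendieckCongr (f : M ≃+ N) :
    GrothendieckAddGroup M ≃+ GrothendieckAddGroup N :=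
  AddMonoidHom.toAddEquiv
    (GrothendieckAddGroup.lift (GrothendieckAddGroup.of.comp f.toAddMonoidHom))
    (GrothendieckAddGroup.lift (GrothendieckAddGroup.of.comp f.symm.toAddMonoidHom))
    (grothendieck_hom_ext fun m => by
      rw [AddMonoidHom.comp_apply, grothendieck_lift_of, AddMonoidHom.comp_apply,
        grothendieck_lift_of]
      exact congrArg GrothendieckAddGroup.of (f.symm_apply_apply m))
    (grothendieck_hom_ext fun m => by
      rw [AddMonoidHom.comp_apply, grothendieck_lift_of, AddMonoidHom.comp_apply,
        grothendieck_lift_of]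
      exact congrArg GrothendieckAddGroup.of (f.apply_symm_apply m))

theorem grothendieckCongr_of (f : M ≃+ N) (m : M) :
    grothendieckCongr f (GrothendieckAddGroup.of m) = GrothendieckAddGroup.of (f m) :=
  grothendieck_lift_of (GrothendieckAddGroup.of.comp f.toAddMonoidHom) m

end Grothendieck

variable {X : Type v} [TopologicalSpace X] {σ : Involution X}
  {A : Type u} [NormedRing A] [NormedAlgebra ℝ A] [CompleteSpace A] [StarRing A]
  [StarModule ℝ A] [RealCStar A] {𝒜 : RealStarAlgBundle σ A} {ε : ℝ}

/-! ### Uniqueness and additivity of the correspondence -/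

section Unique

variable {E E' : FormBundle 𝒜 ε} {F F' : RealBundle (𝒜.adjoinRoot ε)}

/-- In the situation of `represents_iff`, the operator preserves the metric. -/
theorem RealBundle.Iso.isometry_root (hε : ε * ε = 1) (i : RealBundle.Iso E.bundle F.underlying)
    {ψ : Form 𝒜 1 E.bundle} (hψ : ψ.IsMetric)
    (h : ∀ x e e', E.form.toDual x e e' = ψ.toDual x (i.root x e) e') (x : X)
    (e e' : E.bundle.fib x) :
    ψ.toDual x (i.root x e) (i.root x e') = ψ.toDual x e e' :=
  isometry_of_symm hε (Form.isMetric hψ x) (i.root_root x)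
    (fun e e' => by rw [← h, ← h, E.form.symm]) e e'

/-- The Real bundle that represents a form is unique up to isomorphism: if `φ(e, e')` is both
`ψ(J e, e')` and `ψ'(J' e, e')`, then the square root of `ψ'` with respect to `ψ` is an
automorphism that carries `J'` to `J`. -/
theorem Represents.unique_right (hε : ε * ε = 1) (h : Represents E F) (h' : Represents E F') :
    Nonempty (RealBundle.Iso F F') := by
  obtain ⟨i, ψ, hψ, hi⟩ := represents_iff.1 h
  obtain ⟨i', ψ', hψ', hi'⟩ := represents_iff.1 h'
  have hB := Form.isMetric hψ
  have hB' := Form.isMetric hψ'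
  obtain ⟨S, hS, hSc⟩ := exists_isSqrt_bundle hB hB' ψ.continuous ψ'.continuous
  have hSb := isSqrt_bar hB hB' ψ.map_bar ψ'.map_bar hS
  have hSJ : ∀ x e, S x (i'.root x e) = i.root x (S x e) := fun x =>
    (hS x).intertwines hε (hB x) (hB' x) (i.root_root x) (i'.root_root x)
      (i.isometry_root hε hψ hi x) fun e e' => by rw [← hi, ← hi']
  let s : RealBundle.Iso E.bundle E.bundle := RealBundle.Iso.ofMap hB ψ.continuous
    (fun x => LinearEquiv.ofBijective (S x) ((hS x).bijective (hB x) (hB' x))) hSc hSb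
  refine ⟨(RealBundle.Iso.ofUnderlying ((i'.symm.trans s).trans i) fun x e => ?_).symm⟩
  obtain ⟨f, rfl⟩ := (i'.toEquiv x).surjective e
  change i.toEquiv x (S x ((i'.toEquiv x).symm _)) = F.rootAct x (i.toEquiv x (S x
    ((i'.toEquiv x).symm _)))
  rw [LinearEquiv.symm_apply_apply, ← i'.root_apply, hSJ, i.toEquiv_root]

/-- The form represented by a Real bundle is unique up to isometry: `t` preserves both metrics
`ψ` and `ψ'`, so that the square root of `ψ'` with respect to `ψ` commutes with `t`, and pulls the
form `ψ(t e, e')` back to `ψ'(t e, e')`. -/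
theorem Represents.unique_left (hε : ε * ε = 1) (h : Represents E F) (h' : Represents E' F) :
    Nonempty (FormBundle.Iso E E') := by
  obtain ⟨i, ψ, hψ, hi⟩ := represents_iff.1 h
  obtain ⟨i', ψ', hψ', hi'⟩ := represents_iff.1 h'
  let w : RealBundle.Iso E.bundle E'.bundle := i.trans i'.symm
  have hw : ∀ x e, w.toEquiv x (i.root x e) = i'.root x (w.toEquiv x e) := fun x e => by
    change (i'.toEquiv x).symm (i.toEquiv x _) = (i'.toEquiv x).symm (F.rootAct x (i'.toEquiv x
      ((i'.toEquiv x).symm (i.toEquiv x e))))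
    rw [i.toEquiv_root, LinearEquiv.apply_symm_apply]
  have hB := Form.isMetric hψ
  let B' : ∀ x, E.bundle.fib x → E.bundle.fib x → 𝒜.fib x := fun x e e' =>
    ψ'.toDual x (w.toEquiv x e) (w.toEquiv x e')
  have hB' : ∀ x, IsMetric (B' x) := fun x => (Form.isMetric hψ' x).comp (w.toEquiv x)
  have hBc' : FormContinuous B' :=
    FormContinuous.comp (B := fun x e e' => ψ'.toDual x e e') ψ'.continuous
      (T := fun x => w.toEquiv x) (T' := fun x => w.toEquiv x) w.continuous_toFun w.continuous_toFun
  have hBb' : BarInvariant B' := fun x e e' => by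
    change ψ'.toDual _ (w.toEquiv _ _) (w.toEquiv _ _) = _
    rw [w.map_bar, w.map_bar, ψ'.map_bar]
  have hi₂ : ∀ x e e', B' x (i.root x e) (i.root x e') = B' x e e' := fun x e e' => by
    change ψ'.toDual x (w.toEquiv x _) (w.toEquiv x _) = _
    rw [hw, hw, i'.isometry_root hε hψ' hi']
  obtain ⟨S, hS, hSc⟩ := exists_isSqrt_bundle hB hB' ψ.continuous hBc'
  have hSb := isSqrt_bar hB hB' ψ.map_bar hBb' hS
  have hSJ : ∀ x e, i.root x (S x e) = S x (i.root x e) := fun x =>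
    (hS x).comm_of_isometry hε (hB x) (hB' x) (i.root_root x) (i.isometry_root hε hψ hi x) (hi₂ x)
  let s : RealBundle.Iso E.bundle E.bundle := RealBundle.Iso.ofMap hB ψ.continuous
    (fun x => LinearEquiv.ofBijective (S x) ((hS x).bijective (hB x) (hB' x))) hSc hSb
  refine ⟨⟨s.symm.trans w, fun x e e' => ?_⟩⟩
  obtain ⟨f, rfl⟩ := (s.toEquiv x).surjective e
  obtain ⟨f', rfl⟩ := (s.toEquiv x).surjective e'
  change E'.form.toDual x (w.toEquiv x ((s.toEquiv x).symm (s.toEquiv x f)))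
    (w.toEquiv x ((s.toEquiv x).symm (s.toEquiv x f'))) = E.form.toDual x (S x f) (S x f')
  rw [LinearEquiv.symm_apply_apply, LinearEquiv.symm_apply_apply, hi', ← hw, hi, hSJ]
  exact ((hS x).sq _ _).symm

theorem Represents.of_iso_left (h : Represents E F) (i : FormBundle.Iso E' E) :
    Represents E' F := by
  obtain ⟨j, ψ, hψ, hj⟩ := represents_iff.1 h
  have hB : ∀ x, IsMetric fun e e' : E'.bundle.fib x =>
      ψ.toDual x (i.iso.toEquiv x e) (i.iso.toEquiv x e') :=
    fun x => (Form.isMetric hψ x).comp (i.iso.toEquiv x)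
  refine represents_iff.2 ⟨i.iso.trans j, Form.ofMetric hB (fun x e e' => ?_)
    (FormContinuous.comp (B := fun x e e' => ψ.toDual x e e') ψ.continuous
      (T := fun x => i.iso.toEquiv x) (T' := fun x => i.iso.toEquiv x)
      i.iso.continuous_toFun i.iso.continuous_toFun), Form.isMetric_ofMetric _ _ _,
    fun x e e' => ?_⟩
  · rw [i.iso.map_bar, i.iso.map_bar, ψ.map_bar]
  · change _ = ψ.toDual x (i.iso.toEquiv x ((i.iso.toEquiv x).symm ((j.toEquiv x).symm
      (F.rootAct x (j.toEquiv x (i.iso.toEquiv x e)))))) (i.iso.toEquiv x e')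
    rw [← i.isometry, hj, LinearEquiv.apply_symm_apply]
    rfl

theorem Represents.of_iso_right (h : Represents E F) (i : RealBundle.Iso F F') :
    Represents E F' := by
  obtain ⟨u, hu, hub, huc, huc', ψ, hψ, h⟩ := h
  let _ := E.bundle.top
  let _ := F.top
  let _ := F'.top
  refine ⟨fun x => (u x).trans (i.toEquiv x).toAddEquiv, fun x a e => ?_, fun x e => ?_,
    i.continuous_toFun.comp huc, huc'.comp i.continuous_invFun, ψ, hψ, fun x e e' => ?_⟩
  · change i.toEquiv x (u x (a • e)) = _ • i.toEquiv x (u x e)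
    rw [hu, map_smul]
  · change i.toEquiv _ (u _ _) = F'.bar x (i.toEquiv x (u x e))
    rw [hub, i.map_bar]
  · change _ = ψ.toDual x ((u x).symm ((i.toEquiv x).symm (𝒜.root ε x • i.toEquiv x (u x e)))) e'
    rw [← map_smul, LinearEquiv.symm_apply_apply, h]

theorem Represents.sum (h : Represents E F) (h' : Represents E' F') :
    Represents (E.sum E') (F.sum F') := by
  obtain ⟨u, hu, hub, huc, huc', ψ, hψ, h⟩ := h
  obtain ⟨v, hv, hvb, hvc, hvc', ψ', hψ', h'⟩ := h'
  let _ := E.bundle.top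
  let _ := F.top
  let _ := E'.bundle.top
  let _ := F'.top
  let _ := fibProdTop F.top F'.top
  let _ := fibProdTop E.bundle.top E'.bundle.top
  let _ := (F.sum F').top
  let _ := (E.sum E').bundle.top
  refine ⟨fun x => (u x).prodCongr (v x), fun x a e => Prod.ext (hu x a e.1) (hv x a e.2),
    fun x e => Prod.ext (hub x e.1) (hvb x e.2),
    continuous_toProd (huc.comp (continuous_left _ _)) (hvc.comp (continuous_right _ _)),
    continuous_toProd (huc'.comp (continuous_left _ _)) (hvc'.comp (continuous_right _ _)),
    ψ.sum ψ', fun x e => ?_, fun x e e' => ?_⟩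
  · -- Sums of positive elements are positive in a real `C^*`-algebra.
    exact IsPos.add (hψ x e.1) (hψ' x e.2)
  · exact congrArg₂ (· + ·) (h x e.1 e'.1) (h' x e.2 e'.2)

/-- Isomorphism classes of forms correspond to isomorphism classes of Real bundles over
`𝒜 ⊗ ℝ[t]/(t² = ε)`. -/
theorem exists_classEquiv [T2Space X] [ParacompactSpace X] (𝒜 : RealStarAlgBundle σ A)
    (hε : ε * ε = 1) :
    ∃ f : FormBundleClass 𝒜 ε ≃+ RealBundleClass (𝒜.adjoinRoot ε),
      ∀ (E : FormBundle 𝒜 ε) (F : RealBundle (𝒜.adjoinRoot ε)), Represents E F →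
        f ⟦E⟧ = ⟦F⟧ := by
  choose r hr using exists_represents_left (𝒜 := 𝒜) hε
  let f : FormBundleClass 𝒜 ε → RealBundleClass (𝒜.adjoinRoot ε) :=
    Quotient.lift (fun E => ⟦r E⟧) fun E E' ⟨i⟩ =>
      Quotient.sound ((hr E).unique_right hε ((hr E').of_iso_left i))
  have hf : ∀ E F, Represents E F → f ⟦E⟧ = ⟦F⟧ := fun E F h =>
    Quotient.sound ((hr E).unique_right hε h)
  have hbij : Function.Bijective f := by
    constructor
    · rintro ⟨E⟩ ⟨E'⟩ h
      obtain ⟨i⟩ := Quotient.exact h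
      exact Quotient.sound (((hr E).of_iso_right i).unique_left hε (hr E'))
    · rintro ⟨F⟩
      obtain ⟨E, h⟩ := exists_represents_right hε F
      exact ⟨⟦E⟧, hf E F h⟩
  refine ⟨AddEquiv.mk (Equiv.ofBijective f hbij) ?_, hf⟩
  rintro ⟨E⟩ ⟨E'⟩
  exact hf _ _ ((hr E).sum (hr E'))

end Unique

end

section

variable {X : Type v} [TopologicalSpace X] {σ : Involution X}

/-! ### The algebra bundles `𝒜 ⊗ ℝ[t]/(t² = ±1)` -/

section Tensor

variable {A : Type u} [Ring A] [Algebra ℝ A] [TopologicalSpace A]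

theorem contract_tensor_map {R : Type u} [Ring R] [Algebra ℝ R] {B C : Type} [Ring B] [Algebra ℝ B]
    [Ring C] [Algebra ℝ C] (g : B →ₐ[ℝ] C) (f : C →ₗ[ℝ] ℝ) (z : R ⊗[ℝ] B) :
    contract R f (Algebra.TensorProduct.map (AlgHom.id ℝ R) g z) =
      contract R (f ∘ₗ g.toLinearMap) z := by
  induction z using TensorProduct.induction_on with
  | zero => simp
  | tmul a b => simp [contract]
  | add z w hz hw => simp only [map_add, hz, hw]

theorem RealAlgBundle.continuous_tensor_map (𝒜 : RealAlgBundle σ A) {B C : Type} [Ring B]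
    [Algebra ℝ B] [Ring C] [Algebra ℝ C] (g : B →ₐ[ℝ] C) :
    Continuous[𝒜.tensorTop B, 𝒜.tensorTop C] fun p =>
      (⟨p.proj, Algebra.TensorProduct.map (AlgHom.id ℝ (𝒜.fib p.proj)) g p.snd⟩ :
        Tot fun x => 𝒜.fib x ⊗[ℝ] C) := by
  let _ := 𝒜.top
  let _ := 𝒜.tensorTop B
  refine continuous_iInf_rng.2 fun f => continuous_induced_rng.2 ?_
  refine (𝒜.continuous_contract B (f ∘ₗ g.toLinearMap)).congr fun p => ?_
  exact congrArg (Bundle.TotalSpace.mk _) (contract_tensor_map g f p.snd).symm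

/-- Functoriality of `𝒜 ⊗ B` in `B`. -/
noncomputable def RealAlgBundle.tensorCongr (𝒜 : RealAlgBundle σ A) {B C : Type} [Ring B]
    [Algebra ℝ B] [Ring C] [Algebra ℝ C] (g : B ≃ₐ[ℝ] C) :
    RealAlgBundle.Iso (𝒜.tensor B) (𝒜.tensor C) where
  toEquiv x := Algebra.TensorProduct.congr AlgEquiv.refl g
  continuous_toFun := 𝒜.continuous_tensor_map g.toAlgHom
  continuous_invFun := 𝒜.continuous_tensor_map g.symm.toAlgHom
  map_bar x (z : 𝒜.fib x ⊗[ℝ] B) := by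
    change Algebra.TensorProduct.map (AlgHom.id ℝ _) g.toAlgHom
      (Algebra.TensorProduct.map (𝒜.bar x) (AlgHom.id ℝ B) z) =
      Algebra.TensorProduct.map (𝒜.bar x) (AlgHom.id ℝ C)
        (Algebra.TensorProduct.map (AlgHom.id ℝ _) g.toAlgHom z)
    induction z using TensorProduct.induction_on with
    | zero => simp
    | tmul a b => simp
    | add z w hz hw => simp only [map_add, hz, hw]

end Tensor

/-- `ℝ[t]/(t² = -1)` is the field of complex numbers. -/
noncomputable def rootAlgComplex : RootAlg (-1) ≃ₐ[ℝ] ℂ :=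
  AlgEquiv.ofBijective
    (AdjoinRoot.liftAlgHom _ (Algebra.ofId ℝ ℂ) Complex.I (by
      simp [Complex.I_sq]))
    (by
      have h : ∀ a b : ℝ, AdjoinRoot.liftAlgHom (Polynomial.X ^ 2 - Polynomial.C (-1) : ℝ[X])
          (Algebra.ofId ℝ ℂ) Complex.I (by simp [Complex.I_sq]) (a • 1 + b • rootElt (-1)) =
          ⟨a, b⟩ := fun a b => by
        rw [map_add, map_smul, map_smul, map_one, AdjoinRoot.liftAlgHom_root]
        apply Complex.ext <;> simp
      refine ⟨fun q q' hq => ?_, fun z => ⟨_, h z.re z.im⟩⟩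
      rw [rootAlg_eq q, rootAlg_eq q'] at hq ⊢
      rw [h, h, Complex.mk.injEq] at hq
      rw [hq.1, hq.2])

section Split

theorem contract_add_sub {R : Type u} [Ring R] [Algebra ℝ R] {B : Type} [Ring B] [Algebra ℝ B]
    (f g : B →ₗ[ℝ] ℝ) (z : R ⊗[ℝ] B) :
    contract R (f + g) z = contract R f z + contract R g z ∧
      contract R (f - g) z = contract R f z - contract R g z := by
  induction z using TensorProduct.induction_on with
  | zero => simp
  | tmul a b => simp [contract_tmul, add_smul, sub_smul]
  | add z w hz hw =>
    simp only [map_add, hz.1, hz.2, hw.1, hw.2]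
    constructor <;> abel

/-- For `t² = 1`, the algebra `R ⊗ ℝ[t]/(t² = 1)` is `R × R`, the element `t` being `(1, -1)`. -/
noncomputable def splitEquiv (R : Type u) [Ring R] [Algebra ℝ R] :
    R ⊗[ℝ] RootAlg 1 ≃ₐ[ℝ] R × R where
  toFun z := (re z + im z, re z - im z)
  invFun p := ((1 / 2 : ℝ) • (p.1 + p.2)) ⊗ₜ 1 + ((1 / 2 : ℝ) • (p.1 - p.2)) ⊗ₜ rootElt 1
  left_inv z := by
    apply root_ext
    · rw [re_add, re_tmul_one, re_tmul_root]
      module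
    · rw [im_add, im_tmul_one, im_tmul_root]
      module
  right_inv p := by
    dsimp only
    rw [re_add, re_tmul_one, re_tmul_root, im_add, im_tmul_one, im_tmul_root]
    refine Prod.ext ?_ ?_ <;> dsimp only <;> module
  map_mul' z w := by
    rw [re_mul, im_mul, one_smul]
    refine Prod.ext ?_ ?_ <;>
      simp only [Prod.mk_mul_mk, add_mul, mul_add, sub_mul, mul_sub] <;> abel
  map_add' z w := by
    rw [re_add, im_add]
    refine Prod.ext ?_ ?_ <;> simp only [Prod.mk_add_mk] <;> abel
  commutes' r := by
    have h : algebraMap ℝ (R ⊗[ℝ] RootAlg 1) r = algebraMap ℝ R r ⊗ₜ 1 := rfl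
    rw [h, re_tmul_one, im_tmul_one]
    simp [Prod.algebraMap_apply]

variable {A : Type u} [NormedRing A] [NormedAlgebra ℝ A] [CompleteSpace A] [StarRing A]
  [StarModule ℝ A] [RealCStar A]

theorem RealStarAlgBundle.continuous_comb (𝒜 : RealStarAlgBundle σ A) (r s : ℝ) :
    Continuous[fibProdTop 𝒜.top 𝒜.top, 𝒜.top]
      fun p => (⟨p.proj, r • p.snd.1 + s • p.snd.2⟩ : Tot 𝒜.fib) := by
  let _ := 𝒜.top
  let _ := fibProdTop 𝒜.top 𝒜.top
  exact 𝒜.continuous_add.comp (f := fun p : Tot fun x => 𝒜.fib x × 𝒜.fib x =>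
    (⟨p.proj, (r • p.snd.1, s • p.snd.2)⟩ : Tot fun x => 𝒜.fib x × 𝒜.fib x))
    (continuous_toProd ((𝒜.continuous_const_smul r).comp (continuous_left _ _))
      ((𝒜.continuous_const_smul s).comp (continuous_right _ _)))

/-- The isomorphism of `𝒜 ⊗ ℝ[t]/(t² = 1)` with `𝒜 × 𝒜`. -/
noncomputable def RealStarAlgBundle.splitIso (𝒜 : RealStarAlgBundle σ A) :
    RealAlgBundle.Iso (𝒜.adjoinRoot 1) (𝒜.toRealAlgBundle.prod 𝒜.toRealAlgBundle) where
  toEquiv x := splitEquiv (𝒜.fib x)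
  continuous_toFun := by
    let _ := 𝒜.top
    let _ := (𝒜.adjoinRoot 1).top
    let _ := 𝒜.tensorTop (RootAlg 1)
    refine continuous_toProd (tE := 𝒜.top) (tF := 𝒜.top)
      ((𝒜.continuous_contract (RootAlg 1) (rootCoeff 1 0 + rootCoeff 1 1)).congr fun p => ?_)
      ((𝒜.continuous_contract (RootAlg 1) (rootCoeff 1 0 - rootCoeff 1 1)).congr fun p => ?_)
    · exact congrArg (Bundle.TotalSpace.mk _) (contract_add_sub _ _ _).1
    · exact congrArg (Bundle.TotalSpace.mk _) (contract_add_sub _ _ _).2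
  continuous_invFun := by
    let _ := 𝒜.top
    let _ := fibProdTop 𝒜.top 𝒜.top
    refine continuous_iInf_rng.2 fun f => continuous_induced_rng.2 ?_
    refine (𝒜.continuous_comb (1 / 2 * (f 1 + f (rootElt 1))) (1 / 2 * (f 1 - f (rootElt 1)))).congr
      fun p => congrArg (Bundle.TotalSpace.mk _) ?_
    change _ = contract (𝒜.fib p.proj) f (((1 / 2 : ℝ) • (p.snd.1 + p.snd.2)) ⊗ₜ 1 +
      ((1 / 2 : ℝ) • (p.snd.1 - p.snd.2)) ⊗ₜ rootElt 1)
    rw [map_add, contract_tmul, contract_tmul]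
    module
  map_bar x (z : 𝒜.fib x ⊗[ℝ] RootAlg 1) := by
    change (re (Algebra.TensorProduct.map (𝒜.bar x) (AlgHom.id ℝ (RootAlg 1)) z) +
      im (Algebra.TensorProduct.map (𝒜.bar x) (AlgHom.id ℝ (RootAlg 1)) z),
      re (Algebra.TensorProduct.map (𝒜.bar x) (AlgHom.id ℝ (RootAlg 1)) z) -
      im (Algebra.TensorProduct.map (𝒜.bar x) (AlgHom.id ℝ (RootAlg 1)) z)) =
      (𝒜.bar x (re z + im z), 𝒜.bar x (re z - im z))
    rw [re_map, im_map, map_add, map_sub]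

end Split

end

end TwistedK

theorem mainTheorem2 {X : Type*} [TopologicalSpace X] [T2Space X] [ParacompactSpace X]
    (σ : TwistedK.Involution X)
    {A : Type*} [NormedRing A] [NormedAlgebra ℝ A] [CompleteSpace A] [StarRing A]
    [StarModule ℝ A] (hA : TwistedK.IsRealCStarAlgebra A)
    (𝒜 : TwistedK.RealStarAlgBundle σ A) (ε : ℝ) (hε : ε = 1 ∨ ε = -1) :
    (∃! Φ : TwistedK.GR 𝒜 ε ≃+ TwistedK.KR (𝒜.adjoinRoot ε),
      ∀ (E : TwistedK.FormBundle 𝒜 ε) (F : TwistedK.RealBundle (𝒜.adjoinRoot ε)),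
        TwistedK.Represents E F → Φ E.toGR = F.toKR) ∧
    (ε = 1 → Nonempty (TwistedK.RealAlgBundle.Iso (𝒜.adjoinRoot ε)
      (𝒜.toRealAlgBundle.prod 𝒜.toRealAlgBundle))) ∧
    (ε = -1 → Nonempty (TwistedK.RealAlgBundle.Iso (𝒜.adjoinRoot ε) (𝒜.tensor ℂ))) := by
  have hε' : ε * ε = 1 := by rcases hε with rfl | rfl <;> norm_num
  have := hA.realCStar
  refine ⟨?_, ?_, ?_⟩
  · obtain ⟨f, hf⟩ := TwistedK.exists_classEquiv 𝒜 hε'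
    refine ⟨TwistedK.grothendieckCongr f, fun E F h => ?_, fun Ψ hΨ => ?_⟩
    · exact (TwistedK.grothendieckCongr_of f _).trans (congrArg _ (hf E F h))
    · refine AddEquiv.toAddMonoidHom_injective
        (TwistedK.grothendieck_hom_ext ?_)
      rintro ⟨E⟩
      obtain ⟨F, h⟩ := TwistedK.exists_represents_left hε' E
      exact (hΨ E F h).trans
        ((TwistedK.grothendieckCongr_of f _).trans (congrArg _ (hf E F h))).symm
  · rintro rfl
    exact ⟨𝒜.splitIso⟩
  · rintro rfl
    exact ⟨𝒜.tensorCongr TwistedK.rootAlgComplex⟩
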